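/- Let $(\Lambda V,d)$ be a Sullivan algebra over $\mathbb{Q}$, i.e. a commutative differential graded algebra $(\Lambda V, d)$ with $\Lambda V=\mathrm{Sym}(V^{\mathrm{even}})\otimes\mathrm{Ext}(V^{\mathrm{odd}})$ for a graded rational vector space $V=V^{\ge 1}$ which is the union of an increasing sequence $V(0)\subseteq V(1)\subseteq\dots$ of graded subspaces with $d|_{V(0)}=0$ and $d(V(k+1))\subseteq\Lambda V(k)$. Let $d_0\colon V\to V$ be the linear part of $d$, determined by $\operatorname{im}(d-d_0)\subseteq\Lambda^{\ge 2}V$ on $V$, and let $\pi_n:=H^n(V,d_0)$ denote the (dual) rational homotopy of $(\Lambda V,d)$ (so $\pi_n=V^n$ if $(\Lambda V,d)$ is minimal, i.e. $\operatorname{im} d\subseteq\Lambda^{\ge 2}V$). Suppose that $(\Lambda V,d)$ is elliptic, i.e. simply connected ($H^1(\Lambda V,d)=0$) with $\dim H^*(\Lambda V,d)<\infty$ and $\dim \pi_*<\infty$, and that $\dim \pi_{\mathrm{odd}}=2$ and $\dim \pi_{\mathrm{even}}=1$. Then $(\Lambda V,d)$ is formal, i.e. it is connected to its cohomology algebra $(H^*(\Lambda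 V,d),0)$ by a finite zigzag of quasi-isomorphisms of commutative differential graded algebras. Moreover, there are an integer $k\ge 2$ and generators $x$ of even degree and $y,z$ of odd degree, with $\deg y>1$, such that the algebra $$(\Lambda\langle x,z\rangle,\ dx=0,\ dz=x^k)\otimes(\Lambda\langle y\rangle,0)$$ is a minimal model of $(\Lambda V,d)$, i.e. admits a quasi-isomorphism to $(\Lambda V,d)$; if $(\Lambda V,d)$ is itself minimal, then it is isomorphic to this algebra. -/

import Mathlib

open scoped TensorProduct DirectSum

universe u v

noncomputable section

/-- A commutative differential graded algebra (commutative cochain algebra) over `ℚ`,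
graded in degrees `0, 1, 2, …`, with differential of degree `+1`. -/
structure CDGA where
  /-- the underlying algebra -/
  carrier : Type u
  [ring : Ring carrier]
  [algebra : Algebra ℚ carrier]
  /-- the subspace of homogeneous elements of degree `n` -/
  gr : ℕ → Submodule ℚ carrier
  [graded : GradedAlgebra gr]
  /-- the differential -/
  d : carrier →ₗ[ℚ] carrier
  d_mem : ∀ (n : ℕ) (a : carrier), a ∈ gr n → d a ∈ gr (n + 1)
  d_d : ∀ a : carrier, d (d a) = 0
  leibniz : ∀ (m : ℕ) (a b : carrier), a ∈ gr m →
    d (a * b) = d a * b + (-1 : ℚ) ^ m • (a * d b)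
  graded_comm : ∀ (m n : ℕ) (a b : carrier), a ∈ gr m → b ∈ gr n →
    a * b = (-1 : ℚ) ^ (m * n) • (b * a)

namespace CDGA

instance : CoeSort CDGA.{u} (Type u) := ⟨CDGA.carrier⟩

attribute [instance] CDGA.ring CDGA.algebra CDGA.graded

/-- A family of submodules is an internal direct sum decomposition as soon as it spans and
admits linear projections. -/
theorem isInternal_of_proj {M : Type u} [AddCommGroup M] [Module ℚ M] (G : ℕ → Submodule ℚ M)
    (p : ℕ → M →ₗ[ℚ] M) (hp : ∀ n, ∀ x ∈ G n, p n x = x)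
    (hp' : ∀ m n, m ≠ n → ∀ x ∈ G m, p n x = 0) (htop : ⨆ n, G n = ⊤) :
    DirectSum.IsInternal G := by
  rw [DirectSum.isInternal_submodule_iff_iSupIndep_and_iSup_eq_top]
  refine ⟨?_, htop⟩
  intro n
  rw [Submodule.disjoint_def]
  intro x hx hx'
  rw [← hp n x hx]
  have hle : (⨆ j, ⨆ (_ : j ≠ n), G j) ≤ LinearMap.ker (p n) :=
    iSup₂_le fun j hj y hy => hp' j n hj y hy
  exact hle hx'

section Cohomology

variable (A : CDGA.{u})

/-- The projection of `A` to its part of degree `n`. -/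
def proj (n : ℕ) : A →ₗ[ℚ] A := GradedAlgebra.proj A.gr n

variable {A}

theorem proj_mem (n : ℕ) (a : A) : A.proj n a ∈ A.gr n := by
  simp [proj, GradedAlgebra.proj_apply]

theorem proj_of_mem {n : ℕ} {a : A} (h : a ∈ A.gr n) : A.proj n a = a := by
  rw [proj, GradedAlgebra.proj_apply, DirectSum.decompose_of_mem_same _ h]

theorem proj_of_mem_ne {m n : ℕ} (hmn : m ≠ n) {a : A} (h : a ∈ A.gr m) : A.proj n a = 0 := by
  rw [proj, GradedAlgebra.proj_apply, DirectSum.decompose_of_mem_ne _ h hmn]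

theorem sum_proj (a : A) : ∃ s : Finset ℕ, a = ∑ n ∈ s, A.proj n a := by
  classical
  exact ⟨_, (DirectSum.sum_support_decompose A.gr a).symm⟩

theorem induction_gr {P : A → Prop} (hadd : ∀ a b, P a → P b → P (a + b)) (hzero : P 0)
    (hgr : ∀ n, ∀ a ∈ A.gr n, P a) (a : A) : P a :=
  DirectSum.Decomposition.inductionOn A.gr hzero (fun m => hgr _ _ m.2) hadd a

theorem proj_d (n : ℕ) (a : A) : A.proj (n + 1) (A.d a) = A.d (A.proj n a) := by
  refine induction_gr (P := fun a => A.proj (n + 1) (A.d a) = A.d (A.proj n a)) ?_ ?_ ?_ a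
  · intro a b ha hb
    simp only [map_add, ha, hb]
  · simp
  · intro m a ha
    by_cases h : m = n
    · subst h
      rw [proj_of_mem ha, proj_of_mem (A.d_mem _ _ ha)]
    · rw [proj_of_mem_ne h ha, proj_of_mem_ne (by omega) (A.d_mem _ _ ha), map_zero]

theorem proj_zero_d (a : A) : A.proj 0 (A.d a) = 0 := by
  refine induction_gr (P := fun a => A.proj 0 (A.d a) = 0) ?_ ?_ ?_ a
  · intro a b ha hb
    simp only [map_add, ha, hb, add_zero]
  · simp
  · intro m a ha
    exact proj_of_mem_ne (by omega) (A.d_mem _ _ ha)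

theorem d_proj_of_d_eq_zero {a : A} (h : A.d a = 0) (n : ℕ) : A.d (A.proj n a) = 0 := by
  rw [← proj_d, h, map_zero]

theorem mul_d_of_d_eq_zero {a : A} (h : A.d a = 0) (b : A) : ∃ c, A.d c = a * A.d b := by
  obtain ⟨s, hs⟩ := sum_proj a
  refine ⟨∑ n ∈ s, (-1 : ℚ) ^ n • (A.proj n a * b), ?_⟩
  conv_rhs => rw [hs]
  rw [map_sum, Finset.sum_mul]
  refine Finset.sum_congr rfl fun n _ => ?_
  rw [map_smul, A.leibniz n _ _ (proj_mem n a), d_proj_of_d_eq_zero h, zero_mul, zero_add,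
    smul_smul, ← mul_pow]
  simp

theorem d_mul_of_d_eq_zero {a : A} (h : A.d a = 0) (b : A) : A.d (b * a) = A.d b * a := by
  refine induction_gr (P := fun b => A.d (b * a) = A.d b * a) ?_ ?_ ?_ b
  · intro b c hb hc
    simp only [add_mul, map_add, hb, hc]
  · simp
  · intro m b hb
    rw [A.leibniz m _ _ hb, h, mul_zero, smul_zero, add_zero]

theorem d_one : A.d 1 = 0 := by
  have h := A.leibniz 0 1 1 SetLike.GradedOne.one_mem
  simpa using h

variable (A)

/-- The subalgebra `ker d` of cocycles. -/
def cocycles : Subalgebra ℚ A where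
  carrier := {a | A.d a = 0}
  mul_mem' {a b} ha hb := by
    change A.d (a * b) = 0
    rw [d_mul_of_d_eq_zero hb, show A.d a = 0 from ha, zero_mul]
  add_mem' {a b} ha hb := by
    change A.d (a + b) = 0
    rw [map_add, show A.d a = 0 from ha, show A.d b = 0 from hb, add_zero]
  algebraMap_mem' r := by
    change A.d (algebraMap ℚ A r) = 0
    rw [Algebra.algebraMap_eq_smul_one, map_smul, d_one, smul_zero]

/-- The ideal `im d` of coboundaries in the algebra of cocycles. -/
def coboundaries : Ideal A.cocycles where
  carrier := {z | ∃ b : A, A.d b = z}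
  add_mem' := by
    rintro x y ⟨b, hb⟩ ⟨c, hc⟩
    exact ⟨b + c, by rw [map_add, hb, hc]; rfl⟩
  zero_mem' := ⟨0, by simp⟩
  smul_mem' := by
    rintro z x ⟨b, hb⟩
    obtain ⟨c, hc⟩ := mul_d_of_d_eq_zero z.2 b
    exact ⟨c, by rw [hc, hb]; rfl⟩

instance : A.coboundaries.IsTwoSided where
  mul_mem_of_left := by
    rintro x z ⟨b, hb⟩
    exact ⟨b * z, by rw [d_mul_of_d_eq_zero z.2, hb]; rfl⟩

/-- The cohomology algebra `H(A) = ker d / im d`, as an algebra. -/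
abbrev CohomologyAlgebra : Type u := A.cocycles ⧸ A.coboundaries

/-- The cohomology class of a cocycle. -/
def cohomologyClass : A.cocycles →ₐ[ℚ] A.CohomologyAlgebra := Ideal.Quotient.mkₐ ℚ A.coboundaries

/-- `H^n(A)`: the classes of the cocycles of degree `n`. -/
def cohomologyGr (n : ℕ) : Submodule ℚ A.CohomologyAlgebra :=
  ((A.gr n).comap A.cocycles.val.toLinearMap).map A.cohomologyClass.toLinearMap

variable {A}

theorem cohomologyClass_surjective : Function.Surjective A.cohomologyClass :=
  Ideal.Quotient.mk_surjective

theorem cohomologyClass_eq_zero {z : A.cocycles} :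
    A.cohomologyClass z = 0 ↔ ∃ b : A, A.d b = z := by
  change Ideal.Quotient.mk A.coboundaries z = 0 ↔ _
  rw [Ideal.Quotient.eq_zero_iff_mem]
  rfl

theorem mem_cohomologyGr {n : ℕ} {x : A.CohomologyAlgebra} :
    x ∈ A.cohomologyGr n ↔ ∃ z : A.cocycles, (z : A) ∈ A.gr n ∧ A.cohomologyClass z = x :=
  Iff.rfl

variable (A)

/-- The projection of the cocycles to degree `n`. -/
def cocyclesProj (n : ℕ) : A.cocycles →ₗ[ℚ] A.cocycles where
  toFun z := ⟨A.proj n z, d_proj_of_d_eq_zero z.2 n⟩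
  map_add' x y := Subtype.ext (by simp)
  map_smul' r x := Subtype.ext (by simp)

/-- The projection of the cohomology to degree `n`. -/
def cohomologyProj (n : ℕ) : A.CohomologyAlgebra →ₗ[ℚ] A.CohomologyAlgebra :=
  (A.coboundaries.restrictScalars ℚ).liftQ
    (A.cohomologyClass.toLinearMap ∘ₗ A.cocyclesProj n) (by
      rintro z ⟨b, hb⟩
      rw [LinearMap.mem_ker]
      change A.cohomologyClass (A.cocyclesProj n z) = 0
      rw [cohomologyClass_eq_zero]
      change ∃ b : A, A.d b = A.proj n z
      rw [← hb]
      cases n with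
      | zero => exact ⟨0, by rw [proj_zero_d, map_zero]⟩
      | succ n => exact ⟨A.proj n b, by rw [proj_d]⟩)

variable {A}

theorem cohomologyProj_class (n : ℕ) (z : A.cocycles) :
    A.cohomologyProj n (A.cohomologyClass z) = A.cohomologyClass (A.cocyclesProj n z) := rfl

variable (A)

theorem cohomologyGr_isInternal : DirectSum.IsInternal A.cohomologyGr := by
  refine isInternal_of_proj _ A.cohomologyProj ?_ ?_ ?_
  · rintro n _ ⟨z, hz, rfl⟩
    change A.cohomologyProj n (A.cohomologyClass z) = A.cohomologyClass z
    rw [cohomologyProj_class]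
    exact congrArg _ (Subtype.ext (proj_of_mem hz))
  · rintro m n hmn _ ⟨z, hz, rfl⟩
    change A.cohomologyProj n (A.cohomologyClass z) = 0
    rw [cohomologyProj_class, show A.cocyclesProj n z = 0 from
      Subtype.ext (proj_of_mem_ne hmn hz), map_zero]
  · rw [eq_top_iff]
    rintro x -
    obtain ⟨z, rfl⟩ := cohomologyClass_surjective x
    obtain ⟨s, hs⟩ := sum_proj (z : A)
    have hz : z = ∑ n ∈ s, A.cocyclesProj n z := by
      apply Subtype.ext
      rw [AddSubmonoidClass.coe_finsetSum]
      exact hs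
    rw [hz, map_sum]
    refine Submodule.sum_mem _ fun n _ => ?_
    exact Submodule.mem_iSup_of_mem n ⟨A.cocyclesProj n z, proj_mem n _, rfl⟩

instance : SetLike.GradedMonoid A.cohomologyGr where
  one_mem := ⟨1, SetLike.GradedOne.one_mem (A := A.gr), map_one A.cohomologyClass⟩
  mul_mem := by
    rintro i j _ _ ⟨x, hx, rfl⟩ ⟨y, hy, rfl⟩
    exact ⟨x * y, SetLike.GradedMul.mul_mem (A := A.gr) hx hy, map_mul A.cohomologyClass x y⟩

instance : GradedAlgebra A.cohomologyGr :=
  { A.cohomologyGr_isInternal.chooseDecomposition with }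

/-- The cohomology algebra `(H(A), 0)` as a commutative differential graded algebra with
vanishing differential. -/
def cohomology : CDGA.{u} where
  carrier := A.CohomologyAlgebra
  gr := A.cohomologyGr
  d := 0
  d_mem _ _ _ := Submodule.zero_mem _
  d_d _ := rfl
  leibniz _ _ _ _ := by simp
  graded_comm := by
    rintro m n _ _ ⟨x, hx, rfl⟩ ⟨y, hy, rfl⟩
    change A.cohomologyClass x * A.cohomologyClass y =
      (-1 : ℚ) ^ (m * n) • (A.cohomologyClass y * A.cohomologyClass x)
    rw [← map_mul, ← map_mul, ← map_smul]
    exact congrArg _ (Subtype.ext (A.graded_comm m n _ _ hx hy))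

end Cohomology

/-- A morphism of commutative differential graded algebras: an algebra homomorphism of degree `0`
commuting with the differentials. -/
structure Hom (A : CDGA.{u}) (B : CDGA.{v}) where
  /-- the underlying algebra homomorphism -/
  toAlgHom : A →ₐ[ℚ] B
  map_mem : ∀ (n : ℕ) (a : A), a ∈ A.gr n → toAlgHom a ∈ B.gr n
  map_d : ∀ a : A, toAlgHom (A.d a) = B.d (toAlgHom a)

namespace Hom

variable {A : CDGA.{u}} {B : CDGA.{v}} (f : Hom A B)

/-- The restriction of a morphism to cocycles. -/
def cocyclesMap : A.cocycles →ₐ[ℚ] B.cocycles :=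
  (f.toAlgHom.comp A.cocycles.val).codRestrict B.cocycles fun z => by
    change B.d (f.toAlgHom z) = 0
    rw [← f.map_d, show A.d z = 0 from z.2, map_zero]

/-- The algebra homomorphism `H(f) : H(A) → H(B)` induced by a morphism `f : A → B`. -/
def cohomologyMap : A.cohomology →ₐ[ℚ] B.cohomology :=
  Ideal.Quotient.liftₐ A.coboundaries (B.cohomologyClass.comp f.cocyclesMap) (by
    rintro z ⟨b, hb⟩
    change B.cohomologyClass (f.cocyclesMap z) = 0
    rw [cohomologyClass_eq_zero]
    exact ⟨f.toAlgHom b, by rw [← f.map_d, hb]; rfl⟩)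

/-- A quasi-isomorphism is a morphism that induces an isomorphism in cohomology. -/
def IsQuasiIso : Prop := Function.Bijective f.cohomologyMap

end Hom

/-- Two commutative differential graded algebras are isomorphic if there is a bijective morphism
between them. -/
def IsIsomorphic (A : CDGA.{u}) (B : CDGA.{v}) : Prop :=
  ∃ f : Hom A B, Function.Bijective f.toAlgHom

/-- Weak equivalence: connected by a finite zigzag of quasi-isomorphisms. -/
def WeaklyEquivalent : CDGA.{u} → CDGA.{u} → Prop :=
  Relation.EqvGen fun A B => ∃ f : Hom A B, f.IsQuasiIso

/-- `A` is formal if it is weakly equivalent to its cohomology algebra `(H(A), 0)`. -/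
def IsFormal (A : CDGA.{u}) : Prop := WeaklyEquivalent A A.cohomology

section Tensor

variable (A : CDGA.{u}) (B : CDGA.{v})

/-- The underlying algebra of the tensor product, with multiplication
`(a ⊗ b) (a' ⊗ b') = (-1) ^ (deg b * deg a') (a a') ⊗ (b b')`. -/
abbrev TensorAlg : Type (max u v) := GradedTensorProduct ℚ A.gr B.gr

variable {A B} in
/-- The element `a ⊗ b`. -/
abbrev tm (a : A) (b : B) : TensorAlg A B := GradedTensorProduct.tmul ℚ a b

/-- The part of degree `n` of `A ⊗ B` is spanned by the `a ⊗ b` with `deg a + deg b = n`. -/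
def tensorGr (n : ℕ) : Submodule ℚ (TensorAlg A B) :=
  Submodule.span ℚ {t | ∃ i j : ℕ, i + j = n ∧ ∃ a ∈ A.gr i, ∃ b ∈ B.gr j, tm a b = t}

/-- The sign involution `a ↦ (-1) ^ (deg a) a`. -/
def signInv : A →ₗ[ℚ] A :=
  (DirectSum.decomposeLinearEquiv A.gr).symm.toLinearMap ∘ₗ
    DirectSum.lmap (fun n => (-1 : ℚ) ^ n • LinearMap.id) ∘ₗ
      (DirectSum.decomposeLinearEquiv A.gr).toLinearMap

/-- The differential of the tensor product, `d (a ⊗ b) = d a ⊗ b + (-1) ^ (deg a) a ⊗ d b`. -/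
def tensorD : TensorAlg A B →ₗ[ℚ] TensorAlg A B :=
  (GradedTensorProduct.of ℚ A.gr B.gr).toLinearMap ∘ₗ
    (TensorProduct.map A.d LinearMap.id + TensorProduct.map A.signInv B.d) ∘ₗ
      (GradedTensorProduct.of ℚ A.gr B.gr).symm.toLinearMap

variable {A B}

theorem signInv_of_mem {m : ℕ} {a : A} (h : a ∈ A.gr m) : A.signInv a = (-1 : ℚ) ^ m • a := by
  lift a to A.gr m using h
  simp only [signInv, LinearMap.comp_apply, LinearEquiv.coe_coe,
    DirectSum.decomposeLinearEquiv_apply_coe, DirectSum.lmap_lof]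
  simp

theorem tensorD_tm {m : ℕ} {a : A} (h : a ∈ A.gr m) (b : B) :
    tensorD A B (tm a b) = tm (A.d a) b + (-1 : ℚ) ^ m • tm a (B.d b) := by
  change GradedTensorProduct.of ℚ A.gr B.gr (A.d a ⊗ₜ b + A.signInv a ⊗ₜ B.d b) = _
  rw [signInv_of_mem h, map_add, ← TensorProduct.smul_tmul', map_smul]

theorem tm_mul_tm {j i : ℕ} (a : A) {b : B} (hb : b ∈ B.gr j) {a' : A} (ha : a' ∈ A.gr i)
    (b' : B) : tm a b * tm a' b' = (-1 : ℚ) ^ (j * i) • tm (a * a') (b * b') := by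
  have h := GradedTensorProduct.tmul_coe_mul_coe_tmul (R := ℚ) A.gr B.gr a ⟨b, hb⟩ ⟨a', ha⟩ b'
  refine h.trans ?_
  rw [Units.smul_def, ← Int.cast_smul_eq_zsmul ℚ]
  simp

theorem tm_mem {i j n : ℕ} (hn : i + j = n) {a : A} (ha : a ∈ A.gr i) {b : B}
    (hb : b ∈ B.gr j) : tm a b ∈ tensorGr A B n :=
  Submodule.subset_span ⟨i, j, hn, a, ha, b, hb, rfl⟩

theorem tensor_induction {P : TensorAlg A B → Prop} (hzero : P 0)
    (hadd : ∀ s t, P s → P t → P (s + t))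
    (htm : ∀ i j, ∀ a ∈ A.gr i, ∀ b ∈ B.gr j, P (tm a b)) (t : TensorAlg A B) : P t := by
  refine TensorProduct.induction_on (motive := P) t hzero (fun a b => ?_) hadd
  refine induction_gr (P := fun a => P (tm a b)) ?_ ?_ ?_ a
  · intro a a' h h'
    change P (GradedTensorProduct.of ℚ A.gr B.gr ((a + a') ⊗ₜ b))
    rw [TensorProduct.add_tmul, map_add]
    exact hadd _ _ h h'
  · change P (GradedTensorProduct.of ℚ A.gr B.gr (0 ⊗ₜ b))
    rw [TensorProduct.zero_tmul, map_zero]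
    exact hzero
  · intro i a ha
    refine induction_gr (P := fun b => P (tm a b)) ?_ ?_ ?_ b
    · intro b b' h h'
      change P (GradedTensorProduct.of ℚ A.gr B.gr (a ⊗ₜ (b + b')))
      rw [TensorProduct.tmul_add, map_add]
      exact hadd _ _ h h'
    · change P (GradedTensorProduct.of ℚ A.gr B.gr (a ⊗ₜ 0))
      rw [TensorProduct.tmul_zero, map_zero]
      exact hzero
    · exact fun j b hb => htm i j a ha b hb

variable (A B)

/-- The projection of the tensor product to degree `n`. -/
def tensorProj (n : ℕ) : TensorAlg A B →ₗ[ℚ] TensorAlg A B :=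
  (GradedTensorProduct.of ℚ A.gr B.gr).toLinearMap ∘ₗ
    (∑ ij ∈ Finset.HasAntidiagonal.antidiagonal n, TensorProduct.map (A.proj ij.1) (B.proj ij.2)) ∘ₗ
      (GradedTensorProduct.of ℚ A.gr B.gr).symm.toLinearMap

variable {A B}

theorem tensorProj_tm (n : ℕ) {i j : ℕ} {a : A} (ha : a ∈ A.gr i) {b : B} (hb : b ∈ B.gr j) :
    tensorProj A B n (tm a b) = if i + j = n then tm a b else 0 := by
  change GradedTensorProduct.of ℚ A.gr B.gr
    ((∑ ij ∈ Finset.HasAntidiagonal.antidiagonal n, TensorProduct.map (A.proj ij.1) (B.proj ij.2)) (a ⊗ₜ b)) = _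
  rw [LinearMap.sum_apply]
  simp only [TensorProduct.map_tmul]
  have key : ∀ ij ∈ Finset.HasAntidiagonal.antidiagonal n, ij ≠ (i, j) →
      A.proj ij.1 a ⊗ₜ[ℚ] B.proj ij.2 b = 0 := by
    rintro ⟨i', j'⟩ - hne
    by_cases h : i = i'
    · have h' : j ≠ j' := fun h' => hne (by rw [h, h'])
      rw [proj_of_mem_ne h' hb, TensorProduct.tmul_zero]
    · rw [proj_of_mem_ne h ha, TensorProduct.zero_tmul]
  split_ifs with hn
  · rw [Finset.sum_eq_single_of_mem (i, j) (Finset.HasAntidiagonal.mem_antidiagonal.mpr hn) key, proj_of_mem ha,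
      proj_of_mem hb]
  · rw [Finset.sum_eq_zero, map_zero]
    intro ij hij
    refine key ij hij ?_
    rintro rfl
    exact hn (Finset.HasAntidiagonal.mem_antidiagonal.mp hij)

variable (A B)

theorem tensorGr_isInternal : DirectSum.IsInternal (tensorGr A B) := by
  refine isInternal_of_proj _ (tensorProj A B) ?_ ?_ ?_
  · intro n x hx
    induction hx using Submodule.span_induction with
    | mem x h =>
      obtain ⟨i, j, hn, a, ha, b, hb, rfl⟩ := h
      rw [tensorProj_tm n ha hb, if_pos hn]
    | zero => exact map_zero _
    | add x y _ _ hx hy => rw [map_add, hx, hy]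
    | smul r x _ hx => rw [map_smul, hx]
  · intro m n hmn x hx
    induction hx using Submodule.span_induction with
    | mem x h =>
      obtain ⟨i, j, hm, a, ha, b, hb, rfl⟩ := h
      rw [tensorProj_tm n ha hb, if_neg (by omega)]
    | zero => exact map_zero _
    | add x y _ _ hx hy => rw [map_add, hx, hy, add_zero]
    | smul r x _ hx => rw [map_smul, hx, smul_zero]
  · rw [eq_top_iff]
    rintro x -
    refine tensor_induction (P := fun x => x ∈ ⨆ n, tensorGr A B n) (Submodule.zero_mem _)
      (fun s t => Submodule.add_mem _) ?_ x
    exact fun i j a ha b hb => Submodule.mem_iSup_of_mem (i + j) (tm_mem rfl ha hb)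

instance : SetLike.GradedMonoid (tensorGr A B) where
  one_mem := tm_mem (add_zero 0) (a := (1 : A)) (b := (1 : B)) SetLike.GradedOne.one_mem
    SetLike.GradedOne.one_mem
  mul_mem := by
    intro m n x y hx hy
    induction hx using Submodule.span_induction with
    | mem x h =>
      obtain ⟨i, j, hm, a, ha, b, hb, rfl⟩ := h
      induction hy using Submodule.span_induction with
      | mem y h =>
        obtain ⟨i', j', hn, a', ha', b', hb', rfl⟩ := h
        rw [tm_mul_tm a hb ha' b']
        exact Submodule.smul_mem _ _ (tm_mem (by omega) (SetLike.GradedMul.mul_mem ha ha')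
          (SetLike.GradedMul.mul_mem hb hb'))
      | zero => rw [mul_zero]; exact Submodule.zero_mem _
      | add x y _ _ hx hy => rw [mul_add]; exact Submodule.add_mem _ hx hy
      | smul r x _ hx => rw [mul_smul_comm]; exact Submodule.smul_mem _ _ hx
    | zero => rw [zero_mul]; exact Submodule.zero_mem _
    | add x y _ _ hx hy => rw [add_mul]; exact Submodule.add_mem _ hx hy
    | smul r x _ hx => rw [smul_mul_assoc]; exact Submodule.smul_mem _ _ hx

instance : GradedAlgebra (tensorGr A B) :=
  { (tensorGr_isInternal A B).chooseDecomposition with }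

theorem tm_add (a : A) (b b' : B) : tm a (b + b') = tm a b + tm a b' := by
  exact congrArg (GradedTensorProduct.of ℚ A.gr B.gr) (TensorProduct.tmul_add a b b')

theorem add_tm (a a' : A) (b : B) : tm (a + a') b = tm a b + tm a' b := by
  exact congrArg (GradedTensorProduct.of ℚ A.gr B.gr) (TensorProduct.add_tmul a a' b)

theorem tm_smul (r : ℚ) (a : A) (b : B) : tm a (r • b) = r • tm a b := by
  exact congrArg (GradedTensorProduct.of ℚ A.gr B.gr) (TensorProduct.tmul_smul r a b)

theorem smul_tm (r : ℚ) (a : A) (b : B) : tm (r • a) b = r • tm a b := by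
  exact congrArg (GradedTensorProduct.of ℚ A.gr B.gr) (TensorProduct.smul_tmul' r a b).symm

theorem tm_zero (a : A) : tm a (0 : B) = 0 := by
  exact congrArg (GradedTensorProduct.of ℚ A.gr B.gr) (TensorProduct.tmul_zero B a)

theorem zero_tm (b : B) : tm (0 : A) b = 0 := by
  exact congrArg (GradedTensorProduct.of ℚ A.gr B.gr) (TensorProduct.zero_tmul A b)

/-- The tensor product `A ⊗ B` of commutative differential graded algebras. -/
def tensor : CDGA.{max u v} where
  carrier := TensorAlg A B
  gr := tensorGr A B
  d := tensorD A B
  d_mem := by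
    intro n x hx
    induction hx using Submodule.span_induction with
    | mem x h =>
      obtain ⟨i, j, hn, a, ha, b, hb, rfl⟩ := h
      rw [tensorD_tm ha]
      exact Submodule.add_mem _ (tm_mem (by omega) (A.d_mem _ _ ha) hb)
        (Submodule.smul_mem _ _ (tm_mem (by omega) ha (B.d_mem _ _ hb)))
    | zero => rw [map_zero]; exact Submodule.zero_mem _
    | add x y _ _ hx hy => rw [map_add]; exact Submodule.add_mem _ hx hy
    | smul r x _ hx => rw [map_smul]; exact Submodule.smul_mem _ _ hx
  d_d := by
    refine tensor_induction ?_ ?_ ?_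
    · simp
    · intro s t hs ht
      rw [map_add, map_add, hs, ht, add_zero]
    · intro i j a ha b hb
      rw [tensorD_tm ha, map_add, map_smul, tensorD_tm ha, tensorD_tm (A.d_mem _ _ ha), A.d_d,
        B.d_d, zero_tm, tm_zero, pow_succ]
      simp
  leibniz := by
    intro m x y hx
    induction hx using Submodule.span_induction with
    | mem x h =>
      obtain ⟨i, j, hm, a, ha, b, hb, rfl⟩ := h
      refine tensor_induction (P := fun y => tensorD A B (tm a b * y) =
        tensorD A B (tm a b) * y + (-1 : ℚ) ^ m • (tm a b * tensorD A B y)) ?_ ?_ ?_ y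
      · simp
      · intro s t hs ht
        simp only [mul_add, map_add, smul_add, hs, ht]
        abel
      · intro i' j' a' ha' b' hb'
        rw [tm_mul_tm a hb ha', map_smul, tensorD_tm (SetLike.GradedMul.mul_mem ha ha'),
          tensorD_tm ha, tensorD_tm ha', add_mul, mul_add, smul_mul_assoc, mul_smul_comm,
          tm_mul_tm _ hb ha', tm_mul_tm _ (B.d_mem _ _ hb) ha', tm_mul_tm _ hb ha',
          tm_mul_tm _ hb (A.d_mem _ _ ha'), A.leibniz i _ _ ha, B.leibniz j _ _ hb]
        simp only [tm_add, add_tm, tm_smul, smul_tm, smul_add, smul_smul]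
        subst hm
        have h1 : (-1 : ℚ) ^ j * (-1 : ℚ) ^ j = 1 := by rw [← mul_pow]; simp
        have e1 : (-1 : ℚ) ^ (j * i') * (-1) ^ i = (-1) ^ (i + j) * (-1) ^ (j * (i' + 1)) := by
          rw [mul_add, pow_add, pow_add, mul_one]
          linear_combination (-(-1 : ℚ) ^ (j * i') * (-1) ^ i) * h1
        have e2 : (-1 : ℚ) ^ (j * i') * (-1) ^ (i + i') = (-1) ^ i * (-1) ^ ((j + 1) * i') := by
          rw [add_mul, pow_add, pow_add, one_mul]
          ring
        have e3 : (-1 : ℚ) ^ i * (-1) ^ ((j + 1) * i') * (-1) ^ j =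
            (-1) ^ (i + j) * (-1) ^ i' * (-1) ^ (j * i') := by
          rw [add_mul, pow_add, pow_add, one_mul]
          ring
        simp only [← mul_assoc]
        rw [e1, e2, e3]
        abel
    | zero => simp
    | add x x' _ _ hx hx' =>
      simp only [add_mul, map_add, smul_add, hx, hx']
      abel
    | smul r x _ hx =>
      simp only [smul_mul_assoc, map_smul, hx, smul_add]
      rw [smul_comm r]
  graded_comm := by
    intro m n x y hx hy
    induction hx using Submodule.span_induction with
    | mem x h =>
      obtain ⟨i, j, hm, a, ha, b, hb, rfl⟩ := h
      induction hy using Submodule.span_induction with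
      | mem y h =>
        obtain ⟨i', j', hn, a', ha', b', hb', rfl⟩ := h
        rw [tm_mul_tm _ hb ha', tm_mul_tm _ hb' ha, A.graded_comm _ _ _ _ ha ha',
          B.graded_comm _ _ _ _ hb hb', tm_smul, smul_tm, smul_smul, smul_smul, smul_smul]
        congr 1
        subst hm hn
        have h1 : (-1 : ℚ) ^ (j' * i) * (-1 : ℚ) ^ (j' * i) = 1 := by rw [← mul_pow]; simp
        rw [show (i + j) * (i' + j') = j * i' + i * i' + j * j' + j' * i by ring]
        simp only [pow_add]
        linear_combination (-(-1 : ℚ) ^ (j * i') * (-1) ^ (i * i') * (-1) ^ (j * j')) * h1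
      | zero => simp
      | add x y _ _ hx hy => simp only [mul_add, add_mul, smul_add, hx, hy]
      | smul r x _ hx =>
        rw [mul_smul_comm, smul_mul_assoc, hx, smul_comm r]
    | zero => simp
    | add x y _ _ hx hy => simp only [mul_add, add_mul, smul_add, hx, hy]
    | smul r x _ hx =>
      rw [mul_smul_comm, smul_mul_assoc, hx, smul_comm r]

end Tensor

section Free

variable (A : CDGA.{u})

/-- The span `V^even` of the homogeneous subspaces of even degree. -/
def evenPart (V : ℕ → Submodule ℚ A) : Submodule ℚ A := ⨆ n : {n : ℕ // Even n}, V n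

/-- The span `V^odd` of the homogeneous subspaces of odd degree. -/
def oddPart (V : ℕ → Submodule ℚ A) : Submodule ℚ A := ⨆ n : {n : ℕ // Odd n}, V n

/-- `A = ΛV` as a graded algebra: `V` is a graded subspace of `A` concentrated in positive degrees,
and the inclusion of `V` extends to an isomorphism of algebras from the tensor product of the
symmetric algebra on `V^even` and the exterior algebra on `V^odd` onto `A`. -/
structure IsFreeOn (V : ℕ → Submodule ℚ A) : Prop where
  le_gr : ∀ n, V n ≤ A.gr n
  zero_eq_bot : V 0 = ⊥
  exists_equiv : ∃ φ : (SymmetricAlgebra ℚ (A.evenPart V) ⊗[ℚ] ExteriorAlgebra ℚ (A.oddPart V))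
      ≃ₐ[ℚ] A,
    (∀ v : A.evenPart V, φ (SymmetricAlgebra.ι ℚ _ v ⊗ₜ 1) = v) ∧
      ∀ w : A.oddPart V, φ (1 ⊗ₜ ExteriorAlgebra.ι ℚ w) = w

/-- `A = Λ⟨g₀, g₁, …⟩` as a graded algebra, with the linearly independent generators `g i`
homogeneous of degree `deg i`. -/
structure IsFreelyGeneratedBy {ι : Type} (g : ι → A) (deg : ι → ℕ) : Prop where
  linearIndependent : LinearIndependent ℚ g
  isFreeOn : A.IsFreeOn fun n => Submodule.span ℚ {a | ∃ i, deg i = n ∧ g i = a}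

end Free

end CDGA

/-- A Sullivan algebra `(ΛV, d)`: a commutative differential graded algebra that is free on a graded
subspace `V = V^{≥ 1}` which is the union of an increasing sequence `F 0 ⊆ F 1 ⊆ …` of graded
subspaces with `d = 0` on `F 0` and `d (F (k + 1)) ⊆ Λ (F k)`. -/
structure SullivanAlgebra extends CDGA.{u} where
  /-- the part of degree `n` of the space of generators -/
  V : ℕ → Submodule ℚ toCDGA
  isFreeOn : toCDGA.IsFreeOn V
  nilpotent : ∃ F : ℕ → ℕ → Submodule ℚ toCDGA,
    (∀ k n, F k n ≤ F (k + 1) n) ∧ (∀ n, ⨆ k, F k n = V n) ∧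
    (∀ n, ∀ v ∈ F 0 n, d v = 0) ∧
    ∀ k n, ∀ v ∈ F (k + 1) n, d v ∈ Algebra.adjoin ℚ {w : toCDGA | ∃ m, w ∈ F k m}

namespace SullivanAlgebra

variable (S : SullivanAlgebra.{u})

/-- The ideal `Λ⁺V` of elements of positive degree. -/
def positivePart : Submodule ℚ S.toCDGA := ⨆ n : {n : ℕ // 0 < n}, S.gr n

/-- The space `Λ^{≥ 2} V = Λ⁺V · Λ⁺V` of decomposable elements. -/
def decomposables : Submodule ℚ S.toCDGA := S.positivePart * S.positivePart

/-- `(ΛV, d)` is minimal if the image of `d` consists of decomposable elements. -/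
def IsMinimal : Prop := ∀ a : S.toCDGA, S.d a ∈ S.decomposables

/-- The kernel in degree `n` of the linear part `d₀ : V → V` of the differential, where `d₀ v` is
the element of `V` with `d v - d₀ v ∈ Λ^{≥ 2} V`. -/
def linearCocycles (n : ℕ) : Submodule ℚ S.toCDGA := S.V n ⊓ S.decomposables.comap S.d

/-- The image in degree `n` of the linear part of the differential: the `w ∈ V ^ n` with
`d v - w ∈ Λ^{≥ 2} V` for some `v ∈ V ^ (n - 1)`; note that `V ^ 0 = 0`. -/
def linearCoboundaries (n : ℕ) : Submodule ℚ S.toCDGA :=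
  S.V n ⊓ ((S.V (n - 1)).map S.d ⊔ S.decomposables)

/-- `H ^ n (V, d₀)`, the (dual) rational homotopy in degree `n` of `(ΛV, d)`; it is `V ^ n` if
`(ΛV, d)` is minimal. -/
abbrev homotopy (n : ℕ) : Type u :=
  S.linearCocycles n ⧸ (S.linearCoboundaries n).comap (S.linearCocycles n).subtype

/-- The rational homotopy in even degrees. -/
abbrev evenHomotopy : Type u := ⨁ n : {n : ℕ // Even n}, S.homotopy n

/-- The rational homotopy in odd degrees. -/
abbrev oddHomotopy : Type u := ⨁ n : {n : ℕ // Odd n}, S.homotopy n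

/-- `(ΛV, d)` is elliptic if it is simply connected and its rational homotopy and its cohomology
are both finite-dimensional. -/
structure IsElliptic : Prop where
  simplyConnected : S.cohomology.gr 1 = ⊥
  finite_evenHomotopy : Module.Finite ℚ S.evenHomotopy
  finite_oddHomotopy : Module.Finite ℚ S.oddHomotopy
  finite_cohomology : Module.Finite ℚ S.cohomology

end SullivanAlgebra

end

/-! The proof passes to a minimal model inside `ΛV`, reads off its differential from degrees, and
checks formality on the result.

Minimal model. Choose a contraction `t` of `(V, d₀)`, that is, a map of degree `-1` for which `d₀ t
+ t d₀` is a projection with kernel representing `H(V, d₀)`, and extend it to a derivation `θ` of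
`ΛV` (`IsFreeOn.exists_contraction`). Then `L = dθ + θd` is an ordinary derivation of degree `0`
that commutes with `d`. On words of length `n`, modulo longer words, `L` acts diagonalizably with
natural numbers as eigenvalues, and in a given degree long words vanish. So every element is killed
by some `X ^ N * ρ` with `ρ(0) ≠ 0` evaluated at `L` (`exists_annihilator`), and `ΛV` is the
generalized kernel of `L` plus a part on which `L` is invertible. The second part is acyclic because
`L` is null-homotopic. The generalized kernel, `minimalPart`, is therefore a subalgebra stable under
`d` whose inclusion is a quasi-isomorphism. It is generated by lifts of a basis of `H(V, d₀)`
(`IsHomotopyBasis.exists_generators`), and these satisfy no relations beyond graded commutativity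
(`IsFreeOn.injective_of_independent`). If `ΛV` is minimal, then `θ = 0` and nothing is thrown away.

Differential. There are three generators, `x` even and `y`, `z` odd, with decomposable
differentials. Simple connectivity excludes odd generators of degree `1` (`one_lt`). For degree
reasons then `dx = 0`, and `dy`, `dz` are multiples of powers of `x` with exponent at least `2`.
They cannot both vanish, since otherwise all powers of `x` would survive to cohomology
(`not_finite_cohomology`). After possibly exchanging `y` and `z`, the power in `dz` divides the one
in `dy`, so that subtracting a multiple of `x ^ j * z` from `y` makes it a cocycle
(`exists_normal_form`).

Formality. In `Λ⟨x, z⟩ ⊗ Λ⟨y⟩` with `dz = x ^ k` all cocycles lie in `Λ⟨x, y⟩`. Hence the map to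
cohomology with `x ↦ [x]`, `y ↦ [y]`, `z ↦ 0` sends each cocycle to its class and is a
quasi-isomorphism (`isFormal_of_isQuasiIso`). -/

namespace CDGA

/-! ### Homogeneous components and the sign involution. -/

section Graded

variable {A : CDGA.{u}}

theorem one_mem_gr : (1 : A) ∈ A.gr 0 := SetLike.GradedOne.one_mem

theorem mul_mem_gr {i j : ℕ} {a b : A} (ha : a ∈ A.gr i) (hb : b ∈ A.gr j) :
    a * b ∈ A.gr (i + j) := SetLike.GradedMul.mul_mem ha hb

theorem pow_mem_gr {i : ℕ} {a : A} (ha : a ∈ A.gr i) (n : ℕ) : a ^ n ∈ A.gr (n * i) := by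
  induction n with
  | zero => simpa using one_mem_gr
  | succ n ih =>
    rw [pow_succ, add_mul, one_mul]
    exact mul_mem_gr ih ha

theorem eq_zero_of_proj {a : A} (h : ∀ n, A.proj n a = 0) : a = 0 := by
  obtain ⟨s, hs⟩ := sum_proj a
  rw [hs]
  exact Finset.sum_eq_zero fun n _ => h n

/-- Linear maps that agree on homogeneous elements agree. -/
theorem linearMap_ext_gr {M : Type*} [AddCommGroup M] [Module ℚ M] {f g : A →ₗ[ℚ] M}
    (h : ∀ n, ∀ a ∈ A.gr n, f a = g a) : f = g := by
  ext a
  refine induction_gr (P := fun a => f a = g a) ?_ ?_ h a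
  · intro a b ha hb
    rw [map_add, map_add, ha, hb]
  · simp

/-- A linear map defined degree by degree. -/
theorem exists_linearMap_gr {M : Type*} [AddCommGroup M] [Module ℚ M] (f : ℕ → A →ₗ[ℚ] M) :
    ∃ g : A →ₗ[ℚ] M, ∀ n, ∀ a ∈ A.gr n, g a = f n a := by
  refine ⟨DirectSum.toModule ℚ ℕ M (fun n => f n ∘ₗ (A.gr n).subtype) ∘ₗ
    (DirectSum.decomposeLinearEquiv A.gr).toLinearMap, ?_⟩
  intro n a ha
  lift a to A.gr n using ha
  rw [LinearMap.comp_apply, LinearEquiv.coe_coe, DirectSum.decomposeLinearEquiv_apply_coe,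
    DirectSum.toModule_lof]
  rfl

theorem mem_span_of_mem_gr {ι : Type*} {g : ι → A} {deg : ι → ℕ} (hg : ∀ i, g i ∈ A.gr (deg i))
    {a : A} (ha : a ∈ Submodule.span ℚ (Set.range g)) {n : ℕ} (hn : a ∈ A.gr n) :
    a ∈ Submodule.span ℚ {b | ∃ i, deg i = n ∧ g i = b} := by
  rw [← proj_of_mem hn]
  clear hn
  induction ha using Submodule.span_induction with
  | mem x h =>
    obtain ⟨i, rfl⟩ := h
    by_cases h : deg i = n
    · rw [proj_of_mem (h ▸ hg i)]
      exact Submodule.subset_span ⟨i, h, rfl⟩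
    · rw [proj_of_mem_ne h (hg i)]
      exact Submodule.zero_mem _
  | zero => rw [map_zero]; exact Submodule.zero_mem _
  | add x y _ _ hx hy => rw [map_add]; exact Submodule.add_mem _ hx hy
  | smul r x _ hx => rw [map_smul]; exact Submodule.smul_mem _ _ hx

/-- The sign involution is an algebra automorphism that anticommutes with `d`. With it the Leibniz
rule holds without homogeneity assumptions, and its eigenvalues `1` and `-1` stand for even and odd
degree. -/
theorem signInv_mul (a b : A) : A.signInv (a * b) = A.signInv a * A.signInv b := by
  refine induction_gr (P := fun a => A.signInv (a * b) = A.signInv a * A.signInv b) ?_ ?_ ?_ a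
  · intro a a' h h'
    rw [add_mul, map_add, map_add, add_mul, h, h']
  · simp
  · intro m a ha
    refine induction_gr (P := fun b => A.signInv (a * b) = A.signInv a * A.signInv b) ?_ ?_ ?_ b
    · intro b b' h h'
      rw [mul_add, map_add, map_add, mul_add, h, h']
    · simp
    · intro n b hb
      rw [signInv_of_mem ha, signInv_of_mem hb, signInv_of_mem (mul_mem_gr ha hb), pow_add,
        smul_mul_smul_comm]

theorem signInv_signInv (a : A) : A.signInv (A.signInv a) = a := by
  refine induction_gr (P := fun a => A.signInv (A.signInv a) = a) ?_ ?_ ?_ a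
  · intro a a' h h'
    rw [map_add, map_add, h, h']
  · simp
  · intro m a ha
    rw [signInv_of_mem ha, map_smul, signInv_of_mem ha, smul_smul, ← mul_pow]
    simp

theorem signInv_one : A.signInv 1 = 1 := by
  rw [signInv_of_mem one_mem_gr]
  simp

theorem signInv_mem {n : ℕ} {a : A} (h : a ∈ A.gr n) : A.signInv a ∈ A.gr n := by
  rw [signInv_of_mem h]
  exact Submodule.smul_mem _ _ h

theorem signInv_d (a : A) : A.signInv (A.d a) = -A.d (A.signInv a) := by
  refine induction_gr (P := fun a => A.signInv (A.d a) = -A.d (A.signInv a)) ?_ ?_ ?_ a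
  · intro a a' h h'
    simp only [map_add, h, h', neg_add]
  · simp
  · intro m a ha
    rw [signInv_of_mem ha, signInv_of_mem (A.d_mem _ _ ha), map_smul, pow_succ]
    simp

theorem d_mul (a b : A) : A.d (a * b) = A.d a * b + A.signInv a * A.d b := by
  refine induction_gr (P := fun a => A.d (a * b) = A.d a * b + A.signInv a * A.d b) ?_ ?_ ?_ a
  · intro a a' h h'
    simp only [map_add, h, h', add_mul]
    abel
  · simp
  · intro m a ha
    rw [A.leibniz m a b ha, signInv_of_mem ha, smul_mul_assoc]

theorem commute_of_signInv_eq {a : A} (ha : A.signInv a = a) (b : A) : Commute a b := by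
  -- `a + A.signInv a` is twice the even part of `a`, so that this identity, unlike the claim
  -- itself, is additive in `a` and can be checked on homogeneous elements.
  have key : ∀ a b : A, (a + A.signInv a) * b = b * (a + A.signInv a) := by
    intro a b
    refine induction_gr (P := fun a => (a + A.signInv a) * b = b * (a + A.signInv a)) ?_ ?_ ?_ a
    · intro a a' h h'
      rw [map_add, add_add_add_comm, add_mul, mul_add, h, h']
    · simp
    · intro m a ha
      rw [signInv_of_mem ha]
      rcases Nat.even_or_odd m with hm | hm
      · refine induction_gr (P := fun b => (a + (-1 : ℚ) ^ m • a) * b =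
          b * (a + (-1 : ℚ) ^ m • a)) ?_ ?_ ?_ b
        · intro b b' h h'
          rw [mul_add, add_mul b b', h, h']
        · simp
        · intro n b hb
          rw [hm.neg_one_pow, one_smul, add_mul, mul_add, A.graded_comm m n a b ha hb,
            (hm.mul_right n).neg_one_pow, one_smul]
      · rw [hm.neg_one_pow]
        simp
  have h := key a b
  rw [ha, ← two_smul ℚ a, smul_mul_assoc, mul_smul_comm] at h
  exact smul_right_injective _ (two_ne_zero (α := ℚ)) h

theorem mul_eq_neg_of_signInv_eq_neg {a b : A} (ha : A.signInv a = -a) (hb : A.signInv b = -b) :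
    a * b = -(b * a) := by
  -- As for even elements: `a - A.signInv a` is twice the odd part.
  have key : ∀ a b : A, (a - A.signInv a) * (b - A.signInv b) =
      -((b - A.signInv b) * (a - A.signInv a)) := by
    intro a b
    refine induction_gr (P := fun a => (a - A.signInv a) * (b - A.signInv b) =
      -((b - A.signInv b) * (a - A.signInv a))) ?_ ?_ ?_ a
    · intro a a' h h'
      rw [map_add, add_sub_add_comm, add_mul, mul_add, h, h', neg_add]
    · simp
    · intro m a ha
      refine induction_gr (P := fun b => (a - A.signInv a) * (b - A.signInv b) =
        -((b - A.signInv b) * (a - A.signInv a))) ?_ ?_ ?_ b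
      · intro b b' h h'
        rw [map_add, add_sub_add_comm, mul_add, add_mul, h, h', neg_add]
      · simp
      · intro n b hb
        rw [signInv_of_mem ha, signInv_of_mem hb]
        rcases Nat.even_or_odd m with hm | hm
        · rw [hm.neg_one_pow]; simp
        rcases Nat.even_or_odd n with hn | hn
        · rw [hn.neg_one_pow]; simp
        have h := A.graded_comm m n a b ha hb
        rw [(hm.mul hn).neg_one_pow, neg_smul, one_smul] at h
        rw [hm.neg_one_pow, hn.neg_one_pow]
        simp only [neg_smul, one_smul, sub_neg_eq_add, add_mul, mul_add, h]
        abel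
  have h := key a b
  rw [ha, hb, sub_neg_eq_add, sub_neg_eq_add, ← two_smul ℚ a, ← two_smul ℚ b,
    smul_mul_smul_comm, smul_mul_smul_comm, ← smul_neg] at h
  exact smul_right_injective _ (by norm_num : (2 * 2 : ℚ) ≠ 0) h

theorem mul_self_of_signInv_eq_neg {a : A} (ha : A.signInv a = -a) : a * a = 0 := by
  have h := mul_eq_neg_of_signInv_eq_neg ha ha
  have h2 : (2 : ℚ) • (a * a) = 0 := by
    rw [two_smul]
    nth_rewrite 1 [h]
    exact neg_add_cancel _
  exact (smul_eq_zero.mp h2).resolve_left two_ne_zero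

theorem signInv_even {n : ℕ} (hn : Even n) {a : A} (ha : a ∈ A.gr n) : A.signInv a = a := by
  rw [signInv_of_mem ha, hn.neg_one_pow, one_smul]

theorem signInv_odd {n : ℕ} (hn : Odd n) {a : A} (ha : a ∈ A.gr n) : A.signInv a = -a := by
  rw [signInv_of_mem ha, hn.neg_one_pow, neg_smul, one_smul]

end Graded

/-! ### The word length filtration by powers of the augmentation ideal. -/

section Pos

variable (A : CDGA.{u})

/-- The ideal `A⁺` of elements of positive degree. -/
def pos : Submodule ℚ A := ⨆ n : {n : ℕ // 0 < n}, A.gr n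

/-- The elements all of whose components have degree at least `n`. -/
def lowerBound (n : ℕ) : Submodule ℚ A := ⨅ m : Fin n, LinearMap.ker (A.proj m)

variable {A}

theorem mem_lowerBound {n : ℕ} {a : A} : a ∈ A.lowerBound n ↔ ∀ m < n, A.proj m a = 0 := by
  simp only [lowerBound, Submodule.mem_iInf, LinearMap.mem_ker]
  exact ⟨fun h m hm => h ⟨m, hm⟩, fun h m => h m m.2⟩

theorem mem_lowerBound_of_mem_gr {m n : ℕ} (h : n ≤ m) {a : A} (ha : a ∈ A.gr m) :
    a ∈ A.lowerBound n :=
  mem_lowerBound.mpr fun i hi => proj_of_mem_ne (by omega) ha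

theorem pos_eq_lowerBound : A.pos = A.lowerBound 1 := by
  apply le_antisymm
  · exact iSup_le fun n a ha => mem_lowerBound_of_mem_gr n.2 ha
  · intro a ha
    obtain ⟨s, hs⟩ := sum_proj a
    rw [hs]
    refine Submodule.sum_mem _ fun n _ => ?_
    rcases Nat.eq_zero_or_pos n with rfl | hn
    · rw [mem_lowerBound.mp ha 0 one_pos]
      exact Submodule.zero_mem _
    · exact Submodule.mem_iSup_of_mem (⟨n, hn⟩ : {n : ℕ // 0 < n}) (proj_mem _ _)

theorem mem_pos {a : A} : a ∈ A.pos ↔ A.proj 0 a = 0 := by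
  rw [pos_eq_lowerBound, mem_lowerBound]
  simp

theorem mem_pos_of_mem_gr {n : ℕ} (hn : 0 < n) {a : A} (ha : a ∈ A.gr n) : a ∈ A.pos :=
  mem_pos.mpr (proj_of_mem_ne hn.ne' ha)

theorem mul_mem_lowerBound {i j : ℕ} {a b : A} (ha : a ∈ A.lowerBound i)
    (hb : b ∈ A.lowerBound j) : a * b ∈ A.lowerBound (i + j) := by
  obtain ⟨s, hs⟩ := sum_proj a
  obtain ⟨t, ht⟩ := sum_proj b
  rw [hs, ht, Finset.sum_mul]
  refine Submodule.sum_mem _ fun m _ => ?_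
  rw [Finset.mul_sum]
  refine Submodule.sum_mem _ fun n _ => ?_
  by_cases hm : m < i
  · rw [mem_lowerBound.mp ha m hm, zero_mul]
    exact Submodule.zero_mem _
  by_cases hn : n < j
  · rw [mem_lowerBound.mp hb n hn, mul_zero]
    exact Submodule.zero_mem _
  exact mem_lowerBound_of_mem_gr (by omega) (mul_mem_gr (proj_mem _ _) (proj_mem _ _))

theorem lowerBound_anti {i j : ℕ} (h : i ≤ j) : A.lowerBound j ≤ A.lowerBound i := fun _ ha =>
  mem_lowerBound.mpr fun m hm => mem_lowerBound.mp ha m (by omega)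

theorem pos_pow_le_lowerBound (n : ℕ) : A.pos ^ n ≤ A.lowerBound n := by
  induction n with
  | zero => exact fun a _ => mem_lowerBound.mpr (by simp)
  | succ n ih =>
    rw [pow_succ, Submodule.mul_le]
    intro a ha b hb
    exact mul_mem_lowerBound (ih ha) (pos_eq_lowerBound (A := A) ▸ hb)

/-- Each factor from `A.pos` contributes at least `1` to the degree. So the word length filtration
is finite in each degree, which makes every successive approximation below terminate. -/
theorem eq_zero_of_mem_pos_pow {m n : ℕ} (h : m < n) {a : A} (ha : a ∈ A.gr m)
    (hn : a ∈ A.pos ^ n) : a = 0 := by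
  rw [← proj_of_mem ha]
  exact mem_lowerBound.mp (pos_pow_le_lowerBound n hn) m h

theorem eq_zero_of_forall_mem_pos_pow {a : A} (h : ∀ n, 1 ≤ n → a ∈ A.pos ^ n) : a = 0 :=
  eq_zero_of_proj fun n =>
    mem_lowerBound.mp (pos_pow_le_lowerBound (n + 1) (h _ (by omega))) n (by omega)

theorem pos_mul_pos_le : A.pos * A.pos ≤ A.pos := by
  rw [Submodule.mul_le]
  intro a ha b hb
  rw [pos_eq_lowerBound] at *
  exact lowerBound_anti (by omega) (mul_mem_lowerBound ha hb)

/-- The zeroth power is `ℚ · 1`, which need not contain `A.pos`; the filtration is decreasing only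
from exponent `1` on. -/
theorem pos_pow_anti {i j : ℕ} (hi : 1 ≤ i) (h : i ≤ j) : A.pos ^ j ≤ A.pos ^ i := by
  induction j, h using Nat.le_induction with
  | base => exact le_rfl
  | succ j hij ih =>
    refine le_trans ?_ ih
    obtain ⟨k, rfl⟩ : ∃ k, j = k + 1 := ⟨j - 1, by omega⟩
    rw [pow_succ, pow_succ, mul_assoc]
    exact mul_le_mul' le_rfl pos_mul_pos_le

/-- The twist `σ` is the sign involution for the odd derivations `d` and `θ` and the identity for
`dθ + θd`. -/
theorem map_pos_pow_le {T σ : A →ₗ[ℚ] A} (hT : ∀ a b, T (a * b) = T a * b + σ a * T b)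
    (hσ : ∀ n, ∀ a ∈ A.pos ^ n, σ a ∈ A.pos ^ n) (hpos : ∀ a ∈ A.pos, T a ∈ A.pos)
    {n : ℕ} (hn : 1 ≤ n) {a : A} (ha : a ∈ A.pos ^ n) : T a ∈ A.pos ^ n := by
  induction n, hn using Nat.le_induction generalizing a with
  | base => rw [pow_one] at *; exact hpos a ha
  | succ n hn ih =>
    rw [pow_succ] at ha ⊢
    induction ha using Submodule.mul_induction_on' with
    | mem_mul_mem a ha b hb =>
      rw [hT]
      exact Submodule.add_mem _ (Submodule.mul_mem_mul (ih ha) hb)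
        (Submodule.mul_mem_mul (hσ n a ha) (hpos b hb))
    | add a _ b _ ha hb => rw [map_add]; exact Submodule.add_mem _ ha hb

theorem map_mul_pos_pow_le {B : Type*} [Ring B] [Algebra ℚ B] (f : A →ₐ[ℚ] B) {N : Submodule ℚ B}
    (h : ∀ a ∈ A.pos, f a ∈ N) {n : ℕ} {a : A} (ha : a ∈ A.pos ^ n) : f a ∈ N ^ n := by
  have : (A.pos ^ n).map f.toLinearMap ≤ N ^ n := by
    rw [Submodule.map_pow]
    refine pow_le_pow_left' ?_ n
    rintro _ ⟨b, hb, rfl⟩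
    exact h b hb
  exact this ⟨a, ha, rfl⟩

theorem signInv_mem_pos {a : A} (ha : a ∈ A.pos) : A.signInv a ∈ A.pos := by
  induction ha using Submodule.iSup_induction' with
  | mem n a ha => exact mem_pos_of_mem_gr n.2 (signInv_mem ha)
  | zero => rw [map_zero]; exact Submodule.zero_mem _
  | add a b _ _ ha hb => rw [map_add]; exact Submodule.add_mem _ ha hb

theorem signInv_mem_pos_pow {n : ℕ} {a : A} (ha : a ∈ A.pos ^ n) : A.signInv a ∈ A.pos ^ n :=
  map_mul_pos_pow_le (AlgHom.ofLinearMap A.signInv signInv_one signInv_mul)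
    (fun _ => signInv_mem_pos) ha

theorem d_mem_pos (a : A) : A.d a ∈ A.pos := mem_pos.mpr (proj_zero_d a)

theorem d_mem_pos_pow {n : ℕ} (hn : 1 ≤ n) {a : A} (ha : a ∈ A.pos ^ n) : A.d a ∈ A.pos ^ n :=
  map_pos_pow_le d_mul (fun _ _ => signInv_mem_pos_pow) (fun a _ => d_mem_pos a) hn ha

end Pos

/-! ### Algebras generated in positive degrees. -/

section Generated

variable {A : CDGA.{u}}

/-- An algebra generated by a space `G` is `ℚ + K` for every `K` that contains `G` and is closed
under multiplication. -/
theorem mem_one_sup_of_adjoin {G K : Submodule ℚ A} (hGK : G ≤ K) (hK : K * K ≤ K)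
    (htop : Algebra.adjoin ℚ (G : Set A) = ⊤) (a : A) : a ∈ (1 : Submodule ℚ A) ⊔ K := by
  have ha : a ∈ Algebra.adjoin ℚ (G : Set A) := htop ▸ Algebra.mem_top
  induction ha using Algebra.adjoin_induction with
  | mem x hx => exact Submodule.mem_sup_right (hGK hx)
  | algebraMap r => exact Submodule.mem_sup_left (Submodule.algebraMap_mem r)
  | add x y _ _ hx hy => exact Submodule.add_mem _ hx hy
  | mul x y _ _ hx hy =>
    obtain ⟨r, hr, v, hv, rfl⟩ := Submodule.mem_sup.mp hx
    obtain ⟨r', hr', v', hv', rfl⟩ := Submodule.mem_sup.mp hy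
    obtain ⟨r, rfl⟩ := Submodule.mem_one.mp hr
    obtain ⟨r', rfl⟩ := Submodule.mem_one.mp hr'
    rw [add_mul, mul_add, mul_add, ← map_mul, ← Algebra.smul_def, ← Algebra.commutes,
      ← Algebra.smul_def, add_assoc]
    exact Submodule.add_mem_sup (Submodule.algebraMap_mem _) (Submodule.add_mem _
      (Submodule.smul_mem _ _ hv') (Submodule.add_mem _ (Submodule.smul_mem _ _ hv)
        (hK (Submodule.mul_mem_mul hv hv'))))

/-- An induction principle for `A.pos`: a linear condition that is stable under products needs to be
checked on generators only. Comparing components of degree `0` removes the constant term. -/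
theorem pos_le_of_adjoin_of_mul_le {G K : Submodule ℚ A} (hGK : G ≤ K) (hK : K * K ≤ K)
    (hpos : K ≤ A.pos) (htop : Algebra.adjoin ℚ (G : Set A) = ⊤) : A.pos ≤ K := by
  intro a ha
  obtain ⟨_, hr, v, hv, h⟩ := Submodule.mem_sup.mp (mem_one_sup_of_adjoin hGK hK htop a)
  obtain ⟨r, rfl⟩ := Submodule.mem_one.mp hr
  have h1 : algebraMap ℚ A r = 0 := by
    have h0 := mem_pos.mp ha
    rw [← h, map_add, mem_pos.mp (hpos hv), add_zero, Algebra.algebraMap_eq_smul_one, map_smul,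
      proj_of_mem one_mem_gr] at h0
    rw [Algebra.algebraMap_eq_smul_one, h0]
  rwa [← h, h1, zero_add]

theorem exists_algebraMap_of_adjoin {G : Submodule ℚ A} (hG : G ≤ A.pos)
    (htop : Algebra.adjoin ℚ (G : Set A) = ⊤) {a : A} (ha : a ∈ A.gr 0) :
    ∃ r : ℚ, algebraMap ℚ A r = a := by
  obtain ⟨_, hr, v, hv, h⟩ := Submodule.mem_sup.mp
    (mem_one_sup_of_adjoin hG pos_mul_pos_le htop a)
  obtain ⟨r, rfl⟩ := Submodule.mem_one.mp hr
  refine ⟨r, ?_⟩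
  rw [← proj_of_mem ha, ← h, map_add, mem_pos.mp hv, add_zero, Algebra.algebraMap_eq_smul_one,
    map_smul, proj_of_mem one_mem_gr]

theorem pos_sq_le : A.pos ^ 2 ≤ A.pos := by
  simpa using pos_pow_anti (A := A) le_rfl one_le_two

theorem pos_le_of_adjoin {G : Submodule ℚ A} (hG : G ≤ A.pos)
    (htop : Algebra.adjoin ℚ (G : Set A) = ⊤) : A.pos ≤ G ⊔ A.pos ^ 2 := by
  have h : G ⊔ A.pos ^ 2 ≤ A.pos := sup_le hG pos_sq_le
  refine pos_le_of_adjoin_of_mul_le le_sup_left ?_ h htop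
  exact le_trans (mul_le_mul' h h) (by rw [pow_two]; exact le_sup_right)

theorem proj_mem_pos_sq {a : A} (ha : a ∈ A.pos ^ 2) (n : ℕ) : A.proj n a ∈ A.pos ^ 2 := by
  have hpos : ∀ b ∈ A.pos, ∀ m, A.proj m b ∈ A.pos := by
    intro b hb m
    rcases Nat.eq_zero_or_pos m with rfl | hm
    · rw [mem_pos.mp hb]
      exact Submodule.zero_mem _
    · exact mem_pos_of_mem_gr hm (proj_mem _ _)
  rw [pow_two] at ha ⊢
  induction ha using Submodule.mul_induction_on' with
  | mem_mul_mem a ha b hb =>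
    obtain ⟨s, hs⟩ := sum_proj a
    obtain ⟨t, ht⟩ := sum_proj b
    rw [hs, ht, Finset.sum_mul, map_sum]
    refine Submodule.sum_mem _ fun i _ => ?_
    rw [Finset.mul_sum, map_sum]
    refine Submodule.sum_mem _ fun j _ => ?_
    have hij := mul_mem_gr (proj_mem i a) (proj_mem j b)
    by_cases h : i + j = n
    · rw [proj_of_mem (h ▸ hij)]
      exact Submodule.mul_mem_mul (hpos a ha i) (hpos b hb j)
    · rw [proj_of_mem_ne h hij]
      exact Submodule.zero_mem _
  | add a _ b _ ha hb => rw [map_add]; exact Submodule.add_mem _ ha hb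

end Generated

end CDGA

/-! ### Free graded commutative algebras: universal property and linear part. -/

/-- A linear map with commuting values extends to the symmetric algebra. -/
theorem SymmetricAlgebra.exists_algHom_of_commute {M T : Type*} [AddCommGroup M] [Module ℚ M]
    [Ring T] [Algebra ℚ T] (e : M →ₗ[ℚ] T) (h : ∀ v w, e v * e w = e w * e v) :
    ∃ F : SymmetricAlgebra ℚ M →ₐ[ℚ] T, ∀ v, F (SymmetricAlgebra.ι ℚ M v) = e v := by
  -- The universal property of the symmetric algebra needs a commutative target; the subalgebra
  -- generated by the values is one.
  have := Algebra.isMulCommutative_adjoin ℚ (s := Set.range e) (by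
    rintro _ ⟨v, rfl⟩ _ ⟨w, rfl⟩
    exact h v w)
  let : CommRing (Algebra.adjoin ℚ (Set.range e)) :=
    { (Algebra.adjoin ℚ (Set.range e)).toRing with mul_comm := this.is_comm.comm }
  let e' : M →ₗ[ℚ] Algebra.adjoin ℚ (Set.range e) :=
    e.codRestrict (Subalgebra.toSubmodule (Algebra.adjoin ℚ (Set.range e)))
      fun v => Algebra.subset_adjoin ⟨v, rfl⟩
  refine ⟨(Algebra.adjoin ℚ (Set.range e)).val.comp (SymmetricAlgebra.lift e'), fun v => ?_⟩
  rw [AlgHom.comp_apply, SymmetricAlgebra.lift_ι_apply]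
  rfl

namespace CDGA

section Free

variable {A : CDGA.{u}} {V : ℕ → Submodule ℚ A}

theorem IsFreeOn.le_pos (h : A.IsFreeOn V) : ⨆ n, V n ≤ A.pos := by
  refine iSup_le fun n a ha => ?_
  rcases Nat.eq_zero_or_pos n with rfl | hn
  · rw [h.zero_eq_bot] at ha
    rw [(Submodule.mem_bot ℚ).mp ha]
    exact Submodule.zero_mem _
  · exact mem_pos_of_mem_gr hn (h.le_gr n ha)

theorem le_evenPart {n : ℕ} (hn : Even n) : V n ≤ A.evenPart V :=
  le_iSup (fun n : {n : ℕ // Even n} => V n) ⟨n, hn⟩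

theorem le_oddPart {n : ℕ} (hn : Odd n) : V n ≤ A.oddPart V :=
  le_iSup (fun n : {n : ℕ // Odd n} => V n) ⟨n, hn⟩

theorem evenPart_le : A.evenPart V ≤ ⨆ n, V n := iSup_le fun n => le_iSup V n

theorem oddPart_le : A.oddPart V ≤ ⨆ n, V n := iSup_le fun n => le_iSup V n

theorem IsFreeOn.signInv_evenPart (h : A.IsFreeOn V) {a : A} (ha : a ∈ A.evenPart V) :
    A.signInv a = a := by
  have : A.evenPart V ≤ LinearMap.ker (A.signInv - LinearMap.id) :=
    iSup_le fun n a ha => by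
      rw [LinearMap.mem_ker, LinearMap.sub_apply, signInv_even n.2 (h.le_gr n ha),
        LinearMap.id_apply, sub_self]
  simpa [sub_eq_zero] using this ha

theorem IsFreeOn.signInv_oddPart (h : A.IsFreeOn V) {a : A} (ha : a ∈ A.oddPart V) :
    A.signInv a = -a := by
  have : A.oddPart V ≤ LinearMap.ker (A.signInv + LinearMap.id) :=
    iSup_le fun n a ha => by
      rw [LinearMap.mem_ker, LinearMap.add_apply, signInv_odd n.2 (h.le_gr n ha),
        LinearMap.id_apply, neg_add_cancel]
  simpa [add_eq_zero_iff_eq_neg] using this ha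

theorem IsFreeOn.adjoin_eq_top (h : A.IsFreeOn V) :
    Algebra.adjoin ℚ ((⨆ n, V n : Submodule ℚ A) : Set A) = ⊤ := by
  obtain ⟨φ, hφ1, hφ2⟩ := h.exists_equiv
  rw [eq_top_iff]
  rintro a -
  obtain ⟨t, rfl⟩ := φ.surjective a
  induction t using TensorProduct.induction_on with
  | zero => rw [map_zero]; exact Subalgebra.zero_mem _
  | add s t hs ht => rw [map_add]; exact Subalgebra.add_mem _ hs ht
  | tmul x y =>
    have hxy : x ⊗ₜ[ℚ] y = (x ⊗ₜ 1) * (1 ⊗ₜ y) := by simp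
    rw [hxy, map_mul]
    refine Subalgebra.mul_mem _ ?_ ?_
    · induction x using SymmetricAlgebra.induction with
      | algebraMap r =>
        have : (algebraMap ℚ (SymmetricAlgebra ℚ (A.evenPart V)) r) ⊗ₜ[ℚ]
            (1 : ExteriorAlgebra ℚ (A.oddPart V)) = algebraMap ℚ _ r := rfl
        rw [this, AlgEquiv.commutes]
        exact Subalgebra.algebraMap_mem _ _
      | ι v => rw [hφ1]; exact Algebra.subset_adjoin (evenPart_le v.2)
      | mul a b ha hb =>
        have : (a * b) ⊗ₜ[ℚ] (1 : ExteriorAlgebra ℚ (A.oddPart V)) = (a ⊗ₜ 1) * (b ⊗ₜ 1) := by simp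
        rw [this, map_mul]
        exact Subalgebra.mul_mem _ (ha (by simp)) (hb (by simp))
      | add a b ha hb =>
        rw [TensorProduct.add_tmul, map_add]
        exact Subalgebra.add_mem _ (ha (by simp)) (hb (by simp))
    · induction y using ExteriorAlgebra.induction with
      | algebraMap r =>
        rw [show (1 : SymmetricAlgebra ℚ (A.evenPart V)) ⊗ₜ[ℚ]
          (algebraMap ℚ (ExteriorAlgebra ℚ (A.oddPart V)) r) = algebraMap ℚ _ r by
            rw [Algebra.algebraMap_eq_smul_one, TensorProduct.tmul_smul,
              Algebra.algebraMap_eq_smul_one]; rfl, AlgEquiv.commutes]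
        exact Subalgebra.algebraMap_mem _ _
      | ι v => rw [hφ2]; exact Algebra.subset_adjoin (oddPart_le v.2)
      | mul a b ha hb =>
        have : (1 : SymmetricAlgebra ℚ (A.evenPart V)) ⊗ₜ[ℚ] (a * b) = (1 ⊗ₜ a) * (1 ⊗ₜ b) := by
          simp
        rw [this, map_mul]
        exact Subalgebra.mul_mem _ (ha (by simp)) (hb (by simp))
      | add a b ha hb =>
        rw [TensorProduct.tmul_add, map_add]
        exact Subalgebra.add_mem _ (ha (by simp)) (hb (by simp))

/-- The universal property of a free graded commutative algebra, with values in an arbitrary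
algebra. -/
theorem IsFreeOn.exists_algHom (h : A.IsFreeOn V) {T : Type*} [Ring T] [Algebra ℚ T]
    (lam : A →ₗ[ℚ] T)
    (hee : ∀ a ∈ A.evenPart V, ∀ b ∈ A.evenPart V, lam a * lam b = lam b * lam a)
    (heo : ∀ a ∈ A.evenPart V, ∀ b ∈ A.oddPart V, lam a * lam b = lam b * lam a)
    (hoo : ∀ a ∈ A.oddPart V, lam a * lam a = 0) :
    ∃ Φ : A →ₐ[ℚ] T, ∀ n, ∀ v ∈ V n, Φ v = lam v := by
  obtain ⟨φ, hφ1, hφ2⟩ := h.exists_equiv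
  obtain ⟨F, hF⟩ := SymmetricAlgebra.exists_algHom_of_commute
    (lam ∘ₗ (A.evenPart V).subtype) fun v w => hee v v.2 w w.2
  let G : ExteriorAlgebra ℚ (A.oddPart V) →ₐ[ℚ] T :=
    ExteriorAlgebra.lift ℚ ⟨lam ∘ₗ (A.oddPart V).subtype, fun w => hoo w w.2⟩
  have hG : ∀ w, G (ExteriorAlgebra.ι ℚ w) = lam w := fun w => ExteriorAlgebra.lift_ι_apply ℚ _ _ w
  have hFG : ∀ x y, Commute (F x) (G y) := by
    intro x y
    induction x using SymmetricAlgebra.induction with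
    | algebraMap r => rw [AlgHom.commutes]; exact Algebra.commute_algebraMap_left r _
    | ι v =>
      rw [hF]
      induction y using ExteriorAlgebra.induction with
      | algebraMap r => rw [AlgHom.commutes]; exact Algebra.commute_algebraMap_right r _
      | ι w => rw [hG]; exact heo v v.2 w w.2
      | mul a b ha hb => rw [map_mul]; exact ha.mul_right hb
      | add a b ha hb => rw [map_add]; exact ha.add_right hb
    | mul a b ha hb => rw [map_mul]; exact ha.mul_left hb
    | add a b ha hb => rw [map_add]; exact ha.add_left hb
  refine ⟨(Algebra.TensorProduct.lift F G hFG).comp φ.symm.toAlgHom, fun n v hv => ?_⟩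
  change Algebra.TensorProduct.lift F G hFG (φ.symm v) = lam v
  rcases Nat.even_or_odd n with hn | hn
  · have : φ.symm v = SymmetricAlgebra.ι ℚ _ (⟨v, le_evenPart hn hv⟩ : A.evenPart V) ⊗ₜ 1 := by
      rw [AlgEquiv.symm_apply_eq, hφ1]
    rw [this, Algebra.TensorProduct.lift_tmul, map_one, mul_one, hF]
    rfl
  · have : φ.symm v = 1 ⊗ₜ ExteriorAlgebra.ι ℚ (⟨v, le_oddPart hn hv⟩ : A.oddPart V) := by
      rw [AlgEquiv.symm_apply_eq, hφ2]
    rw [this, Algebra.TensorProduct.lift_tmul, map_one, one_mul, hG]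

/-- The projection of `ΛV` to `V` that kills `1` and the decomposable elements. -/
theorem IsFreeOn.exists_linearPart (h : A.IsFreeOn V) :
    ∃ l : A →ₗ[ℚ] A, (∀ n, ∀ v ∈ V n, l v = v) ∧ (∀ a ∈ A.pos ^ 2, l a = 0) ∧
      ∀ n, ∀ a ∈ A.gr n, l a ∈ V n := by
  -- `lam v` is the endomorphism `(r, a) ↦ (0, r • v)`. Any two of these compose to zero, so the
  -- induced homomorphism `Φ` kills products of elements of `A.pos`, and the linear part of `a` can
  -- be read off as the second component of `Φ a (1, 0)`.
  let lam : A →ₗ[ℚ] Module.End ℚ (ℚ × A) :=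
    { toFun := fun v => LinearMap.inr ℚ ℚ A ∘ₗ LinearMap.toSpanSingleton ℚ A v ∘ₗ
        LinearMap.fst ℚ ℚ A
      map_add' := fun v w => by ext <;> simp
      map_smul' := fun r v => by ext <;> simp }
  have hlam : ∀ v w, lam v * lam w = 0 := fun v w => by ext <;> simp [lam]
  obtain ⟨Φ, hΦ⟩ := h.exists_algHom lam (fun a _ b _ => by rw [hlam, hlam])
    (fun a _ b _ => by rw [hlam, hlam]) (fun a _ => hlam a a)
  -- `Φ` takes values in the range of `lam` on all of `A.pos`, as products are sent to `lam 0`.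
  have hpos : A.pos ≤ A.pos ⊓ (LinearMap.range lam).comap Φ.toLinearMap := by
    refine pos_le_of_adjoin_of_mul_le (G := ⨆ n, V n) ?_ ?_ inf_le_left h.adjoin_eq_top
    · refine le_inf h.le_pos (iSup_le fun n v hv => ?_)
      exact ⟨v, (hΦ n v hv).symm⟩
    · rw [Submodule.mul_le]
      rintro a ⟨ha, ha'⟩ b ⟨hb, hb'⟩
      refine ⟨pos_mul_pos_le (Submodule.mul_mem_mul ha hb), 0, ?_⟩
      obtain ⟨v, hv⟩ := ha'
      obtain ⟨w, hw⟩ := hb'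
      have hv : lam v = Φ a := hv
      have hw : lam w = Φ b := hw
      change lam 0 = Φ (a * b)
      rw [map_mul, ← hv, ← hw, hlam, map_zero]
  let l : A →ₗ[ℚ] A :=
    LinearMap.snd ℚ ℚ A ∘ₗ LinearMap.applyₗ ((1, 0) : ℚ × A) ∘ₗ Φ.toLinearMap
  have hl : ∀ a, l a = (Φ a (1, 0)).2 := fun a => rfl
  have hlV : ∀ n, ∀ v ∈ V n, l v = v := by
    intro n v hv
    rw [hl, hΦ n v hv]
    simp [lam]
  have hl2 : ∀ a ∈ A.pos ^ 2, l a = 0 := by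
    intro a ha
    rw [pow_two] at ha
    induction ha using Submodule.mul_induction_on' with
    | mem_mul_mem a ha b hb =>
      obtain ⟨v, hv⟩ := (hpos ha).2
      obtain ⟨w, hw⟩ := (hpos hb).2
      have hv : lam v = Φ a := hv
      have hw : lam w = Φ b := hw
      rw [hl, map_mul, ← hv, ← hw, hlam]
      rfl
    | add a _ b _ ha hb => rw [map_add, ha, hb, add_zero]
  refine ⟨l, hlV, hl2, fun n a ha => ?_⟩
  rcases Nat.eq_zero_or_pos n with rfl | hn
  -- Since `V 0 = ⊥`, constants have to be killed: `Φ` maps them to scalars, and a scalar multiple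
  -- of `(1, 0)` has second component `0`.
  · obtain ⟨r, rfl⟩ := exists_algebraMap_of_adjoin h.le_pos h.adjoin_eq_top ha
    have : l (algebraMap ℚ A r) = 0 := by
      rw [hl, AlgHom.commutes]
      simp [Module.algebraMap_end_apply]
    rw [this]
    exact Submodule.zero_mem _
  · obtain ⟨v, hv, f, hf, hvf⟩ := Submodule.mem_sup.mp
      (pos_le_of_adjoin h.le_pos h.adjoin_eq_top (mem_pos_of_mem_gr hn ha))
    have hvn : A.proj n v ∈ V n := by
      clear hvf
      induction hv using Submodule.iSup_induction' with
      | mem m v hv =>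
        by_cases hmn : m = n
        · subst hmn
          rwa [proj_of_mem (h.le_gr _ hv)]
        · rw [proj_of_mem_ne hmn (h.le_gr _ hv)]
          exact Submodule.zero_mem _
      | zero => rw [map_zero]; exact Submodule.zero_mem _
      | add v w _ _ hv hw => rw [map_add]; exact Submodule.add_mem _ hv hw
    rw [← proj_of_mem ha, ← hvf, map_add, map_add, hlV n _ hvn, hl2 _ (proj_mem_pos_sq hf n),
      add_zero]
    exact hvn

end Free

end CDGA

/-! ### Derivations of degree `-1` and a contraction of the linear part of `d`. -/

/-- Every linear map between vector spaces has a generalized inverse. -/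
theorem LinearMap.exists_generalizedInverse {K M N : Type*} [Field K] [AddCommGroup M] [Module K M]
    [AddCommGroup N] [Module K N] (f : M →ₗ[K] N) : ∃ g : N →ₗ[K] M, ∀ a, f (g (f a)) = f a := by
  obtain ⟨g₀, hg₀⟩ := f.rangeRestrict.exists_rightInverse_of_surjective f.range_rangeRestrict
  obtain ⟨g, hg⟩ := LinearMap.exists_extend g₀
  refine ⟨g, fun a => ?_⟩
  have h1 : g (f a) = g₀ (f.rangeRestrict a) := by rw [← hg]; rfl
  have h2 := LinearMap.congr_fun hg₀ (f.rangeRestrict a)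
  rw [h1]
  exact congrArg Subtype.val h2

namespace CDGA

section Homotopy

variable {A : CDGA.{u}} {V : ℕ → Submodule ℚ A}

theorem IsFreeOn.mem_span_closure (h : A.IsFreeOn V) (a : A) :
    a ∈ Submodule.span ℚ (Submonoid.closure {v : A | ∃ n, v ∈ V n} : Set A) := by
  have h1 : Algebra.adjoin ℚ ((⨆ n, V n : Submodule ℚ A) : Set A) ≤
      Algebra.adjoin ℚ {v : A | ∃ n, v ∈ V n} := by
    refine Algebra.adjoin_le ?_
    have : ⨆ n, V n ≤ Subalgebra.toSubmodule (Algebra.adjoin ℚ {v : A | ∃ n, v ∈ V n}) :=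
      iSup_le fun n v hv => Algebra.subset_adjoin ⟨n, hv⟩
    exact this
  rw [h.adjoin_eq_top] at h1
  have h2 : a ∈ Algebra.adjoin ℚ {v : A | ∃ n, v ∈ V n} := h1 Algebra.mem_top
  rwa [← Subalgebra.mem_toSubmodule, Algebra.adjoin_eq_span] at h2

/-- A linear map of degree `-1` on the generators extends to a derivation of degree `-1`. -/
theorem IsFreeOn.exists_derivation (h : A.IsFreeOn V) (t : A →ₗ[ℚ] A)
    (ht : ∀ n, ∀ v ∈ V (n + 1), t v ∈ V n) :
    ∃ θ : A →ₗ[ℚ] A, (∀ a b, θ (a * b) = θ a * b + A.signInv a * θ b) ∧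
      (∀ n, ∀ a ∈ A.gr (n + 1), θ a ∈ A.gr n) ∧ (∀ a ∈ A.gr 0, θ a = 0) ∧
      ∀ n, ∀ v ∈ V n, θ v = t v := by
  -- `t` exchanges parities on the generators. This is what makes the matrices below commute,
  -- respectively square to zero.
  have ht_even : A.evenPart V ≤ LinearMap.ker (A.signInv ∘ₗ t + t) := by
    refine iSup_le fun ⟨n, hn⟩ a ha => ?_
    rw [LinearMap.mem_ker, LinearMap.add_apply, LinearMap.comp_apply]
    cases n with
    | zero =>
      change a ∈ V 0 at ha
      rw [h.zero_eq_bot, Submodule.mem_bot] at ha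
      simp [ha]
    | succ n =>
      rw [signInv_odd (by rwa [Nat.even_add_one, Nat.not_even_iff_odd] at hn)
        (h.le_gr _ (ht n a ha)), neg_add_cancel]
  have ht_odd : A.oddPart V ≤ LinearMap.ker (A.signInv ∘ₗ t - t) := by
    refine iSup_le fun ⟨n, hn⟩ a ha => ?_
    rw [LinearMap.mem_ker, LinearMap.sub_apply, LinearMap.comp_apply]
    cases n with
    | zero => exact absurd hn (by simp)
    | succ n =>
      rw [signInv_even (by rwa [Nat.odd_add_one, Nat.not_odd_iff_even] at hn)
        (h.le_gr _ (ht n a ha)), sub_self]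
  have he : ∀ a ∈ A.evenPart V, A.signInv (t a) = -t a := fun a ha =>
    eq_neg_of_add_eq_zero_left (ht_even ha)
  have ho : ∀ a ∈ A.oddPart V, A.signInv (t a) = t a := fun a ha => sub_eq_zero.mp (ht_odd ha)
  -- A linear map `θ` is a derivation twisted by the sign involution exactly if `a ↦ !![a, 0; θ a,
  -- A.signInv a]` is multiplicative. So `θ` is obtained as the lower left entry of the homomorphism
  -- extending `lam`.
  let lam : A →ₗ[ℚ] Matrix (Fin 2) (Fin 2) A :=
    { toFun := fun a => !![a, 0; t a, A.signInv a]
      map_add' := fun a b => by ext i j; fin_cases i <;> fin_cases j <;> simp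
      map_smul' := fun r a => by ext i j; fin_cases i <;> fin_cases j <;> simp }
  have hmul : ∀ a b, lam a * lam b =
      !![a * b, 0; t a * b + A.signInv a * t b, A.signInv a * A.signInv b] := by
    intro a b
    simp [lam]
  have hee : ∀ a ∈ A.evenPart V, ∀ b ∈ A.evenPart V, lam a * lam b = lam b * lam a := by
    intro a ha b hb
    rw [hmul, hmul, h.signInv_evenPart ha, h.signInv_evenPart hb,
      (commute_of_signInv_eq (h.signInv_evenPart ha) b).eq,
      (commute_of_signInv_eq (h.signInv_evenPart ha) (t b)).eq,
      (commute_of_signInv_eq (h.signInv_evenPart hb) (t a)).eq, add_comm]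
  have heo : ∀ a ∈ A.evenPart V, ∀ b ∈ A.oddPart V, lam a * lam b = lam b * lam a := by
    intro a ha b hb
    rw [hmul, hmul, h.signInv_evenPart ha, h.signInv_oddPart hb,
      (commute_of_signInv_eq (h.signInv_evenPart ha) b).eq,
      (commute_of_signInv_eq (h.signInv_evenPart ha) (t b)).eq,
      mul_eq_neg_of_signInv_eq_neg (he a ha) (h.signInv_oddPart hb), mul_neg,
      (commute_of_signInv_eq (h.signInv_evenPart ha) b).eq, neg_mul, neg_mul, add_comm]
  have hoo : ∀ a ∈ A.oddPart V, lam a * lam a = 0 := by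
    intro a ha
    rw [hmul, h.signInv_oddPart ha, mul_self_of_signInv_eq_neg (h.signInv_oddPart ha),
      (commute_of_signInv_eq (ho a ha) a).eq]
    ext i j
    fin_cases i <;> fin_cases j <;>
      simp [mul_self_of_signInv_eq_neg (h.signInv_oddPart ha)]
  obtain ⟨Φ, hΦ⟩ := h.exists_algHom lam hee heo hoo
  have key : ∀ a, Φ a 0 0 = a ∧ Φ a 0 1 = 0 ∧ Φ a 1 1 = A.signInv a := by
    intro a
    have ha : a ∈ Algebra.adjoin ℚ ((⨆ n, V n : Submodule ℚ A) : Set A) :=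
      h.adjoin_eq_top ▸ Algebra.mem_top
    induction ha using Algebra.adjoin_induction with
    | mem v hv =>
      induction hv using Submodule.iSup_induction' with
      | mem n v hv => rw [hΦ n v hv]; simp [lam]
      | zero => simp
      | add v w _ _ hv hw => simp [hv, hw]
    | algebraMap r =>
      rw [AlgHom.commutes, Algebra.algebraMap_eq_smul_one (A := A), map_smul, signInv_one]
      simp [Matrix.algebraMap_matrix_apply, Algebra.algebraMap_eq_smul_one]
    | add x y _ _ hx hy => simp [hx, hy]
    | mul x y _ _ hx hy =>
      rw [map_mul, signInv_mul]
      simp [Matrix.mul_apply, Fin.sum_univ_two, hx, hy]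
  let θ : A →ₗ[ℚ] A :=
    { toFun := fun a => Φ a 1 0
      map_add' := fun a b => by simp
      map_smul' := fun r a => by simp }
  have hθmul : ∀ a b, θ (a * b) = θ a * b + A.signInv a * θ b := by
    intro a b
    change Φ (a * b) 1 0 = Φ a 1 0 * b + A.signInv a * Φ b 1 0
    rw [map_mul, Matrix.mul_apply, Fin.sum_univ_two, (key b).1, (key a).2.2]
  have hθV : ∀ n, ∀ v ∈ V n, θ v = t v := by
    intro n v hv
    change Φ v 1 0 = t v
    rw [hΦ n v hv]
    simp [lam]
  have hθ1 : θ 1 = 0 := by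
    have h1 := hθmul 1 1
    rwa [signInv_one, mul_one, one_mul, mul_one, left_eq_add] at h1
  -- Degrees are natural numbers, so a map of degree `-1` must vanish in degree `0`; this case is
  -- carried along separately.
  have hcl : ∀ a ∈ Submonoid.closure {v : A | ∃ n, v ∈ V n},
      ∃ m, a ∈ A.gr m ∧ (m = 0 → θ a = 0) ∧ ∀ n, m = n + 1 → θ a ∈ A.gr n := by
    intro a ha
    induction ha using Submonoid.closure_induction with
    | mem v hv =>
      obtain ⟨n, hv⟩ := hv
      refine ⟨n, h.le_gr n hv, ?_, ?_⟩
      · rintro rfl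
        rw [h.zero_eq_bot, Submodule.mem_bot] at hv
        rw [hv, map_zero]
      · rintro n rfl
        rw [hθV _ v hv]
        exact h.le_gr n (ht n v hv)
    | one => exact ⟨0, one_mem_gr, fun _ => hθ1, fun n hn => by omega⟩
    | mul a b _ _ ha hb =>
      obtain ⟨i, hai, ha0, ha1⟩ := ha
      obtain ⟨j, hbj, hb0, hb1⟩ := hb
      refine ⟨i + j, mul_mem_gr hai hbj, ?_, ?_⟩
      · intro hij
        rw [hθmul, ha0 (by omega), hb0 (by omega), zero_mul, mul_zero, add_zero]
      · intro n hn
        rw [hθmul]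
        refine Submodule.add_mem _ ?_ ?_
        · rcases i with _ | i
          · rw [ha0 rfl, zero_mul]
            exact Submodule.zero_mem _
          · obtain rfl : n = i + j := by omega
            exact mul_mem_gr (ha1 i rfl) hbj
        · rcases j with _ | j
          · rw [hb0 rfl, mul_zero]
            exact Submodule.zero_mem _
          · obtain rfl : n = i + j := by omega
            exact mul_mem_gr (signInv_mem hai) (hb1 j rfl)
  refine ⟨θ, hθmul, ?_, ?_, hθV⟩
  · intro n a ha
    rw [← proj_of_mem ha]
    have hs := h.mem_span_closure a
    clear ha
    induction hs using Submodule.span_induction with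
    | mem x hx =>
      obtain ⟨m, hm, -, hm1⟩ := hcl x hx
      by_cases hmn : m = n + 1
      · rw [proj_of_mem (hmn ▸ hm)]
        exact hm1 n hmn
      · rw [proj_of_mem_ne hmn hm, map_zero]
        exact Submodule.zero_mem _
    | zero => simp
    | add x y _ _ hx hy => rw [map_add, map_add]; exact Submodule.add_mem _ hx hy
    | smul r x _ hx => rw [map_smul, map_smul]; exact Submodule.smul_mem _ _ hx
  · intro a ha
    rw [← proj_of_mem ha]
    have hs := h.mem_span_closure a
    clear ha
    induction hs using Submodule.span_induction with
    | mem x hx =>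
      obtain ⟨m, hm, hm0, -⟩ := hcl x hx
      by_cases hmn : m = 0
      · rw [proj_of_mem (hmn ▸ hm)]
        exact hm0 hmn
      · rw [proj_of_mem_ne hmn hm, map_zero]
    | zero => simp
    | add x y _ _ hx hy => rw [map_add, map_add, hx, hy, add_zero]
    | smul r x _ hx => rw [map_smul, map_smul, hx, smul_zero]

/-- A free algebra has a derivation `θ` of degree `-1` such that `dθ + θd` is, up to decomposable
elements, a projection of the space of generators along representatives of `H(V, d₀)`. -/
theorem IsFreeOn.exists_contraction (h : A.IsFreeOn V) :
    ∃ θ : A →ₗ[ℚ] A, (∀ a b, θ (a * b) = θ a * b + A.signInv a * θ b) ∧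
      (∀ n, ∀ a ∈ A.gr (n + 1), θ a ∈ A.gr n) ∧ (∀ a ∈ A.gr 0, θ a = 0) ∧
      (∀ n, ∀ v ∈ V n, ∃ w ∈ V n, A.d w ∈ A.pos ^ 2 ∧ A.d (θ w) + θ (A.d w) ∈ A.pos ^ 2 ∧
        A.d (θ (v - w)) + θ (A.d (v - w)) - (v - w) ∈ A.pos ^ 2 ∧
        (A.d v ∈ A.pos ^ 2 → v - w ∈ (V (n - 1)).map A.d ⊔ A.pos ^ 2)) ∧
      ((∀ a, A.d a ∈ A.pos ^ 2) → θ = 0) := by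
  obtain ⟨l, hlV, hl2, hl⟩ := h.exists_linearPart
  have hll : ∀ a, l (l a) = l a := fun a => LinearMap.congr_fun
    (linearMap_ext_gr (f := l ∘ₗ l) (g := l) fun n a ha => hlV n _ (hl n a ha)) a
  have hlsup : ∀ v ∈ ⨆ n, V n, l v = v := by
    intro v hv
    have : ⨆ n, V n ≤ LinearMap.ker (l - LinearMap.id) := iSup_le fun n v hv => by
      simp [hlV n v hv]
    simpa [sub_eq_zero] using this hv
  have hpos : ∀ a ∈ A.pos, a - l a ∈ A.pos ^ 2 := by
    intro a ha
    obtain ⟨v, hv, f, hf, rfl⟩ := Submodule.mem_sup.mp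
      (pos_le_of_adjoin h.le_pos h.adjoin_eq_top ha)
    rw [map_add, hlsup v hv, hl2 f hf, add_zero, add_sub_cancel_left]
    exact hf
  -- the linear part of the differential
  let D : A →ₗ[ℚ] A := l ∘ₗ A.d ∘ₗ l
  have hD : ∀ a, D a = l (A.d (l a)) := fun a => rfl
  have hDl : ∀ a, D (l a) = D a := fun a => by rw [hD, hD, hll]
  have hlD : ∀ a, l (D a) = D a := fun a => by rw [hD, hll]
  have hDV : ∀ n, ∀ a ∈ A.gr n, D a ∈ V (n + 1) := fun n a ha =>
    hl _ _ (A.d_mem _ _ (h.le_gr n (hl n a ha)))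
  have hDD : ∀ a, D (D a) = 0 := by
    intro a
    -- `d` preserves decomposables, so replacing `d (l a)` by its linear part changes `d (d (l a)) =
    -- 0` by a decomposable element only.
    have h1 := d_mem_pos_pow one_le_two (hpos _ (d_mem_pos (l a)))
    rw [map_sub, A.d_d, zero_sub, Submodule.neg_mem_iff] at h1
    rw [hD, hlD, hD, hl2 _ h1]
  obtain ⟨g, hg⟩ := D.exists_generalizedInverse
  -- `g` need not be homogeneous. Its component of degree `-1` is still a generalized inverse
  -- because `D` has degree `1`.
  obtain ⟨g', hg'⟩ := exists_linearMap_gr (A := A) fun n => match n with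
    | 0 => 0
    | n + 1 => A.proj n ∘ₗ g
  let t₁ : A →ₗ[ℚ] A := l ∘ₗ g'
  have ht₁0 : ∀ a ∈ A.gr 0, t₁ a = 0 := fun a ha => by
    change l (g' a) = 0
    rw [hg' 0 a ha, LinearMap.zero_apply, map_zero]
  have ht₁ : ∀ n, ∀ a ∈ A.gr (n + 1), t₁ a ∈ V n := fun n a ha => by
    change l (g' a) ∈ V n
    rw [hg' _ a ha]
    exact hl n _ (proj_mem n _)
  have hprojl : ∀ n a, l (A.proj n a) = A.proj n (l a) := fun n a => LinearMap.congr_fun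
    (linearMap_ext_gr (f := l ∘ₗ A.proj n) (g := A.proj n ∘ₗ l) fun m a ha => by
      have h1 := h.le_gr m (hl m a ha)
      rw [LinearMap.comp_apply, LinearMap.comp_apply]
      by_cases hmn : m = n
      · subst hmn
        rw [proj_of_mem ha, proj_of_mem h1]
      · rw [proj_of_mem_ne hmn ha, proj_of_mem_ne hmn h1, map_zero]) a
  have hprojD : ∀ n a, D (A.proj n a) = A.proj (n + 1) (D a) := fun n a => by
    rw [hD, hD, hprojl, ← proj_d, hprojl]
  have hDtD₁ : ∀ a, D (t₁ (D a)) = D a := fun a => LinearMap.congr_fun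
    (linearMap_ext_gr (f := D ∘ₗ t₁ ∘ₗ D) (g := D) fun n a ha => by
      change D (l (g' (D a))) = D a
      have h1 := h.le_gr _ (hDV n a ha)
      rw [hDl, hg' _ _ h1]
      change D (A.proj n (g (D a))) = D a
      rw [hprojD, hg, proj_of_mem h1]) a
  -- Two corrections of the generalized inverse: passing from `t₁` to `t₂` achieves `t₂ D t₂ = t₂`,
  -- and with this `t = t₂ (1 - t₂ D)` satisfies `t t = 0`, while `D t D = D` is kept. Together with
  -- `D D = 0` these relations make `D t + t D` the required projection.
  let t₂ : A →ₗ[ℚ] A := t₁ ∘ₗ D ∘ₗ t₁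
  have hDtD₂ : ∀ a, D (t₂ (D a)) = D a := fun a => by
    change D (t₁ (D (t₁ (D a)))) = D a
    rw [hDtD₁, hDtD₁]
  have htDt₂ : ∀ a, t₂ (D (t₂ a)) = t₂ a := fun a => by
    change t₁ (D (t₁ (D (t₁ (D (t₁ a)))))) = t₁ (D (t₁ a))
    rw [hDtD₁, hDtD₁]
  have ht₂0 : ∀ a ∈ A.gr 0, t₂ a = 0 := fun a ha => by
    change t₁ (D (t₁ a)) = 0
    rw [ht₁0 a ha, map_zero, map_zero]
  have ht₂ : ∀ n, ∀ a ∈ A.gr (n + 1), t₂ a ∈ V n := fun n a ha =>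
    ht₁ n _ (h.le_gr _ (hDV n _ (h.le_gr _ (ht₁ n a ha))))
  let t : A →ₗ[ℚ] A := t₂ ∘ₗ (LinearMap.id - t₂ ∘ₗ D)
  have ht_apply : ∀ a, t a = t₂ (a - t₂ (D a)) := fun a => rfl
  have htD : ∀ a, t (D a) = t₂ (D a) := fun a => by
    rw [ht_apply, hDD, map_zero, sub_zero]
  have hDtD : ∀ a, D (t (D a)) = D a := fun a => by rw [htD, hDtD₂]
  have htt : ∀ a, t (t a) = 0 := fun a => by
    rw [ht_apply (t a), ht_apply a, htDt₂, sub_self, map_zero]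
  have htV : ∀ n, ∀ a ∈ A.gr (n + 1), t a ∈ V n := fun n a ha =>
    ht₂ n _ (Submodule.sub_mem _ ha (h.le_gr _ (ht₂ _ _ (h.le_gr _ (hDV _ _ ha)))))
  obtain ⟨θ, hθmul, hθgr, hθ0, hθV⟩ := h.exists_derivation t
    fun n v hv => htV n v (h.le_gr _ hv)
  have hθsup : ∀ v ∈ ⨆ n, V n, θ v = t v := by
    intro v hv
    have : ⨆ n, V n ≤ LinearMap.ker (θ - t) := iSup_le fun n v hv => by
      simp [hθV n v hv]
    simpa [sub_eq_zero] using this hv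
  have hlmem : ∀ a, l a ∈ ⨆ n, V n := fun a => by
    refine induction_gr (P := fun a => l a ∈ ⨆ n, V n) ?_ ?_ ?_ a
    · intro a b ha hb
      rw [map_add]
      exact Submodule.add_mem _ ha hb
    · simp
    · exact fun n a ha => Submodule.mem_iSup_of_mem n (hl n a ha)
  have htmem : ∀ a, t a ∈ ⨆ n, V n := fun a => hlmem _
  have hθ1 : θ 1 = 0 := hθ0 1 one_mem_gr
  have hθpos : ∀ a ∈ A.pos, θ a ∈ A.pos := by
    intro a ha
    refine (?_ : A.pos ≤ A.pos ⊓ A.pos.comap θ) ha |>.2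
    refine pos_le_of_adjoin_of_mul_le (G := ⨆ n, V n) ?_ ?_ inf_le_left h.adjoin_eq_top
    · refine le_inf h.le_pos fun v hv => ?_
      rw [Submodule.mem_comap, hθsup v hv]
      exact h.le_pos (htmem v)
    · rw [Submodule.mul_le]
      rintro a ⟨ha, ha'⟩ b ⟨hb, hb'⟩
      refine ⟨pos_mul_pos_le (Submodule.mul_mem_mul ha hb), ?_⟩
      change θ (a * b) ∈ A.pos
      rw [hθmul]
      exact Submodule.add_mem _ (pos_mul_pos_le (Submodule.mul_mem_mul ha' hb))
        (pos_mul_pos_le (Submodule.mul_mem_mul (signInv_mem_pos ha) hb'))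
  have hθ2 : ∀ a ∈ A.pos ^ 2, θ a ∈ A.pos ^ 2 := fun a ha =>
    map_pos_pow_le hθmul (fun _ _ => signInv_mem_pos_pow) hθpos one_le_two ha
  have hLV : ∀ v ∈ ⨆ n, V n,
      A.d (θ v) + θ (A.d v) - (D (t v) + t (D v)) ∈ A.pos ^ 2 := by
    intro v hv
    have h1 : A.d (θ v) - D (t v) ∈ A.pos ^ 2 := by
      rw [hθsup v hv, hD, hlsup _ (htmem v)]
      exact hpos _ (d_mem_pos _)
    have h2 : θ (A.d v) - t (D v) ∈ A.pos ^ 2 := by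
      have h3 := hθ2 _ (hpos _ (d_mem_pos v))
      rw [map_sub, hθsup _ (hlmem _)] at h3
      rwa [hD, hlsup v hv]
    rw [add_sub_add_comm]
    exact Submodule.add_mem _ h1 h2
  refine ⟨θ, hθmul, hθgr, hθ0, ?_, ?_⟩
  · intro n v hv
    have hsup : ∀ {w}, w ∈ V n → w ∈ ⨆ n, V n := fun hw => Submodule.mem_iSup_of_mem n hw
    have htV' : D (t v) ∈ V n := by
      cases n with
      | zero =>
        rw [h.zero_eq_bot, Submodule.mem_bot] at hv
        rw [hv, map_zero, map_zero]
        exact Submodule.zero_mem _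
      | succ n => exact hDV n _ (h.le_gr _ (htV n v (h.le_gr _ hv)))
    have htV'' : t (D v) ∈ V n := htV n _ (h.le_gr _ (hDV n v (h.le_gr _ hv)))
    have hw : v - (D (t v) + t (D v)) ∈ V n :=
      Submodule.sub_mem _ hv (Submodule.add_mem _ htV' htV'')
    have hDw : D (v - (D (t v) + t (D v))) = 0 := by
      rw [map_sub, map_add, hDD, hDtD, zero_add, sub_self]
    have htw : t (v - (D (t v) + t (D v))) = t v - t (D (t v)) := by
      rw [map_sub, map_add, htt, add_zero]
    -- The projection complementary to `D t + t D` gives the harmonic representative of `v`. If `D v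
    -- = 0`, it differs from `v` by the linear coboundary `D (t v)`.
    refine ⟨v - (D (t v) + t (D v)), hw, ?_, ?_, ?_, ?_⟩
    · have h1 := hpos _ (d_mem_pos (v - (D (t v) + t (D v))))
      rwa [← hlsup _ (hsup hw), ← hD, hDw, sub_zero, hlsup _ (hsup hw)] at h1
    · have h1 := hLV _ (hsup hw)
      rwa [hDw, htw, map_sub D, hDtD, sub_self, map_zero, add_zero, sub_zero] at h1
    · rw [sub_sub_cancel]
      have h1 := hLV _ (hsup (Submodule.add_mem _ htV' htV''))
      have h2 : D (t (D (t v) + t (D v))) + t (D (D (t v) + t (D v))) = D (t v) + t (D v) := by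
        rw [map_add t, htt, add_zero, map_add D (D (t v)), hDD, zero_add, hDtD, hDtD]
      rwa [h2] at h1
    · intro hdv
      have hDv : D v = 0 := by rw [hD, hlsup v (hsup hv), hl2 _ hdv]
      rw [sub_sub_cancel, hDv, map_zero, add_zero]
      have h1 : A.d (t v) - D (t v) ∈ A.pos ^ 2 := by
        have h2 := hpos _ (d_mem_pos (t v))
        rwa [← hlsup _ (htmem v), ← hD, hlsup _ (htmem v)] at h2
      have htv : t v ∈ V (n - 1) := by
        cases n with
        | zero =>
          rw [h.zero_eq_bot, Submodule.mem_bot] at hv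
          rw [hv, map_zero]
          exact Submodule.zero_mem _
        | succ n => exact htV n v (h.le_gr _ hv)
      rw [← sub_sub_cancel (A.d (t v)) (D (t v))]
      exact Submodule.sub_mem _ (Submodule.mem_sup_left ⟨t v, htv, rfl⟩)
        (Submodule.mem_sup_right h1)
  · intro hmin
    -- In the minimal case `D = 0`. The generalized inverse `t₁` could still be anything, but `t₂ =
    -- t₁ D t₁` contains a factor `D`.
    have hD0 : ∀ a, D a = 0 := fun a => hl2 _ (hmin _)
    have ht0 : ∀ a, t a = 0 := fun a => by
      change t₁ (D (t₁ _)) = 0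
      rw [hD0, map_zero]
    ext a
    have ha : a ∈ Algebra.adjoin ℚ ((⨆ n, V n : Submodule ℚ A) : Set A) :=
      h.adjoin_eq_top ▸ Algebra.mem_top
    induction ha using Algebra.adjoin_induction with
    | mem v hv => rw [hθsup v hv, ht0, LinearMap.zero_apply]
    | algebraMap r =>
      rw [Algebra.algebraMap_eq_smul_one, map_smul, hθ1, smul_zero, LinearMap.zero_apply]
    | add x y _ _ hx hy => rw [map_add, hx, hy]; simp
    | mul x y _ _ hx hy => rw [hθmul, hx, hy]; simp

end Homotopy

end CDGA

/-! ### The operator `L = dθ + θd`, its weights and its generalized kernel. -/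

namespace CDGA

open Polynomial

/-- A derivation `θ` of degree `-1` of a connected algebra `A` such that `dθ + θd` acts on the
indecomposables `A⁺ / A⁺A⁺` as a projection. -/
structure IsContraction (A : CDGA.{u}) (θ : A →ₗ[ℚ] A) : Prop where
  connected : ∀ a ∈ A.gr 0, ∃ r : ℚ, algebraMap ℚ A r = a
  mul : ∀ a b, θ (a * b) = θ a * b + A.signInv a * θ b
  mem : ∀ n, ∀ a ∈ A.gr (n + 1), θ a ∈ A.gr n
  zero : ∀ a ∈ A.gr 0, θ a = 0
  exists_add_add : ∀ a ∈ A.pos, ∃ v ∈ A.pos, ∃ w ∈ A.pos, ∃ f ∈ A.pos ^ 2, v + w + f = a ∧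
    A.d (θ v) + θ (A.d v) ∈ A.pos ^ 2 ∧ A.d (θ w) + θ (A.d w) - w ∈ A.pos ^ 2

section Laplacian

variable {A : CDGA.{u}} {θ : A →ₗ[ℚ] A}

variable (A θ) in
/-- The operator `dθ + θd`. -/
def laplacian : Module.End ℚ A := A.d ∘ₗ θ + θ ∘ₗ A.d

theorem laplacian_apply (a : A) : A.laplacian θ a = A.d (θ a) + θ (A.d a) := rfl

theorem laplacian_d (a : A) : A.laplacian θ (A.d a) = A.d (A.laplacian θ a) := by
  rw [laplacian_apply, laplacian_apply, A.d_d, map_zero, map_add, A.d_d, zero_add, add_zero]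

theorem aeval_laplacian_d (p : ℚ[X]) (a : A) :
    aeval (A.laplacian θ) p (A.d a) = A.d (aeval (A.laplacian θ) p a) := by
  induction p using Polynomial.induction_on' with
  | add p q hp hq => rw [map_add, LinearMap.add_apply, LinearMap.add_apply, hp, hq, map_add]
  | monomial n r =>
    rw [aeval_monomial, Module.End.mul_apply, Module.End.mul_apply,
      Module.algebraMap_end_apply, Module.algebraMap_end_apply, map_smul]
    congr 1
    induction n with
    | zero => rfl
    | succ n ih => rw [pow_succ', Module.End.mul_apply, Module.End.mul_apply, ih, laplacian_d]

/-- Subspaces stable under the operator are stable under polynomials in it. -/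
theorem aeval_mem {M : Type*} [AddCommGroup M] [Module ℚ M] {L : Module.End ℚ M}
    {N : Submodule ℚ M} (h : ∀ a ∈ N, L a ∈ N) (p : ℚ[X]) {a : M} (ha : a ∈ N) :
    aeval L p a ∈ N := by
  induction p using Polynomial.induction_on' with
  | add p q hp hq => rw [map_add]; exact Submodule.add_mem _ hp hq
  | monomial n r =>
    rw [aeval_monomial, Module.End.mul_apply, Module.algebraMap_end_apply]
    refine Submodule.smul_mem _ _ ?_
    induction n with
    | zero => exact ha
    | succ n ih => rw [pow_succ', Module.End.mul_apply]; exact h _ ih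

theorem aeval_mul_apply {M : Type*} [AddCommGroup M] [Module ℚ M] (L : Module.End ℚ M)
    (p q : ℚ[X]) (a : M) : aeval L (p * q) a = aeval L p (aeval L q a) := by
  rw [map_mul, Module.End.mul_apply]

theorem isCoprime_X_pow {ρ : ℚ[X]} (h : ρ.eval 0 ≠ 0) (N : ℕ) : IsCoprime (X ^ N) ρ := by
  refine IsCoprime.pow_left ((Polynomial.irreducible_X.coprime_iff_not_dvd).mpr fun hd => h ?_)
  rwa [X_dvd_iff, ← coeff_zero_eq_eval_zero] at *

namespace IsContraction

theorem signInv_map (hθ : A.IsContraction θ) (a : A) : A.signInv (θ a) = -θ (A.signInv a) := by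
  refine induction_gr (P := fun a => A.signInv (θ a) = -θ (A.signInv a)) ?_ ?_ ?_ a
  · intro a b ha hb
    simp only [map_add, ha, hb, neg_add]
  · simp
  · intro n a ha
    rw [signInv_of_mem ha, map_smul]
    cases n with
    | zero => rw [hθ.zero a ha]; simp
    | succ n =>
      rw [signInv_of_mem (hθ.mem n a ha), pow_succ]
      simp

/-- The graded commutator of two odd derivations is an even one: the mixed terms cancel because the
sign involution anticommutes with both `d` and `θ`. -/
theorem laplacian_mul (hθ : A.IsContraction θ) (a b : A) :
    A.laplacian θ (a * b) = A.laplacian θ a * b + a * A.laplacian θ b := by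
  simp only [laplacian_apply, hθ.mul, d_mul, map_add, hθ.signInv_map, signInv_d, signInv_signInv,
    add_mul, mul_add, neg_mul]
  abel

theorem laplacian_mem (hθ : A.IsContraction θ) {n : ℕ} {a : A} (ha : a ∈ A.gr n) :
    A.laplacian θ a ∈ A.gr n := by
  refine Submodule.add_mem _ ?_ (hθ.mem _ _ (A.d_mem _ _ ha))
  cases n with
  | zero =>
    rw [LinearMap.comp_apply, hθ.zero a ha, map_zero]
    exact Submodule.zero_mem _
  | succ n => exact A.d_mem _ _ (hθ.mem n a ha)

theorem laplacian_mem_pos (hθ : A.IsContraction θ) {a : A} (ha : a ∈ A.pos) :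
    A.laplacian θ a ∈ A.pos := by
  induction ha using Submodule.iSup_induction' with
  | mem n a ha => exact mem_pos_of_mem_gr n.2 (hθ.laplacian_mem ha)
  | zero => rw [map_zero]; exact Submodule.zero_mem _
  | add a b _ _ ha hb => rw [map_add]; exact Submodule.add_mem _ ha hb

theorem laplacian_mem_pos_pow (hθ : A.IsContraction θ) {n : ℕ} (hn : 1 ≤ n) {a : A}
    (ha : a ∈ A.pos ^ n) :
    A.laplacian θ a ∈ A.pos ^ n :=
  map_pos_pow_le (T := A.laplacian θ) (σ := LinearMap.id) hθ.laplacian_mul (fun _ _ h => h)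
    (fun _ => hθ.laplacian_mem_pos) hn ha

theorem laplacian_one (hθ : A.IsContraction θ) : A.laplacian θ 1 = 0 := by
  have h := hθ.laplacian_mul 1 1
  rwa [mul_one, mul_one, one_mul, left_eq_add] at h

theorem proj_laplacian (hθ : A.IsContraction θ) (n : ℕ) (a : A) :
    A.proj n (A.laplacian θ a) = A.laplacian θ (A.proj n a) := by
  refine LinearMap.congr_fun (linearMap_ext_gr (f := A.proj n ∘ₗ A.laplacian θ)
    (g := A.laplacian θ ∘ₗ A.proj n) fun m a ha => ?_) a
  rw [LinearMap.comp_apply, LinearMap.comp_apply]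
  by_cases h : m = n
  · subst h
    rw [proj_of_mem ha, proj_of_mem (hθ.laplacian_mem ha)]
  · rw [proj_of_mem_ne h ha, proj_of_mem_ne h (hθ.laplacian_mem ha), map_zero]

variable (A θ) in
/-- The elements of word length `n` on which the operator `dθ + θd` acts as multiplication by `j`
up to elements of larger word length. -/
def weight (n j : ℕ) : Submodule ℚ A :=
  A.pos ^ n ⊓ (A.pos ^ (n + 1)).comap (A.laplacian θ - (j : ℚ) • LinearMap.id)

variable (A θ) in
/-- The sum of the spaces of elements of positive weight. -/
def posWeight (n : ℕ) : Submodule ℚ A := ⨆ j : ℕ, weight A θ n (j + 1)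

theorem mem_weight {n j : ℕ} {a : A} : a ∈ weight A θ n j ↔
    a ∈ A.pos ^ n ∧ A.laplacian θ a - (j : ℚ) • a ∈ A.pos ^ (n + 1) := Iff.rfl

/-- For a derivation eigenvalues add under multiplication, and so do word lengths. -/
theorem weight_mul_le (hθ : A.IsContraction θ) (m n i j : ℕ) :
    weight A θ m i * weight A θ n j ≤ weight A θ (m + n) (i + j) := by
  rw [Submodule.mul_le]
  rintro a ha b hb
  rw [mem_weight] at *
  refine ⟨by rw [pow_add]; exact Submodule.mul_mem_mul ha.1 hb.1, ?_⟩
  have h : A.laplacian θ (a * b) - ((i + j : ℕ) : ℚ) • (a * b) =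
      (A.laplacian θ a - (i : ℚ) • a) * b + a * (A.laplacian θ b - (j : ℚ) • b) := by
    rw [hθ.laplacian_mul, sub_mul, mul_sub, smul_mul_assoc, mul_smul_comm, Nat.cast_add, add_smul]
    abel
  rw [h]
  refine Submodule.add_mem _ ?_ ?_
  · rw [show m + n + 1 = (m + 1) + n by omega, pow_add]
    exact Submodule.mul_mem_mul ha.2 hb.1
  · rw [show m + n + 1 = m + (n + 1) by omega, pow_add A.pos m]
    exact Submodule.mul_mem_mul ha.1 hb.2

theorem weight_le_posWeight (n j : ℕ) : weight A θ n (j + 1) ≤ posWeight A θ n :=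
  le_iSup (fun j => weight A θ n (j + 1)) j

theorem pow_le_weight_zero (hθ : A.IsContraction θ) {X : Submodule ℚ A} (hX : X ≤ weight A θ 1 0)
    {n : ℕ} (hn : 1 ≤ n) : X ^ n ≤ weight A θ n 0 := by
  induction n, hn using Nat.le_induction with
  | base => rwa [pow_one]
  | succ n hn ih => exact (mul_le_mul' ih hX).trans (hθ.weight_mul_le n 1 0 0)

/-- If the indecomposables are spanned by `X` and elements of positive weight, then the words of
length `n` are spanned by words in `X` and elements of positive weight. -/
theorem pos_pow_le (hθ : A.IsContraction θ) {X : Submodule ℚ A} (hX : X ≤ weight A θ 1 0)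
    (hpos : A.pos ≤ X ⊔ posWeight A θ 1) {n : ℕ} (hn : 1 ≤ n) :
    A.pos ^ n ≤ X ^ n ⊔ posWeight A θ n := by
  induction n, hn using Nat.le_induction with
  | base => rwa [pow_one, pow_one]
  | succ n hn ih =>
    rw [pow_succ]
    refine (mul_le_mul' ih hpos).trans ?_
    -- Of the four products only `X ^ n * X` has weight zero; weights are natural numbers, so no sum
    -- with a positive one cancels.
    rw [Submodule.sup_mul, Submodule.mul_sup, Submodule.mul_sup]
    refine sup_le (sup_le ?_ ?_) (sup_le ?_ ?_)
    · exact le_trans (pow_succ X n).ge le_sup_left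
    · refine le_trans ?_ le_sup_right
      rw [posWeight, Submodule.mul_iSup]
      exact iSup_le fun j => (mul_le_mul' (hθ.pow_le_weight_zero hX hn) le_rfl).trans
        ((hθ.weight_mul_le n 1 0 (j + 1)).trans (by rw [zero_add]; exact weight_le_posWeight _ j))
    · refine le_trans ?_ le_sup_right
      rw [posWeight, Submodule.iSup_mul]
      exact iSup_le fun j => (mul_le_mul' le_rfl hX).trans
        ((hθ.weight_mul_le n 1 (j + 1) 0).trans (weight_le_posWeight _ j))
    · refine le_trans ?_ le_sup_right
      rw [posWeight, Submodule.iSup_mul]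
      refine iSup_le fun i => ?_
      rw [posWeight, Submodule.mul_iSup]
      exact iSup_le fun j => (hθ.weight_mul_le n 1 (i + 1) (j + 1)).trans
        (weight_le_posWeight _ (i + 1 + j))

/-- On weight `j + 1` the polynomial `X - (j + 1)` leads to longer words and does not vanish at `0`.
For sums the polynomials are multiplied. -/
theorem exists_polynomial_of_mem_posWeight (hθ : A.IsContraction θ) {n : ℕ} {a : A}
    (ha : a ∈ posWeight A θ n) :
    ∃ ρ : ℚ[X], ρ.eval 0 ≠ 0 ∧ aeval (A.laplacian θ) ρ a ∈ A.pos ^ (n + 1) := by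
  have hst : ∀ (p : ℚ[X]) {b : A}, b ∈ A.pos ^ (n + 1) →
      aeval (A.laplacian θ) p b ∈ A.pos ^ (n + 1) := fun p b hb =>
    aeval_mem (fun c hc => hθ.laplacian_mem_pos_pow (by omega) hc) p hb
  induction ha using Submodule.iSup_induction' with
  | mem j a ha =>
    refine ⟨X - C ((j + 1 : ℕ) : ℚ), ?_, ?_⟩
    · rw [eval_sub, eval_X, eval_C, zero_sub, neg_ne_zero, Nat.cast_ne_zero]
      omega
    · have h := (mem_weight.mp ha).2
      rwa [map_sub, aeval_X, aeval_C, LinearMap.sub_apply, Module.algebraMap_end_apply]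
  | zero => exact ⟨1, by simp, by simp⟩
  | add a b _ _ ha hb =>
    obtain ⟨ρ, hρ, hρa⟩ := ha
    obtain ⟨σ, hσ, hσb⟩ := hb
    refine ⟨ρ * σ, by rw [eval_mul]; exact mul_ne_zero hρ hσ, ?_⟩
    rw [map_add]
    refine Submodule.add_mem _ ?_ ?_
    · rw [mul_comm, aeval_mul_apply]
      exact hst _ hρa
    · rw [aeval_mul_apply]
      exact hst _ hσb

/-- Weights of words of length `1` are defined modulo `A.pos ^ 2`, so decomposables have every
weight. Taking it to be `1` allows them to be absorbed into `posWeight A θ 1`. -/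
theorem pos_sq_le_posWeight (hθ : A.IsContraction θ) : A.pos ^ 2 ≤ posWeight A θ 1 :=
  fun _ ha => weight_le_posWeight 1 0 (mem_weight.mpr ⟨by rw [pow_one]; exact pos_sq_le ha,
    Submodule.sub_mem _ (hθ.laplacian_mem_pos_pow one_le_two ha) (Submodule.smul_mem _ _ ha)⟩)

theorem pos_le_weight_sup (hθ : A.IsContraction θ) :
    A.pos ≤ weight A θ 1 0 ⊔ posWeight A θ 1 := by
  intro a ha
  obtain ⟨v, hv, w, hw, f, hf, rfl, h1, h2⟩ := hθ.exists_add_add a ha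
  rw [add_assoc]
  refine Submodule.add_mem_sup (mem_weight.mpr ⟨by rwa [pow_one], ?_⟩) (Submodule.add_mem _
    (weight_le_posWeight 1 0 (mem_weight.mpr ⟨by rwa [pow_one], ?_⟩)) (hθ.pos_sq_le_posWeight hf))
  · rwa [Nat.cast_zero, zero_smul, sub_zero]
  · rwa [zero_add, Nat.cast_one, one_smul]

/-- Every element is annihilated by a nonzero polynomial in `dθ + θd`. -/
theorem exists_annihilator (hθ : A.IsContraction θ) (a : A) :
    ∃ (N : ℕ) (ρ : ℚ[X]), ρ.eval 0 ≠ 0 ∧ aeval (A.laplacian θ) (X ^ N * ρ) a = 0 := by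
  -- One step along the filtration: modulo longer words, the factor `X` kills the words of weight
  -- zero and `ρ` the words of positive weight.
  have step : ∀ n, 1 ≤ n → ∀ a ∈ A.pos ^ n,
      ∃ ρ : ℚ[X], ρ.eval 0 ≠ 0 ∧ aeval (A.laplacian θ) (X * ρ) a ∈ A.pos ^ (n + 1) := by
    intro n hn a ha
    obtain ⟨b, hb, c, hc, rfl⟩ := Submodule.mem_sup.mp
      (hθ.pos_pow_le le_rfl hθ.pos_le_weight_sup hn ha)
    obtain ⟨ρ, hρ, hρc⟩ := hθ.exists_polynomial_of_mem_posWeight hc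
    have hst : ∀ c ∈ A.pos ^ (n + 1), A.laplacian θ c ∈ A.pos ^ (n + 1) :=
      fun c hc => hθ.laplacian_mem_pos_pow (by omega) hc
    refine ⟨ρ, hρ, ?_⟩
    rw [map_add]
    refine Submodule.add_mem _ ?_ ?_
    · have h := (mem_weight.mp (hθ.pow_le_weight_zero le_rfl hn hb)).2
      rw [Nat.cast_zero, zero_smul, sub_zero] at h
      rw [mul_comm, aeval_mul_apply, aeval_X]
      exact aeval_mem hst _ h
    · rw [aeval_mul_apply]
      exact aeval_mem hst _ hρc
  have iter : ∀ n, ∀ a ∈ A.pos, ∃ (N : ℕ) (ρ : ℚ[X]), ρ.eval 0 ≠ 0 ∧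
      aeval (A.laplacian θ) (X ^ N * ρ) a ∈ A.pos ^ (n + 1) := by
    intro n
    induction n with
    | zero => exact fun a ha => ⟨0, 1, by simp, by simpa using ha⟩
    | succ n ih =>
      intro a ha
      obtain ⟨N, ρ, hρ, h⟩ := ih a ha
      obtain ⟨σ, hσ, h'⟩ := step (n + 1) (by omega) _ h
      refine ⟨N + 1, ρ * σ, by rw [eval_mul]; exact mul_ne_zero hρ hσ, ?_⟩
      rwa [← aeval_mul_apply, show X * σ * (X ^ N * ρ) = X ^ (N + 1) * (ρ * σ) by ring] at h'
  refine induction_gr (P := fun a => ∃ (N : ℕ) (ρ : ℚ[X]), ρ.eval 0 ≠ 0 ∧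
    aeval (A.laplacian θ) (X ^ N * ρ) a = 0) ?_ ?_ ?_ a
  · rintro a b ⟨N, ρ, hρ, ha⟩ ⟨M, σ, hσ, hb⟩
    refine ⟨N + M, ρ * σ, by rw [eval_mul]; exact mul_ne_zero hρ hσ, ?_⟩
    rw [map_add, show X ^ (N + M) * (ρ * σ) = (X ^ M * σ) * (X ^ N * ρ) by ring,
      aeval_mul_apply, ha, map_zero, zero_add, mul_comm, aeval_mul_apply, hb, map_zero]
  · exact ⟨0, 1, by simp, by simp⟩
  · intro n a ha
    rcases Nat.eq_zero_or_pos n with rfl | hn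
    · obtain ⟨r, rfl⟩ := hθ.connected a ha
      refine ⟨1, 1, by simp, ?_⟩
      rw [mul_one, pow_one, aeval_X, Algebra.algebraMap_eq_smul_one, map_smul, hθ.laplacian_one,
        smul_zero]
    -- Words of length `n + 1` vanish in degree `n`, so finitely many steps suffice.
    · obtain ⟨N, ρ, hρ, h⟩ := iter n a (mem_pos_of_mem_gr hn ha)
      exact ⟨N, ρ, hρ, eq_zero_of_mem_pos_pow (Nat.lt_succ_self n)
        (aeval_mem (fun c hc => hθ.laplacian_mem hc) _ ha) h⟩

/-- The generalized kernel of `dθ + θd`, a subalgebra that carries a minimal model of `A`. -/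
def minimalPart (hθ : A.IsContraction θ) : Subalgebra ℚ A where
  carrier := {a | ∃ N : ℕ, aeval (A.laplacian θ) (X ^ N : ℚ[X]) a = 0}
  mul_mem' := by
    rintro a b ⟨M, ha⟩ ⟨N, hb⟩
    -- Induction on the sum of the exponents: in `L (a * b) = L a * b + a * L b` each summand has a
    -- factor whose exponent has dropped by one.
    obtain ⟨n, hn⟩ : ∃ n, M + N = n := ⟨_, rfl⟩
    induction n generalizing a b M N with
    | zero =>
      obtain rfl : M = 0 := by omega
      rw [pow_zero, map_one, Module.End.one_apply] at ha
      exact ⟨0, by simp [ha]⟩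
    | succ n ih =>
      rcases M with _ | M
      · rw [pow_zero, map_one, Module.End.one_apply] at ha
        exact ⟨0, by simp [ha]⟩
      rcases N with _ | N
      · rw [pow_zero, map_one, Module.End.one_apply] at hb
        exact ⟨0, by simp [hb]⟩
      obtain ⟨K₁, h₁⟩ := ih M (by rwa [pow_succ, aeval_mul_apply, aeval_X] at ha) (N + 1) hb
        (by omega)
      obtain ⟨K₂, h₂⟩ := ih (M + 1) ha N (by rwa [pow_succ, aeval_mul_apply, aeval_X] at hb)
        (by omega)
      refine ⟨K₁ + K₂ + 1, ?_⟩
      rw [pow_succ, aeval_mul_apply, aeval_X, hθ.laplacian_mul, map_add, pow_add, aeval_mul_apply,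
        aeval_mul_apply, h₂, map_zero, add_zero, ← aeval_mul_apply, mul_comm, aeval_mul_apply, h₁,
        map_zero]
  add_mem' := by
    rintro a b ⟨M, ha⟩ ⟨N, hb⟩
    refine ⟨M + N, ?_⟩
    rw [map_add, pow_add, aeval_mul_apply, aeval_mul_apply, hb, map_zero, add_zero,
      ← aeval_mul_apply, mul_comm, aeval_mul_apply, ha, map_zero]
  algebraMap_mem' r := ⟨1, by
    rw [pow_one, aeval_X, Algebra.algebraMap_eq_smul_one, map_smul, hθ.laplacian_one, smul_zero]⟩

theorem d_mem_minimalPart (hθ : A.IsContraction θ) {a : A} (ha : a ∈ hθ.minimalPart) :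
    A.d a ∈ hθ.minimalPart := by
  obtain ⟨N, h⟩ := ha
  exact ⟨N, by rw [aeval_laplacian_d, h, map_zero]⟩

/-- `X ^ N` and `ρ` are coprime, so by Bézout no nonzero element is killed by both. -/
theorem eq_zero_of_mem_minimalPart {hθ : A.IsContraction θ} {a : A} (ha : a ∈ hθ.minimalPart)
    {ρ : ℚ[X]} (hρ : ρ.eval 0 ≠ 0) (h : aeval (A.laplacian θ) ρ a = 0) : a = 0 := by
  obtain ⟨N, hN⟩ := ha
  obtain ⟨p, q, hpq⟩ := isCoprime_X_pow hρ N
  have h1 := congrArg (fun r : ℚ[X] => aeval (A.laplacian θ) r a) hpq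
  simp only [map_add, LinearMap.add_apply, aeval_mul_apply, hN, h, map_zero, map_one,
    Module.End.one_apply, add_zero] at h1
  exact h1.symm

theorem proj_mem_minimalPart (hθ : A.IsContraction θ) {a : A} (ha : a ∈ hθ.minimalPart) (n : ℕ) :
    A.proj n a ∈ hθ.minimalPart := by
  obtain ⟨N, h⟩ := ha
  refine ⟨N, ?_⟩
  have key : ∀ N a, aeval (A.laplacian θ) (X ^ N : ℚ[X]) (A.proj n a) =
      A.proj n (aeval (A.laplacian θ) (X ^ N : ℚ[X]) a) := by
    intro N
    induction N with
    | zero => simp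
    | succ N ih =>
      intro a
      rw [pow_succ, aeval_mul_apply, aeval_mul_apply, aeval_X, ← hθ.proj_laplacian, ih]
  rw [key, h, map_zero]

/-- Every element is the sum of an element of the minimal part and an element on which `dθ + θd` is
invertible, and both are polynomials in `dθ + θd` applied to the element. -/
theorem exists_decomposition (hθ : A.IsContraction θ) (a : A) :
    ∃ p q ρ : ℚ[X], ρ.eval 0 ≠ 0 ∧ p + q * X = 1 ∧
      aeval (A.laplacian θ) p a ∈ hθ.minimalPart ∧
      aeval (A.laplacian θ) ρ (aeval (A.laplacian θ) (q * X) a) = 0 := by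
  obtain ⟨N, ρ, hρ, h⟩ := hθ.exists_annihilator a
  obtain ⟨s, t, hst⟩ := isCoprime_X_pow hρ (N + 1)
  -- Bézout is applied to `X ^ (N + 1)` instead of `X ^ N` so that the complementary component keeps
  -- a factor `X`. It is then a polynomial in `L` applied to `L a`, which `exists_lift` uses.
  refine ⟨t * ρ, s * X ^ N, ρ, hρ, ?_, ⟨N, ?_⟩, ?_⟩
  · rw [← hst]
    ring
  · rw [← aeval_mul_apply, show X ^ N * (t * ρ) = t * (X ^ N * ρ) by ring, aeval_mul_apply, h,
      map_zero]
  · rw [← aeval_mul_apply, show ρ * (s * X ^ N * X) = (s * X) * (X ^ N * ρ) by ring,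
      aeval_mul_apply, h, map_zero]

theorem add_eq_of_add_eq_one {p q : ℚ[X]} (h : p + q = 1) (a : A) :
    aeval (A.laplacian θ) p a + aeval (A.laplacian θ) q a = a := by
  rw [← LinearMap.add_apply, ← map_add, h, map_one, Module.End.one_apply]

/-- A cocycle on which `dθ + θd` is invertible is a coboundary. -/
theorem exists_d_eq {ρ : ℚ[X]} (hρ : ρ.eval 0 ≠ 0) {a : A}
    (h : aeval (A.laplacian θ) ρ a = 0) (hd : A.d a = 0) : ∃ b, A.d b = a := by
  -- Write `ρ = X * ρ.divX + ρ(0)`. On cocycles `L` is `dθ`, so `ρ(L) a = 0` says that `ρ(0) • a` is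
  -- minus the coboundary of `θ (ρ.divX(L) a)`.
  have h1 := congrArg (fun p : ℚ[X] => aeval (A.laplacian θ) p a) (X_mul_divX_add ρ)
  simp only [map_add, LinearMap.add_apply, aeval_mul_apply, aeval_X, h, aeval_C,
    Module.algebraMap_end_apply] at h1
  rw [laplacian_apply, ← aeval_laplacian_d, hd, map_zero, map_zero, add_zero,
    coeff_zero_eq_eval_zero] at h1
  refine ⟨-(ρ.eval 0)⁻¹ • θ (aeval (A.laplacian θ) ρ.divX a), ?_⟩
  rw [map_smul, eq_neg_of_add_eq_zero_left h1, neg_smul, smul_neg, neg_neg, smul_smul,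
    inv_mul_cancel₀ hρ, one_smul]

/-- A cocycle is cohomologous to one in the minimal part. -/
theorem exists_cocycle (hθ : A.IsContraction θ) {a : A} (ha : A.d a = 0) :
    ∃ a₀ ∈ hθ.minimalPart, A.d a₀ = 0 ∧ ∃ b, A.d b = a - a₀ := by
  obtain ⟨p, q, ρ, hρ, hpq, hp, hq⟩ := hθ.exists_decomposition a
  refine ⟨_, hp, by rw [← aeval_laplacian_d, ha, map_zero], ?_⟩
  obtain ⟨b, hb⟩ := exists_d_eq hρ hq (by rw [← aeval_laplacian_d, ha, map_zero])
  exact ⟨b, by rw [hb, eq_sub_iff_add_eq', add_eq_of_add_eq_one hpq]⟩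

/-- A coboundary in the minimal part is the coboundary of an element of the minimal part. -/
theorem exists_d_eq_of_mem_minimalPart (hθ : A.IsContraction θ) {b : A}
    (hb : A.d b ∈ hθ.minimalPart) : ∃ b₀ ∈ hθ.minimalPart, A.d b₀ = A.d b := by
  obtain ⟨p, q, ρ, hρ, hpq, hp, hq⟩ := hθ.exists_decomposition b
  refine ⟨_, hp, ?_⟩
  have h1 := congrArg A.d (add_eq_of_add_eq_one (θ := θ) hpq b)
  rw [map_add] at h1
  -- The coboundary of the other component is killed by `ρ(L)`, but as a difference it also lies in
  -- the minimal part. Hence it is zero.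
  have h2 : A.d (aeval (A.laplacian θ) (q * X) b) ∈ hθ.minimalPart := by
    rw [← eq_sub_iff_add_eq'] at h1
    rw [h1]
    exact Subalgebra.sub_mem _ hb (hθ.d_mem_minimalPart hp)
  rw [eq_zero_of_mem_minimalPart h2 hρ (by rw [aeval_laplacian_d, hq, map_zero]), add_zero] at h1
  exact h1

/-- A generator killed by `dθ + θd` up to decomposables is congruent to an element of the minimal
part. -/
theorem exists_lift (hθ : A.IsContraction θ) {n : ℕ} {a : A} (ha : a ∈ A.gr n)
    (h : A.laplacian θ a ∈ A.pos ^ 2) :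
    ∃ a₀ ∈ hθ.minimalPart, a₀ ∈ A.gr n ∧ a - a₀ ∈ A.pos ^ 2 := by
  obtain ⟨p, q, ρ, hρ, hpq, hp, hq⟩ := hθ.exists_decomposition a
  refine ⟨_, hp, aeval_mem (fun c hc => hθ.laplacian_mem hc) _ ha, ?_⟩
  rw [← eq_sub_of_add_eq' (add_eq_of_add_eq_one hpq a), aeval_mul_apply, aeval_X]
  exact aeval_mem (fun c hc => hθ.laplacian_mem_pos_pow one_le_two hc) _ h

/-- Successive approximation along word length. Modulo longer words, an element of the minimal part
is a polynomial in the `g i` plus a term of positive weight. This term is killed by a power of `X`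
and, up to longer words, also by some `ρ` with `ρ(0) ≠ 0`; by Bézout it consists of longer words
itself. -/
theorem mem_adjoin_of_mem_minimalPart (hθ : A.IsContraction θ) {ι : Type*} {g : ι → A}
    {deg : ι → ℕ} (hg : ∀ i, g i ∈ A.gr (deg i)) (hmin : ∀ i, g i ∈ hθ.minimalPart)
    (hwt : ∀ i, g i ∈ weight A θ 1 0)
    (hpos : A.pos ≤ Submodule.span ℚ (Set.range g) ⊔ posWeight A θ 1) {a : A}
    (ha : a ∈ hθ.minimalPart) : a ∈ Algebra.adjoin ℚ (Set.range g) := by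
  set W := Submodule.span ℚ (Set.range g) with hW
  have hWmin : W ≤ Subalgebra.toSubmodule hθ.minimalPart :=
    Submodule.span_le.mpr (by rintro _ ⟨i, rfl⟩; exact hmin i)
  have hWwt : W ≤ weight A θ 1 0 := Submodule.span_le.mpr (by rintro _ ⟨i, rfl⟩; exact hwt i)
  have hpow : ∀ (B : Subalgebra ℚ A), W ≤ Subalgebra.toSubmodule B → ∀ n,
      W ^ n ≤ Subalgebra.toSubmodule B := by
    intro B hB n
    induction n with
    | zero => rw [pow_zero]; exact Submodule.one_le.mpr B.one_mem
    | succ n ih =>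
      rw [pow_succ]
      exact Submodule.mul_le.mpr fun x hx y hy => B.mul_mem (ih hx) (hB hy)
  have step : ∀ n, 1 ≤ n → ∀ a ∈ hθ.minimalPart, a ∈ A.pos ^ n →
      ∃ b ∈ W ^ n, a - b ∈ hθ.minimalPart ∧ a - b ∈ A.pos ^ (n + 1) := by
    intro n hn a ha han
    obtain ⟨b, hb, w, hw, rfl⟩ := Submodule.mem_sup.mp (hθ.pos_pow_le hWwt hpos hn han)
    refine ⟨b, hb, Subalgebra.sub_mem _ ha (hpow _ hWmin n hb), ?_⟩
    obtain ⟨N, hN⟩ := Subalgebra.sub_mem _ ha (hpow _ hWmin n hb)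
    rw [add_sub_cancel_left] at *
    obtain ⟨ρ, hρ, h⟩ := hθ.exists_polynomial_of_mem_posWeight hw
    obtain ⟨s, t, hst⟩ := isCoprime_X_pow hρ N
    rw [← add_eq_of_add_eq_one hst w, aeval_mul_apply, hN, map_zero, zero_add, aeval_mul_apply]
    exact aeval_mem (fun c hc => hθ.laplacian_mem_pos_pow (by omega) hc) _ h
  have hWadj : W ≤ Subalgebra.toSubmodule (Algebra.adjoin ℚ (Set.range g)) :=
    Submodule.span_le.mpr Algebra.subset_adjoin
  have iter : ∀ n, ∀ a ∈ hθ.minimalPart, a ∈ A.pos →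
      ∃ b ∈ Algebra.adjoin ℚ (Set.range g), a - b ∈ hθ.minimalPart ∧ a - b ∈ A.pos ^ (n + 1) := by
    intro n
    induction n with
    | zero =>
      exact fun a ha hap => ⟨0, Subalgebra.zero_mem _, by simpa using ha, by simpa using hap⟩
    | succ n ih =>
      intro a ha hap
      obtain ⟨b, hb, h1, h2⟩ := ih a ha hap
      obtain ⟨c, hc, h3, h4⟩ := step (n + 1) (by omega) _ h1 h2
      rw [sub_sub] at h3 h4
      exact ⟨b + c, Subalgebra.add_mem _ hb (hpow _ hWadj _ hc), h3, h4⟩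
  have hproj : ∀ n, ∀ b ∈ Algebra.adjoin ℚ (Set.range g),
      A.proj n b ∈ Algebra.adjoin ℚ (Set.range g) := by
    intro n b hb
    have hcl : ∀ c ∈ Submonoid.closure (Set.range g), ∃ m, c ∈ A.gr m := by
      intro c hc
      induction hc using Submonoid.closure_induction with
      | mem x hx => obtain ⟨i, rfl⟩ := hx; exact ⟨_, hg i⟩
      | one => exact ⟨0, one_mem_gr⟩
      | mul x y _ _ hx hy =>
        obtain ⟨i, hx⟩ := hx
        obtain ⟨j, hy⟩ := hy
        exact ⟨i + j, mul_mem_gr hx hy⟩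
    have hb' : b ∈ Submodule.span ℚ (Submonoid.closure (Set.range g) : Set A) := by
      rwa [← Algebra.adjoin_eq_span]
    clear hb
    induction hb' using Submodule.span_induction with
    | mem x hx =>
      obtain ⟨m, hm⟩ := hcl x hx
      have hx' : x ∈ Algebra.adjoin ℚ (Set.range g) := by
        rw [← Subalgebra.mem_toSubmodule, Algebra.adjoin_eq_span]
        exact Submodule.subset_span hx
      by_cases h : m = n
      · rwa [proj_of_mem (h ▸ hm)]
      · rw [proj_of_mem_ne h hm]
        exact Subalgebra.zero_mem _
    | zero => rw [map_zero]; exact Subalgebra.zero_mem _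
    | add x y _ _ hx hy => rw [map_add]; exact Subalgebra.add_mem _ hx hy
    | smul r x _ hx => rw [map_smul]; exact Subalgebra.smul_mem _ hx r
  obtain ⟨s, hs⟩ := sum_proj a
  rw [hs]
  refine Subalgebra.sum_mem _ fun n _ => ?_
  have han := hθ.proj_mem_minimalPart ha n
  rcases Nat.eq_zero_or_pos n with rfl | hn
  · obtain ⟨r, hr⟩ := hθ.connected _ (proj_mem 0 a)
    rw [← hr]
    exact Subalgebra.algebraMap_mem _ r
  -- The remainder has word length above `n`, hence no component in degree `n`. The approximation
  -- `b` need not be homogeneous and is projected to degree `n`.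
  · obtain ⟨b, hb, -, h⟩ := iter n _ han (mem_pos_of_mem_gr hn (proj_mem n a))
    have h1 := mem_lowerBound.mp (pos_pow_le_lowerBound _ h) n (Nat.lt_succ_self n)
    rw [map_sub, proj_of_mem (proj_mem n a), sub_eq_zero] at h1
    rw [h1]
    exact hproj n b hb

end IsContraction

end Laplacian

end CDGA

/-! ### The algebras `ℚ[X] ⊗ Λ⟨ε⟩`, realized as dual numbers over a polynomial ring. -/

theorem SymmetricAlgebra.algHom_ext_of_forall {M T : Type*} [AddCommGroup M] [Module ℚ M]
    [Ring T] [Algebra ℚ T] {f g : SymmetricAlgebra ℚ M →ₐ[ℚ] T}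
    (h : ∀ v, f (SymmetricAlgebra.ι ℚ M v) = g (SymmetricAlgebra.ι ℚ M v)) : f = g := by
  refine AlgHom.ext fun a => ?_
  induction a using SymmetricAlgebra.induction with
  | algebraMap r => rw [AlgHom.commutes, AlgHom.commutes]
  | ι v => exact h v
  | mul a b ha hb => rw [map_mul, map_mul, ha, hb]
  | add a b ha hb => rw [map_add, map_add, ha, hb]

namespace CDGA

open MvPolynomial DualNumber TrivSqZeroExt

section Koszul

variable {σ : Type u} (w : σ → ℕ) (q : ℕ)

/-- The polynomials all of whose monomials have weighted degree `n - k`. -/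
def shiftedHomogeneous (k n : ℕ) : Submodule ℚ (MvPolynomial σ ℚ) where
  -- Adding `k` on the left instead of subtracting it from `n` makes the space zero for `n < k`.
  carrier := {φ | ∀ m, coeff m φ ≠ 0 → Finsupp.weight w m + k = n}
  add_mem' := by
    intro φ ψ hφ hψ m hm
    by_contra h
    rw [coeff_add, not_not.mp (mt (hφ m) h), not_not.mp (mt (hψ m) h), add_zero] at hm
    exact hm rfl
  zero_mem' := fun m hm => absurd (coeff_zero m) hm
  smul_mem' := by
    intro r φ hφ m hm
    refine hφ m fun h => hm ?_
    rw [coeff_smul, h, smul_zero]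

variable {w}

theorem mul_mem_shiftedHomogeneous {k l m n : ℕ} {φ ψ : MvPolynomial σ ℚ}
    (hφ : φ ∈ shiftedHomogeneous w k m) (hψ : ψ ∈ shiftedHomogeneous w l n) :
    φ * ψ ∈ shiftedHomogeneous w (k + l) (m + n) := by
  classical
  intro d hd
  rw [coeff_mul] at hd
  obtain ⟨⟨i, j⟩, hij, h⟩ := Finset.exists_ne_zero_of_sum_ne_zero hd
  have h1 := hφ i (left_ne_zero_of_mul h)
  have h2 := hψ j (right_ne_zero_of_mul h)
  rw [← Finset.HasAntidiagonal.mem_antidiagonal.mp hij, map_add]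
  dsimp only at h1 h2 ⊢
  omega

theorem monomial_mem_shiftedHomogeneous (k : ℕ) (m : σ →₀ ℕ) (r : ℚ) :
    monomial m r ∈ shiftedHomogeneous w k (Finsupp.weight w m + k) := by
  classical
  intro d hd
  rw [coeff_monomial] at hd
  split_ifs at hd with h
  · rw [h]
  · exact absurd rfl hd

variable (w) in
/-- The part of degree `n` of `ℚ[X] ⊕ ℚ[X] ε`, where `ε` has degree `q`. -/
def koszulGr (n : ℕ) : Submodule ℚ (DualNumber (MvPolynomial σ ℚ)) where
  carrier := {t | t.fst ∈ shiftedHomogeneous w 0 n ∧ t.snd ∈ shiftedHomogeneous w q n}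
  add_mem' := fun hs ht => ⟨Submodule.add_mem _ hs.1 ht.1, Submodule.add_mem _ hs.2 ht.2⟩
  zero_mem' := ⟨Submodule.zero_mem _, Submodule.zero_mem _⟩
  smul_mem' := fun r _ ht => ⟨Submodule.smul_mem _ r ht.1, Submodule.smul_mem _ r ht.2⟩

variable {q}

variable (w) in
/-- The projection of a polynomial to its part of weighted degree `n - k`. -/
noncomputable def shiftedProj (k n : ℕ) : MvPolynomial σ ℚ →ₗ[ℚ] MvPolynomial σ ℚ :=
  (basisMonomials σ ℚ).constr ℚ fun m => if Finsupp.weight w m + k = n then monomial m 1 else 0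

theorem shiftedProj_monomial (k n : ℕ) (m : σ →₀ ℕ) (r : ℚ) :
    shiftedProj w k n (monomial m r) =
      if Finsupp.weight w m + k = n then monomial m r else 0 := by
  have h : monomial m r = r • (basisMonomials σ ℚ m) := by
    rw [coe_basisMonomials, smul_monomial, smul_eq_mul, mul_one]
  rw [h, map_smul, shiftedProj, Module.Basis.constr_basis, coe_basisMonomials]
  split_ifs <;> simp

theorem shiftedProj_of_mem {k n : ℕ} {φ : MvPolynomial σ ℚ}
    (hφ : φ ∈ shiftedHomogeneous w k n) : shiftedProj w k n φ = φ := by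
  conv_lhs => rw [φ.as_sum]
  conv_rhs => rw [φ.as_sum]
  rw [map_sum]
  refine Finset.sum_congr rfl fun m hm => ?_
  rw [shiftedProj_monomial, if_pos (hφ m (mem_support_iff.mp hm))]

theorem shiftedProj_of_mem_ne {k m n : ℕ} (hmn : m ≠ n) {φ : MvPolynomial σ ℚ}
    (hφ : φ ∈ shiftedHomogeneous w k m) : shiftedProj w k n φ = 0 := by
  rw [φ.as_sum, map_sum]
  refine Finset.sum_eq_zero fun d hd => ?_
  rw [shiftedProj_monomial, if_neg]
  rw [hφ d (mem_support_iff.mp hd)]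
  exact hmn

theorem koszulGr_isInternal : DirectSum.IsInternal (koszulGr w q) := by
  refine isInternal_of_proj _ (fun n =>
    { toFun := fun t => inl (shiftedProj w 0 n t.fst) + inr (shiftedProj w q n t.snd)
      map_add' := fun s t => by ext <;> simp
      map_smul' := fun r t => by ext <;> simp }) ?_ ?_ ?_
  · intro n t ht
    ext1
    · simp [shiftedProj_of_mem ht.1]
    · simp [shiftedProj_of_mem ht.2]
  · intro m n hmn t ht
    ext1
    · simp [shiftedProj_of_mem_ne hmn ht.1]
    · simp [shiftedProj_of_mem_ne hmn ht.2]
  · rw [eq_top_iff]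
    rintro t -
    rw [← inl_fst_add_inr_snd_eq t]
    refine Submodule.add_mem _ ?_ ?_
    · induction t.fst using MvPolynomial.induction_on' with
      | monomial m r =>
        refine Submodule.mem_iSup_of_mem (Finsupp.weight w m + 0) ⟨?_, ?_⟩
        · rw [fst_inl]
          exact monomial_mem_shiftedHomogeneous 0 m r
        · rw [snd_inl]
          exact Submodule.zero_mem _
      | add φ ψ hφ hψ => rw [inl_add]; exact Submodule.add_mem _ hφ hψ
    · induction t.snd using MvPolynomial.induction_on' with
      | monomial m r =>
        refine Submodule.mem_iSup_of_mem (Finsupp.weight w m + q) ⟨?_, ?_⟩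
        · rw [fst_inr]
          exact Submodule.zero_mem _
        · rw [snd_inr]
          exact monomial_mem_shiftedHomogeneous q m r
      | add φ ψ hφ hψ => rw [inr_add]; exact Submodule.add_mem _ hφ hψ

instance koszulGr_gradedMonoid : SetLike.GradedMonoid (koszulGr w q) where
  one_mem := ⟨by simpa using monomial_mem_shiftedHomogeneous (w := w) 0 0 1, by
    rw [snd_one]; exact Submodule.zero_mem _⟩
  mul_mem := by
    rintro m n s t ⟨hs1, hs2⟩ ⟨ht1, ht2⟩
    refine ⟨?_, ?_⟩
    · rw [fst_mul]
      exact mul_mem_shiftedHomogeneous hs1 ht1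
    · rw [DualNumber.snd_mul]
      refine Submodule.add_mem _ ?_ ?_
      · simpa using mul_mem_shiftedHomogeneous hs1 ht2
      · simpa using mul_mem_shiftedHomogeneous hs2 ht1

noncomputable instance koszulGr_gradedAlgebra : GradedAlgebra (koszulGr w q) :=
  { koszulGr_isInternal.chooseDecomposition with }

theorem even_weight (hw : ∀ i, Even (w i)) (m : σ →₀ ℕ) : Even (Finsupp.weight w m) := by
  rw [Finsupp.weight_apply]
  exact Finset.even_sum _ fun i _ => (hw i).mul_left _

/-- The weights are even and `q` is odd, so the parity of the degree separates `ℚ[X]` from `ℚ[X] ε`.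
-/
theorem snd_eq_zero_of_even (hw : ∀ i, Even (w i)) (hq : Odd q) {n : ℕ} (hn : Even n)
    {t : DualNumber (MvPolynomial σ ℚ)} (ht : t ∈ koszulGr w q n) : t.snd = 0 := by
  ext m
  rw [coeff_zero]
  by_contra h
  have := ht.2 m h
  have h2 := (even_weight hw m).add_odd hq
  rw [this] at h2
  exact (Nat.not_odd_iff_even.mpr hn) h2

theorem fst_eq_zero_of_odd (hw : ∀ i, Even (w i)) {n : ℕ} (hn : Odd n)
    {t : DualNumber (MvPolynomial σ ℚ)} (ht : t ∈ koszulGr w q n) : t.fst = 0 := by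
  ext m
  rw [coeff_zero]
  by_contra h
  have := ht.1 m h
  have h2 := even_weight hw m
  rw [← add_zero (Finsupp.weight w m), this] at h2
  exact (Nat.not_odd_iff_even.mpr h2) hn

/-- The algebra `ℚ[X] ⊗ Λ⟨ε⟩` with generators `X i` of even degree `w i` and `ε` of odd degree `q`,
and the differential `dX = 0`, `dε = D`. -/
noncomputable def koszul (w : σ → ℕ) (hw : ∀ i, Even (w i)) (q : ℕ) (hq : Odd q)
    (D : MvPolynomial σ ℚ)
    (hD : D ∈ shiftedHomogeneous w 0 (q + 1)) : CDGA.{u} where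
  -- A commutative ring can serve as a graded commutative algebra here: odd elements are multiples
  -- of `ε`, so their products vanish and no sign is visible.
  carrier := DualNumber (MvPolynomial σ ℚ)
  gr := koszulGr w q
  d :=
    { toFun := fun t => inl (t.snd * D)
      map_add' := fun s t => by rw [snd_add, add_mul, inl_add]
      map_smul' := fun r t => by rw [snd_smul, smul_mul_assoc, inl_smul]; rfl }
  d_mem := by
    rintro n t ⟨-, ht⟩
    refine ⟨?_, ?_⟩
    · change t.snd * D ∈ shiftedHomogeneous w 0 (n + 1)
      intro m hm
      have := mul_mem_shiftedHomogeneous ht hD m hm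
      omega
    · change (0 : MvPolynomial σ ℚ) ∈ _
      exact Submodule.zero_mem _
  d_d t := by
    change inl ((0 : MvPolynomial σ ℚ) * D) = 0
    rw [zero_mul, inl_zero]
  leibniz := by
    intro m s t hs
    change inl ((s * t).snd * D) = inl (s.snd * D) * t + (-1 : ℚ) ^ m • (s * inl (t.snd * D))
    rcases Nat.even_or_odd m with hm | hm
    · rw [hm.neg_one_pow, one_smul, DualNumber.snd_mul, snd_eq_zero_of_even hw hq hm hs]
      ext1 <;> simp [snd_eq_zero_of_even hw hq hm hs, mul_assoc]
    · rw [hm.neg_one_pow, DualNumber.snd_mul]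
      ext1 <;> simp [fst_eq_zero_of_odd hw hm hs]
      all_goals ring
  graded_comm := by
    intro m n s t hs ht
    rcases Nat.even_or_odd m with hm | hm
    · rw [(hm.mul_right n).neg_one_pow, one_smul, mul_comm]
    rcases Nat.even_or_odd n with hn | hn
    · rw [(hn.mul_left m).neg_one_pow, one_smul, mul_comm]
    have h1 : s * t = 0 := by
      ext1 <;> simp [fst_eq_zero_of_odd hw hm hs, fst_eq_zero_of_odd hw hn ht]
    rw [mul_comm t s, h1, smul_zero]

theorem adjoin_dualNumber_eq_top :
    Algebra.adjoin ℚ (insert ε (Set.range fun i => inl (X i)) :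
      Set (DualNumber (MvPolynomial σ ℚ))) = ⊤ := by
  rw [eq_top_iff]
  rintro t -
  have h : ∀ φ : MvPolynomial σ ℚ, (inl φ : DualNumber (MvPolynomial σ ℚ)) ∈
      Algebra.adjoin ℚ (insert ε (Set.range fun i => inl (X i)) :
      Set (DualNumber (MvPolynomial σ ℚ))) := by
    intro φ
    induction φ using MvPolynomial.induction_on with
    | C r => exact Subalgebra.algebraMap_mem _ r
    | add φ ψ hφ hψ => rw [inl_add]; exact Subalgebra.add_mem _ hφ hψ
    | mul_X φ i hφ =>
      rw [inl_mul]
      exact Subalgebra.mul_mem _ hφ (Algebra.subset_adjoin (Set.mem_insert_of_mem _ ⟨i, rfl⟩))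
  rw [← inl_fst_add_inr_snd_eq t, inr_eq_smul_eps, ← inl_mul_eq_smul]
  exact Subalgebra.add_mem _ (h _) (Subalgebra.mul_mem _ (h _)
    (Algebra.subset_adjoin (Set.mem_insert _ _)))

/-- The universal property of `ℚ[X] ⊗ Λ⟨ε⟩`. -/
theorem exists_dualNumber_algHom {T : Type*} [Ring T] [Algebra ℚ T] (x : σ → T) (z : T)
    (hx : ∀ i j, x i * x j = x j * x i) (hz : z * z = 0) (hxz : ∀ i, z * x i = x i * z) :
    ∃ f : DualNumber (MvPolynomial σ ℚ) →ₐ[ℚ] T, (∀ i, f (inl (X i)) = x i) ∧ f ε = z := by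
  obtain ⟨F, hF⟩ := SymmetricAlgebra.exists_algHom_of_commute
    (Finsupp.linearCombination ℚ x) (fun v w => by
      simp only [Finsupp.linearCombination_apply, Finsupp.sum, Finset.sum_mul, Finset.mul_sum]
      rw [Finset.sum_comm]
      refine Finset.sum_congr rfl fun i _ => Finset.sum_congr rfl fun j _ => ?_
      rw [smul_mul_smul_comm, smul_mul_smul_comm, hx, mul_comm])
  let F' : MvPolynomial σ ℚ →ₐ[ℚ] T := F.comp
    (SymmetricAlgebra.equivMvPolynomial (Finsupp.basisSingleOne (R := ℚ) (ι := σ))).symm.toAlgHom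
  have hF' : ∀ i, F' (X i) = x i := by
    intro i
    change F ((SymmetricAlgebra.equivMvPolynomial _).symm (X i)) = x i
    rw [SymmetricAlgebra.equivMvPolynomial_symm_X, hF]
    simp
  have hcomm : ∀ φ, Commute z (F' φ) := by
    intro φ
    induction φ using MvPolynomial.induction_on with
    | C r =>
      have : F' (C r) = algebraMap ℚ T r := F'.commutes r
      rw [this]
      exact Algebra.commute_algebraMap_right r z
    | add φ ψ hφ hψ => rw [map_add]; exact hφ.add_right hψ
    | mul_X φ i hφ => rw [map_mul, hF']; exact hφ.mul_right (hxz i)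
  refine ⟨DualNumber.lift ⟨(F', z), hz, hcomm⟩, fun i => ?_, ?_⟩
  · rw [DualNumber.lift_apply_inl]
    exact hF' i
  · rw [DualNumber.lift_apply_eps]

theorem dualNumber_algHom_ext {T : Type*} [Ring T] [Algebra ℚ T]
    {f g : DualNumber (MvPolynomial σ ℚ) →ₐ[ℚ] T} (hX : ∀ i, f (inl (X i)) = g (inl (X i)))
    (hε : f ε = g ε) : f = g := by
  refine AlgHom.ext_of_adjoin_eq_top (adjoin_dualNumber_eq_top (σ := σ)) ?_
  rintro _ (rfl | ⟨i, rfl⟩)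
  · exact hε
  · exact hX i

/-- `ℚ[X] ⊗ Λ⟨ε⟩` is the tensor product of a symmetric and an exterior algebra. -/
theorem exists_dualNumber_equiv (E O : Submodule ℚ (DualNumber (MvPolynomial σ ℚ)))
    (hE : E = Submodule.span ℚ (Set.range fun i => inl (X i))) (hO : O = Submodule.span ℚ {ε}) :
    ∃ φ : (SymmetricAlgebra ℚ E ⊗[ℚ] ExteriorAlgebra ℚ O) ≃ₐ[ℚ] DualNumber (MvPolynomial σ ℚ),
      (∀ v : E, φ (SymmetricAlgebra.ι ℚ _ v ⊗ₜ 1) = v) ∧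
      ∀ w : O, φ (1 ⊗ₜ ExteriorAlgebra.ι ℚ w) = w := by
  -- `E` and `O` are variables subject to equations because the types depend on them. In the
  -- application they are `evenPart` and `oddPart`, which could not be rewritten inside these types.
  let F : SymmetricAlgebra ℚ E →ₐ[ℚ] DualNumber (MvPolynomial σ ℚ) :=
    SymmetricAlgebra.lift E.subtype
  let G : ExteriorAlgebra ℚ O →ₐ[ℚ] DualNumber (MvPolynomial σ ℚ) :=
    ExteriorAlgebra.lift ℚ ⟨O.subtype, by
      rintro ⟨v, hv⟩
      rw [hO] at hv
      obtain ⟨r, hr⟩ := Submodule.mem_span_singleton.mp hv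
      change v * v = 0
      rw [← hr, smul_mul_smul_comm, eps_mul_eps, smul_zero]⟩
  have hF : ∀ v : E, F (SymmetricAlgebra.ι ℚ _ v) = v := fun v => SymmetricAlgebra.lift_ι_apply _ v
  have hG : ∀ v : O, G (ExteriorAlgebra.ι ℚ v) = v := fun v => ExteriorAlgebra.lift_ι_apply ℚ _ _ v
  let Φ : SymmetricAlgebra ℚ E ⊗[ℚ] ExteriorAlgebra ℚ O →ₐ[ℚ] DualNumber (MvPolynomial σ ℚ) :=
    Algebra.TensorProduct.lift F G fun _ _ => mul_comm _ _
  have hΦ1 : ∀ v : E, Φ (SymmetricAlgebra.ι ℚ _ v ⊗ₜ 1) = v := by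
    intro v
    change F _ * G 1 = _
    rw [hF, map_one, mul_one]
  have hΦ2 : ∀ v : O, Φ (1 ⊗ₜ ExteriorAlgebra.ι ℚ v) = v := by
    intro v
    change F 1 * G _ = _
    rw [hG, map_one, one_mul]
  have hXE : ∀ i, (inl (X i) : DualNumber (MvPolynomial σ ℚ)) ∈ E := fun i => by
    rw [hE]
    exact Submodule.subset_span ⟨i, rfl⟩
  have hεO : (ε : DualNumber (MvPolynomial σ ℚ)) ∈ O := by
    rw [hO]
    exact Submodule.subset_span rfl
  -- The inverse of `Φ` comes from the universal property of the dual numbers; both composites are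
  -- the identity on generators.
  obtain ⟨s, hs1, hs2⟩ := exists_dualNumber_algHom (σ := σ)
    (T := SymmetricAlgebra ℚ E ⊗[ℚ] ExteriorAlgebra ℚ O)
    (fun i => SymmetricAlgebra.ι ℚ E ⟨_, hXE i⟩ ⊗ₜ 1) (1 ⊗ₜ ExteriorAlgebra.ι ℚ ⟨ε, hεO⟩)
    (fun i j => by simp [mul_comm])
    (by simp)
    (fun i => by simp)
  have h1 : Φ.comp s = AlgHom.id ℚ _ := by
    refine dualNumber_algHom_ext (fun i => ?_) ?_
    · rw [AlgHom.comp_apply, hs1, hΦ1, AlgHom.id_apply]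
    · rw [AlgHom.comp_apply, hs2, hΦ2, AlgHom.id_apply]
  have hsE : ∀ v : E, s v = SymmetricAlgebra.ι ℚ E v ⊗ₜ 1 := by
    rintro ⟨v, hv⟩
    have hv' := hv
    rw [hE] at hv'
    induction hv' using Submodule.span_induction with
    | mem x h => obtain ⟨i, rfl⟩ := h; exact hs1 i
    | zero =>
      rw [show (⟨0, hv⟩ : E) = 0 from rfl, map_zero, TensorProduct.zero_tmul]
      exact map_zero s
    | add x y hx hy ihx ihy =>
      rw [← hE] at hx hy
      rw [show (⟨x + y, hv⟩ : E) = ⟨x, hx⟩ + ⟨y, hy⟩ from rfl, map_add, TensorProduct.add_tmul,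
        ← ihx hx, ← ihy hy, ← map_add]
      rfl
    | smul r x hx ihx =>
      rw [← hE] at hx
      rw [show (⟨r • x, hv⟩ : E) = r • ⟨x, hx⟩ from rfl, map_smul, ← TensorProduct.smul_tmul',
        ← ihx hx, ← map_smul]
      rfl
  have hsO : ∀ v : O, s v = 1 ⊗ₜ ExteriorAlgebra.ι ℚ v := by
    rintro ⟨v, hv⟩
    have hv' := hv
    rw [hO] at hv'
    obtain ⟨r, rfl⟩ := Submodule.mem_span_singleton.mp hv'
    rw [show (⟨r • ε, hv⟩ : O) = r • ⟨ε, hεO⟩ from rfl, map_smul, TensorProduct.tmul_smul, ← hs2,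
      ← map_smul]
    rfl
  have h2 : s.comp Φ = AlgHom.id ℚ _ := by
    refine Algebra.TensorProduct.ext ?_ ?_
    · refine SymmetricAlgebra.algHom_ext_of_forall fun v => ?_
      change s (Φ (SymmetricAlgebra.ι ℚ E v ⊗ₜ 1)) = SymmetricAlgebra.ι ℚ E v ⊗ₜ 1
      rw [hΦ1, hsE]
    · refine ExteriorAlgebra.hom_ext (LinearMap.ext fun v => ?_)
      change s (Φ (1 ⊗ₜ ExteriorAlgebra.ι ℚ v)) = 1 ⊗ₜ ExteriorAlgebra.ι ℚ v
      rw [hΦ2, hsO]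
  exact ⟨AlgEquiv.ofAlgHom Φ s h1 h2, hΦ1, hΦ2⟩

end Koszul

end CDGA

/-! ### Morphisms defined on generators, and the factors `Λ⟨x, z⟩` and `Λ⟨y⟩` of the model. -/

namespace CDGA

open MvPolynomial DualNumber TrivSqZeroExt

section Hom

/-- On an algebra with homogeneous generators it suffices to check degrees on the generators. -/
theorem map_mem_gr_of_adjoin {A : CDGA.{u}} {B : CDGA.{v}} {G : Set A}
    (hG : Algebra.adjoin ℚ G = ⊤) (f : A →ₐ[ℚ] B) (h : ∀ g ∈ G, ∃ n, g ∈ A.gr n ∧ f g ∈ B.gr n)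
    {n : ℕ} {a : A} (ha : a ∈ A.gr n) : f a ∈ B.gr n := by
  have hcl : ∀ c ∈ Submonoid.closure G, ∃ m, c ∈ A.gr m ∧ f c ∈ B.gr m := by
    intro c hc
    induction hc using Submonoid.closure_induction with
    | mem x hx => exact h x hx
    | one => exact ⟨0, one_mem_gr, by rw [map_one]; exact one_mem_gr⟩
    | mul x y _ _ hx hy =>
      obtain ⟨i, hx, hx'⟩ := hx
      obtain ⟨j, hy, hy'⟩ := hy
      exact ⟨i + j, mul_mem_gr hx hy, by rw [map_mul]; exact mul_mem_gr hx' hy'⟩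
  have hs : a ∈ Submodule.span ℚ (Submonoid.closure G : Set A) := by
    rw [← Algebra.adjoin_eq_span ℚ, hG]
    exact (Algebra.mem_top : a ∈ (⊤ : Subalgebra ℚ A))
  rw [← proj_of_mem ha]
  clear ha
  induction hs using Submodule.span_induction with
  | mem x hx =>
    obtain ⟨m, hm, hm'⟩ := hcl x hx
    by_cases hmn : m = n
    · subst hmn
      rwa [proj_of_mem hm]
    · rw [proj_of_mem_ne hmn hm, map_zero]
      exact Submodule.zero_mem _
  | zero => simp
  | add x y _ _ hx hy => rw [map_add, map_add]; exact Submodule.add_mem _ hx hy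
  | smul r x _ hx => rw [map_smul, map_smul]; exact Submodule.smul_mem _ _ hx

/-- On an algebra with homogeneous generators it suffices to check on the generators that an algebra
homomorphism is a morphism. -/
theorem exists_hom_of_adjoin {A : CDGA.{u}} {B : CDGA.{v}} {G : Set A}
    (hG : Algebra.adjoin ℚ G = ⊤) (f : A →ₐ[ℚ] B) (h : ∀ g ∈ G, ∃ n, g ∈ A.gr n ∧ f g ∈ B.gr n)
    (hd : ∀ g ∈ G, f (A.d g) = B.d (f g)) : ∃ F : Hom A B, F.toAlgHom = f := by
  have hmem : ∀ (n : ℕ) (a : A), a ∈ A.gr n → f a ∈ B.gr n := fun n a ha =>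
    map_mem_gr_of_adjoin hG f h ha
  have hs : ∀ a, f (A.signInv a) = B.signInv (f a) := fun a => by
    refine LinearMap.congr_fun (linearMap_ext_gr (f := f.toLinearMap ∘ₗ A.signInv)
      (g := B.signInv ∘ₗ f.toLinearMap) fun n a ha => ?_) a
    change f (A.signInv a) = B.signInv (f a)
    rw [signInv_of_mem ha, signInv_of_mem (hmem n a ha), map_smul]
  refine ⟨⟨f, hmem, fun a => ?_⟩, rfl⟩
  have ha : a ∈ Algebra.adjoin ℚ G := hG ▸ Algebra.mem_top
  induction ha using Algebra.adjoin_induction with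
  | mem x hx => exact hd x hx
  | algebraMap r =>
    rw [Algebra.algebraMap_eq_smul_one, map_smul, d_one, map_smul, map_smul, map_one, map_smul,
      d_one, map_zero]
  | add x y _ _ hx hy => simp only [map_add, hx, hy]
  | mul x y _ _ hx hy => rw [d_mul, map_add, map_mul, map_mul, map_mul, d_mul, hx, hy, hs]

end Hom

section Models

variable {p q r : ℕ}

theorem X_pow_mem_shiftedHomogeneous {k : ℕ} (h : k * p = q + 1) :
    (X PUnit.unit ^ k : MvPolynomial PUnit.{u + 1} ℚ) ∈
      shiftedHomogeneous (fun _ => p) 0 (q + 1) := by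
  have h1 := monomial_mem_shiftedHomogeneous (σ := PUnit.{u + 1}) (w := fun _ => p) 0
    (Finsupp.single PUnit.unit k) 1
  rw [X_pow_eq_monomial]
  rwa [Finsupp.weight_single, smul_eq_mul, h, add_zero] at h1

/-- The algebra `Λ⟨x, z⟩` with `deg x = p` even, `deg z = q` odd, `dx = 0` and `dz = D`. -/
noncomputable abbrev evenOdd (hp : Even p) (hq : Odd q) (D : MvPolynomial PUnit.{u + 1} ℚ)
    (hD : D ∈ shiftedHomogeneous (fun _ => p) 0 (q + 1)) : CDGA.{u} :=
  koszul (fun _ => p) (fun _ => hp) q hq D hD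

/-- The algebra `Λ⟨y⟩` with `deg y = r` odd and `dy = 0`. -/
noncomputable abbrev oddSphere (hr : Odd r) : CDGA.{u} :=
  koszul (σ := PEmpty.{u + 1}) (fun _ => 0) (fun _ => Even.zero) r hr 0 (Submodule.zero_mem _)

section Koszul

variable {σ : Type u} {w : σ → ℕ} (hw : ∀ i, Even (w i)) (hq : Odd q) (D : MvPolynomial σ ℚ)
  (hD : D ∈ shiftedHomogeneous w 0 (q + 1))

/-- The generator `X i`. -/
noncomputable def koszulX (i : σ) : koszul w hw q hq D hD :=
  (inl (X i) : DualNumber (MvPolynomial σ ℚ))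

/-- The generator `ε`. -/
noncomputable def koszulEps : koszul w hw q hq D hD := (ε : DualNumber (MvPolynomial σ ℚ))

variable {hw hq D hD}

theorem koszulX_mem (i : σ) : koszulX hw hq D hD i ∈ (koszul w hw q hq D hD).gr (w i) := by
  refine ⟨?_, Submodule.zero_mem _⟩
  have h1 := monomial_mem_shiftedHomogeneous (w := w) 0 (Finsupp.single i 1) 1
  rwa [Finsupp.weight_single, one_smul, add_zero] at h1

theorem koszulEps_mem : koszulEps hw hq D hD ∈ (koszul w hw q hq D hD).gr q := by
  refine ⟨Submodule.zero_mem _, ?_⟩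
  have h1 := monomial_mem_shiftedHomogeneous (w := w) q 0 1
  rw [map_zero, zero_add] at h1
  exact h1

theorem adjoin_koszul_eq_top :
    Algebra.adjoin ℚ (insert (koszulEps hw hq D hD) (Set.range (koszulX hw hq D hD))) = ⊤ :=
  adjoin_dualNumber_eq_top

theorem koszul_d_apply (t : DualNumber (MvPolynomial σ ℚ)) :
    (koszul w hw q hq D hD).d t = (inl (t.snd * D) : DualNumber (MvPolynomial σ ℚ)) := rfl

theorem koszul_d_X (i : σ) : (koszul w hw q hq D hD).d (koszulX hw hq D hD i) = 0 := by
  refine (koszul_d_apply _).trans ?_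
  rw [koszulX, snd_inl, zero_mul, inl_zero]
  rfl

theorem koszul_d_eps {i : σ} {k : ℕ} {hD : X i ^ k ∈ shiftedHomogeneous w 0 (q + 1)} :
    (koszul w hw q hq (X i ^ k) hD).d (koszulEps hw hq _ hD) = koszulX hw hq _ hD i ^ k := by
  have h1 : (inl ((ε : DualNumber (MvPolynomial σ ℚ)).snd * X i ^ k) :
      DualNumber (MvPolynomial σ ℚ)) = inl (X i) ^ k := by
    rw [snd_eps, one_mul, inl_pow]
  exact (koszul_d_apply _).trans h1

theorem koszul_d_zero {hD : 0 ∈ shiftedHomogeneous w 0 (q + 1)} :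
    (koszul w hw q hq 0 hD).d = 0 := by
  refine LinearMap.ext fun t => (koszul_d_apply t).trans ?_
  rw [mul_zero, inl_zero]
  rfl

theorem koszulX_pow_ne_zero (i : σ) (n : ℕ) : koszulX hw hq D hD i ^ n ≠ 0 := by
  have h1 : (inl (X i) : DualNumber (MvPolynomial σ ℚ)) ^ n ≠ 0 := fun h => by
    have h3 := congrArg TrivSqZeroExt.fst h
    rw [inl_pow, fst_inl, fst_zero] at h3
    exact pow_ne_zero n (X_ne_zero i) h3
  exact h1

/-- The differential of `φ + ψ ε` is `ψ * D`, and `D` is not a zero divisor. So cocycles have no `ε`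
term. -/
theorem mem_adjoin_of_koszul_d_eq_zero (hD0 : D ≠ 0) {b : koszul w hw q hq D hD}
    (hb : (koszul w hw q hq D hD).d b = 0) :
    b ∈ Algebra.adjoin ℚ (Set.range (koszulX hw hq D hD)) := by
  have key : ∀ φ : MvPolynomial σ ℚ, (inl φ : DualNumber (MvPolynomial σ ℚ)) ∈
      Algebra.adjoin ℚ (Set.range fun i => (inl (X i) : DualNumber (MvPolynomial σ ℚ))) := by
    intro φ
    induction φ using MvPolynomial.induction_on with
    | C a => exact Subalgebra.algebraMap_mem _ a
    | add φ ψ hφ hψ => rw [inl_add]; exact Subalgebra.add_mem _ hφ hψ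
    | mul_X φ i hφ =>
      rw [inl_mul]
      exact Subalgebra.mul_mem _ hφ (Algebra.subset_adjoin ⟨i, rfl⟩)
  change DualNumber (MvPolynomial σ ℚ) at b
  have h1 := congrArg TrivSqZeroExt.fst ((koszul_d_apply b).symm.trans hb)
  rw [fst_inl] at h1
  have h2 := (mul_eq_zero.mp (h1.trans fst_zero)).resolve_right hD0
  have h3 : b = inl b.fst := by
    ext1
    · rw [fst_inl]
    · rw [h2, snd_inl]
  rw [h3]
  exact key _

/-- The universal property of `ℚ[X] ⊗ Λ⟨ε⟩` as a graded algebra. -/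
theorem exists_koszul_algHom {T : CDGA.{v}} {x : σ → T} {z : T} (hx : ∀ i, x i ∈ T.gr (w i))
    (hz : z ∈ T.gr q) : ∃ f : koszul w hw q hq D hD →ₐ[ℚ] T,
      (∀ i, f (koszulX hw hq D hD i) = x i) ∧ f (koszulEps hw hq D hD) = z ∧
        ∀ n, ∀ a ∈ (koszul w hw q hq D hD).gr n, f a ∈ T.gr n := by
  obtain ⟨f, hf1, hf2⟩ : ∃ f : koszul w hw q hq D hD →ₐ[ℚ] T,
      (∀ i, f (koszulX hw hq D hD i) = x i) ∧ f (koszulEps hw hq D hD) = z :=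
    exists_dualNumber_algHom x z
      (fun i j => (commute_of_signInv_eq (signInv_even (hw i) (hx i)) (x j)).eq)
      (mul_self_of_signInv_eq_neg (signInv_odd hq hz))
      (fun i => (commute_of_signInv_eq (signInv_even (hw i) (hx i)) z).symm.eq)
  refine ⟨f, hf1, hf2, fun n a ha => map_mem_gr_of_adjoin adjoin_koszul_eq_top f ?_ ha⟩
  rintro _ (rfl | ⟨i, rfl⟩)
  · exact ⟨q, koszulEps_mem, by rwa [hf2]⟩
  · exact ⟨w i, koszulX_mem i, by rw [hf1]; exact hx i⟩

end Koszul

theorem evenPart_span {A : CDGA.{u}} {ι : Type} (g : ι → A) (deg : ι → ℕ) :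
    A.evenPart (fun n => Submodule.span ℚ {a | ∃ i, deg i = n ∧ g i = a}) =
      Submodule.span ℚ {a | ∃ i, Even (deg i) ∧ g i = a} := by
  apply le_antisymm
  · refine iSup_le fun n => Submodule.span_mono ?_
    rintro _ ⟨i, hi, rfl⟩
    exact ⟨i, hi ▸ n.2, rfl⟩
  · rw [Submodule.span_le]
    rintro _ ⟨i, hi, rfl⟩
    exact Submodule.mem_iSup_of_mem (⟨deg i, hi⟩ : {n : ℕ // Even n})
      (Submodule.subset_span ⟨i, rfl, rfl⟩)

theorem oddPart_span {A : CDGA.{u}} {ι : Type} (g : ι → A) (deg : ι → ℕ) :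
    A.oddPart (fun n => Submodule.span ℚ {a | ∃ i, deg i = n ∧ g i = a}) =
      Submodule.span ℚ {a | ∃ i, Odd (deg i) ∧ g i = a} := by
  apply le_antisymm
  · refine iSup_le fun n => Submodule.span_mono ?_
    rintro _ ⟨i, hi, rfl⟩
    exact ⟨i, hi ▸ n.2, rfl⟩
  · rw [Submodule.span_le]
    rintro _ ⟨i, hi, rfl⟩
    exact Submodule.mem_iSup_of_mem (⟨deg i, hi⟩ : {n : ℕ // Odd n})
      (Submodule.subset_span ⟨i, rfl, rfl⟩)

/-- Homogeneous generators of positive degree that identify `A` with a symmetric algebra tensor an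
exterior algebra generate `A` freely. -/
theorem isFreelyGeneratedBy_of_equiv {A : CDGA.{u}} {ι : Type} {g : ι → A} {deg : ι → ℕ}
    (hind : LinearIndependent ℚ g) (hpos : ∀ i, 0 < deg i) (hg : ∀ i, g i ∈ A.gr (deg i))
    (h : ∀ E O : Submodule ℚ A, E = Submodule.span ℚ {a | ∃ i, Even (deg i) ∧ g i = a} →
      O = Submodule.span ℚ {a | ∃ i, Odd (deg i) ∧ g i = a} →
      ∃ φ : (SymmetricAlgebra ℚ E ⊗[ℚ] ExteriorAlgebra ℚ O) ≃ₐ[ℚ] A,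
        (∀ v : E, φ (SymmetricAlgebra.ι ℚ _ v ⊗ₜ 1) = v) ∧
        ∀ w : O, φ (1 ⊗ₜ ExteriorAlgebra.ι ℚ w) = w) : A.IsFreelyGeneratedBy g deg where
  linearIndependent := hind
  isFreeOn :=
    { le_gr := fun n => by
        rw [Submodule.span_le]
        rintro _ ⟨i, rfl, rfl⟩
        exact hg i
      zero_eq_bot := by
        rw [Submodule.span_eq_bot]
        rintro _ ⟨i, hi, rfl⟩
        exact absurd hi (hpos i).ne'
      exists_equiv := h _ _ (evenPart_span g deg) (oddPart_span g deg) }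

theorem evenOdd_isFreelyGeneratedBy (hp0 : 0 < p) (hp : Even p) (hq : Odd q)
    (D : MvPolynomial PUnit.{u + 1} ℚ) (hD : D ∈ shiftedHomogeneous (fun _ => p) 0 (q + 1)) :
    (evenOdd hp hq D hD).IsFreelyGeneratedBy
      ![koszulX (fun _ => hp) hq D hD PUnit.unit, koszulEps (fun _ => hp) hq D hD] ![p, q] := by
  have hE : {a : DualNumber (MvPolynomial PUnit.{u + 1} ℚ) |
      ∃ i, Even (![p, q] i) ∧ ![inl (X PUnit.unit), ε] i = a} =
        Set.range fun i => inl (X i) := by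
    ext a
    simp only [Fin.exists_fin_two, Set.mem_ofPred_eq, Set.mem_range]
    simp only [Matrix.cons_val_zero, Matrix.cons_val_one, hp, Nat.not_even_iff_odd.mpr hq, true_and,
      false_and, or_false]
    exact ⟨fun h => ⟨_, h⟩, fun ⟨_, h⟩ => h⟩
  have hO : {a : DualNumber (MvPolynomial PUnit.{u + 1} ℚ) |
      ∃ i, Odd (![p, q] i) ∧ ![inl (X PUnit.unit), ε] i = a} = {ε} := by
    ext a
    simp only [Fin.exists_fin_two, Set.mem_ofPred_eq, Set.mem_singleton_iff]
    simp [hq, Nat.not_odd_iff_even.mpr hp, eq_comm]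
  refine isFreelyGeneratedBy_of_equiv ?_ ?_ ?_ ?_
  · change LinearIndependent ℚ
      ![(inl (X PUnit.unit) : DualNumber (MvPolynomial PUnit.{u + 1} ℚ)), ε]
    rw [LinearIndependent.pair_iff]
    intro s t hst
    have h1 := congrArg TrivSqZeroExt.fst hst
    have h2 := congrArg TrivSqZeroExt.snd hst
    simp at h1 h2
    exact ⟨h1, h2⟩
  · intro i
    fin_cases i
    · exact hp0
    · exact hq.pos
  · intro i
    fin_cases i
    · exact koszulX_mem (w := fun _ => p) PUnit.unit
    · exact koszulEps_mem
  · intro E O hE' hO'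
    exact exists_dualNumber_equiv E O (hE'.trans (congrArg _ hE)) (hO'.trans (congrArg _ hO))

theorem oddSphere_isFreelyGeneratedBy (hr : Odd r) :
    (oddSphere.{u} hr).IsFreelyGeneratedBy
      ![koszulEps (fun _ => Even.zero) hr 0 (Submodule.zero_mem _)] ![r] := by
  have hE : {a : DualNumber (MvPolynomial PEmpty.{u + 1} ℚ) |
      ∃ i, Even (![r] i) ∧ ![ε] i = a} = Set.range fun i => inl (X i) := by
    ext a
    simp [Nat.not_even_iff_odd.mpr hr]
  have hO : {a : DualNumber (MvPolynomial PEmpty.{u + 1} ℚ) |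
      ∃ i, Odd (![r] i) ∧ ![ε] i = a} = {ε} := by
    ext a
    simp [hr, eq_comm]
  refine isFreelyGeneratedBy_of_equiv ?_ ?_ ?_ ?_
  · change LinearIndependent ℚ ![(ε : DualNumber (MvPolynomial PEmpty.{u + 1} ℚ))]
    refine LinearIndependent.of_subsingleton (ι := Fin 1) 0 ?_
    intro h
    have := congrArg TrivSqZeroExt.snd h
    simp at this
  · intro i
    fin_cases i
    exact hr.pos
  · intro i
    fin_cases i
    exact koszulEps_mem
  · intro E O hE' hO'
    exact exists_dualNumber_equiv E O (hE'.trans (congrArg _ hE)) (hO'.trans (congrArg _ hO))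

end Models

end CDGA

/-! ### Tensor products, unipotent endomorphisms, and the model `Λ⟨x, z⟩ ⊗ Λ⟨y⟩`. -/

namespace CDGA

open MvPolynomial DualNumber TrivSqZeroExt

section TensorGenerators

variable {A : CDGA.{u}} {B : CDGA.{v}}

/-- The inclusion `a ↦ a ⊗ 1`. -/
noncomputable def tensorInl (A : CDGA.{u}) (B : CDGA.{v}) : A →ₐ[ℚ] A.tensor B :=
  GradedTensorProduct.includeLeft A.gr B.gr

/-- The inclusion `b ↦ 1 ⊗ b`. -/
noncomputable def tensorInr (A : CDGA.{u}) (B : CDGA.{v}) : B →ₐ[ℚ] A.tensor B :=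
  GradedTensorProduct.includeRight A.gr B.gr

theorem tensorInl_mul_tensorInr (a : A) (b : B) : tensorInl A B a * tensorInr A B b = tm a b := by
  have h := tm_mul_tm a (one_mem_gr (A := B)) (one_mem_gr (A := A)) b
  rw [mul_zero, pow_zero, one_smul, mul_one, one_mul] at h
  exact h

theorem tensorInl_mem {n : ℕ} {a : A} (ha : a ∈ A.gr n) : tensorInl A B a ∈ (A.tensor B).gr n :=
  tm_mem (add_zero n) ha one_mem_gr

theorem tensorInr_mem {n : ℕ} {b : B} (hb : b ∈ B.gr n) : tensorInr A B b ∈ (A.tensor B).gr n :=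
  tm_mem (zero_add n) one_mem_gr hb

theorem tensorInl_d (a : A) : (A.tensor B).d (tensorInl A B a) = tensorInl A B (A.d a) := by
  refine LinearMap.congr_fun (linearMap_ext_gr
    (f := (A.tensor B).d ∘ₗ (tensorInl A B).toLinearMap)
    (g := (tensorInl A B).toLinearMap ∘ₗ A.d) fun n a ha => ?_) a
  have h := tensorD_tm ha (1 : B)
  rw [d_one, tm_zero, smul_zero, add_zero] at h
  exact h

theorem tensorInr_d (b : B) : (A.tensor B).d (tensorInr A B b) = tensorInr A B (B.d b) := by
  have h := tensorD_tm (one_mem_gr (A := A)) b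
  rw [d_one, zero_tm, pow_zero, one_smul, zero_add] at h
  exact h

theorem adjoin_tensor_eq_top {G : Set A} {H : Set B} (hG : Algebra.adjoin ℚ G = ⊤)
    (hH : Algebra.adjoin ℚ H = ⊤) :
    Algebra.adjoin ℚ (tensorInl A B '' G ∪ tensorInr A B '' H) = ⊤ := by
  rw [eq_top_iff]
  rintro t -
  set K : Subalgebra ℚ (A.tensor B) :=
    Algebra.adjoin ℚ (tensorInl A B '' G ∪ tensorInr A B '' H) with hK
  refine tensor_induction (P := fun t : A.tensor B => t ∈ K) ?_ ?_ ?_ t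
  · exact Subalgebra.zero_mem K
  · exact fun s t => Subalgebra.add_mem K
  · intro i j a _ b _
    rw [← tensorInl_mul_tensorInr]
    refine Subalgebra.mul_mem K ?_ ?_
    · have ha : a ∈ Algebra.adjoin ℚ G := hG ▸ Algebra.mem_top
      have h1 := Subalgebra.mem_map.mpr ⟨a, ha, (rfl : tensorInl A B a = _)⟩
      rw [AlgHom.map_adjoin] at h1
      exact Algebra.adjoin_mono Set.subset_union_left h1
    · have hb : b ∈ Algebra.adjoin ℚ H := hH ▸ Algebra.mem_top
      have h1 := Subalgebra.mem_map.mpr ⟨b, hb, (rfl : tensorInr A B b = _)⟩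
      rw [AlgHom.map_adjoin] at h1
      exact Algebra.adjoin_mono Set.subset_union_right h1

/-- The universal property of the tensor product of graded commutative algebras. -/
theorem exists_tensor_algHom {T : CDGA} (f : A →ₐ[ℚ] T) (g : B →ₐ[ℚ] T)
    (hf : ∀ n, ∀ a ∈ A.gr n, f a ∈ T.gr n) (hg : ∀ n, ∀ b ∈ B.gr n, g b ∈ T.gr n) :
    ∃ F : A.tensor B →ₐ[ℚ] T, (∀ a, F (tensorInl A B a) = f a) ∧
      ∀ b, F (tensorInr A B b) = g b := by
  refine ⟨GradedTensorProduct.lift A.gr B.gr f g fun i j a b => ?_, fun a => ?_, fun b => ?_⟩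
  · rw [T.graded_comm i j _ _ (hf i a a.2) (hg j b b.2), mul_comm i j, Units.smul_def,
      ← Int.cast_smul_eq_zsmul ℚ]
    simp
  · refine (GradedTensorProduct.lift_tmul A.gr B.gr f g _ a 1).trans ?_
    rw [map_one, mul_one]
  · refine (GradedTensorProduct.lift_tmul A.gr B.gr f g _ 1 b).trans ?_
    rw [map_one, one_mul]

end TensorGenerators

section Unipotent

variable {A : CDGA.{u}}

theorem map_mem_pos_of_adjoin {B : CDGA.{v}} {G : Submodule ℚ A} (hG : G ≤ A.pos)
    (htop : Algebra.adjoin ℚ (G : Set A) = ⊤) (f : A →ₐ[ℚ] B) (hf : ∀ g ∈ G, f g ∈ B.pos)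
    {a : A} (ha : a ∈ A.pos) : f a ∈ B.pos := by
  refine (?_ : A.pos ≤ A.pos ⊓ B.pos.comap f.toLinearMap) ha |>.2
  refine pos_le_of_adjoin_of_mul_le (G := G) (le_inf hG hf) ?_ inf_le_left htop
  rw [Submodule.mul_le]
  rintro a ⟨ha, ha'⟩ b ⟨hb, hb'⟩
  refine ⟨pos_mul_pos_le (Submodule.mul_mem_mul ha hb), ?_⟩
  change f (a * b) ∈ B.pos
  rw [map_mul]
  exact pos_mul_pos_le (Submodule.mul_mem_mul ha' hb')

/-- An endomorphism that is the identity on indecomposables is injective. -/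
theorem injective_of_sub_mem {G : Submodule ℚ A} (hG : G ≤ A.pos)
    (htop : Algebra.adjoin ℚ (G : Set A) = ⊤) (f : A →ₐ[ℚ] A)
    (hf : ∀ g ∈ G, f g - g ∈ A.pos ^ 2) : Function.Injective f := by
  have hpos : ∀ a ∈ A.pos, f a ∈ A.pos := fun a ha =>
    map_mem_pos_of_adjoin hG htop f (fun g hg => by
      rw [← sub_add_cancel (f g) g]
      exact Submodule.add_mem _ (pos_sq_le (hf g hg)) (hG hg)) ha
  have h1 : ∀ a ∈ A.pos, f a - a ∈ A.pos ^ 2 := by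
    intro a ha
    obtain ⟨g, hg, b, hb, rfl⟩ := Submodule.mem_sup.mp (pos_le_of_adjoin hG htop ha)
    rw [map_add, add_sub_add_comm]
    exact Submodule.add_mem _ (hf g hg) (Submodule.sub_mem _ (map_mul_pos_pow_le f hpos hb) hb)
  -- `f` is the identity on every graded piece of the word length filtration. An element of `A.pos`
  -- in the kernel therefore lies in all powers of `A.pos`, and these intersect in zero.
  have hn : ∀ n, 1 ≤ n → ∀ a ∈ A.pos ^ n, f a - a ∈ A.pos ^ (n + 1) := by
    intro n hn
    induction n, hn using Nat.le_induction with
    | base => simpa using h1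
    | succ n hn ih =>
      intro a ha
      rw [pow_succ] at ha
      induction ha using Submodule.mul_induction_on' with
      | mem_mul_mem a ha b hb =>
        have : f (a * b) - a * b = (f a - a) * f b + a * (f b - b) := by
          rw [map_mul, sub_mul, mul_sub]
          abel
        rw [this]
        refine Submodule.add_mem _ ?_ ?_
        · rw [pow_succ]
          exact Submodule.mul_mem_mul (ih a ha) (hpos b hb)
        · rw [show n + 1 + 1 = n + 2 from rfl, pow_add]
          exact Submodule.mul_mem_mul ha (h1 b hb)
      | add a _ b _ ha hb =>
        rw [map_add, add_sub_add_comm]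
        exact Submodule.add_mem _ ha hb
  rw [injective_iff_map_eq_zero]
  intro a ha
  obtain ⟨_, hr, b, hb, rfl⟩ := Submodule.mem_sup.mp
    (mem_one_sup_of_adjoin hG pos_mul_pos_le htop a)
  obtain ⟨r, rfl⟩ := Submodule.mem_one.mp hr
  rw [map_add, AlgHom.commutes] at ha
  have hr0 : algebraMap ℚ A r = 0 := by
    have h0 := congrArg (A.proj 0) ha
    rw [map_add, mem_pos.mp (hpos b hb), add_zero, map_zero, Algebra.algebraMap_eq_smul_one,
      map_smul, proj_of_mem one_mem_gr] at h0
    rw [Algebra.algebraMap_eq_smul_one, h0]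
  rw [hr0, zero_add] at ha ⊢
  refine eq_zero_of_forall_mem_pos_pow fun n hn' => ?_
  induction n, hn' using Nat.le_induction with
  | base => rwa [pow_one]
  | succ n hn' ih =>
    have := hn n hn' b ih
    rwa [ha, zero_sub, Submodule.neg_mem_iff] at this

end Unipotent

section Model

variable {p q r : ℕ} (hp : Even p) (hq : Odd q) (hr : Odd r) (D : MvPolynomial PUnit.{u + 1} ℚ)
  (hD : D ∈ shiftedHomogeneous (fun _ => p) 0 (q + 1))

/-- The algebra `Λ⟨x, z⟩ ⊗ Λ⟨y⟩` with `dx = 0`, `dz = D` and `dy = 0`. -/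
noncomputable abbrev model : CDGA.{u} := (evenOdd hp hq D hD).tensor (oddSphere hr)

/-- The generator `x`. -/
noncomputable def modelX : model hp hq hr D hD :=
  tensorInl _ _ (koszulX (fun _ => hp) hq D hD PUnit.unit)

/-- The generator `z`. -/
noncomputable def modelZ : model hp hq hr D hD :=
  tensorInl _ _ (koszulEps (fun _ => hp) hq D hD)

/-- The generator `y`. -/
noncomputable def modelY : model hp hq hr D hD :=
  tensorInr _ _ (koszulEps (fun _ => Even.zero) hr 0 (Submodule.zero_mem _))

variable {hp hq hr D hD}

theorem modelX_mem : modelX hp hq hr D hD ∈ (model hp hq hr D hD).gr p :=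
  tensorInl_mem (koszulX_mem (w := fun _ => p) PUnit.unit)

theorem modelZ_mem : modelZ hp hq hr D hD ∈ (model hp hq hr D hD).gr q :=
  tensorInl_mem koszulEps_mem

theorem modelY_mem : modelY hp hq hr D hD ∈ (model hp hq hr D hD).gr r :=
  tensorInr_mem koszulEps_mem

theorem adjoin_model_eq_top : Algebra.adjoin ℚ
    {modelX hp hq hr D hD, modelZ hp hq hr D hD, modelY hp hq hr D hD} = ⊤ := by
  have h := adjoin_tensor_eq_top (A := evenOdd hp hq D hD) (B := oddSphere.{u} hr)
    adjoin_koszul_eq_top adjoin_koszul_eq_top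
  refine top_le_iff.mp (h.ge.trans (Algebra.adjoin_mono ?_))
  rintro _ (⟨_, rfl | ⟨i, rfl⟩, rfl⟩ | ⟨_, rfl | ⟨i, rfl⟩, rfl⟩)
  · exact Or.inr (Or.inl rfl)
  · exact Or.inl rfl
  · exact Or.inr (Or.inr rfl)
  · exact i.elim

/-- The universal property of `Λ⟨x, z⟩ ⊗ Λ⟨y⟩` as a graded algebra. -/
theorem exists_model_algHom (T : CDGA.{v}) {x z y : T} (hx : x ∈ T.gr p) (hz : z ∈ T.gr q)
    (hy : y ∈ T.gr r) : ∃ F : model hp hq hr D hD →ₐ[ℚ] T,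
      F (modelX hp hq hr D hD) = x ∧ F (modelZ hp hq hr D hD) = z ∧
        F (modelY hp hq hr D hD) = y := by
  obtain ⟨f, hf1, hf2, hf⟩ := exists_koszul_algHom (hw := fun _ => hp) (hq := hq) (D := D)
    (hD := hD) (x := fun _ => x) (fun _ => hx) hz
  obtain ⟨g, -, hg2, hg⟩ := exists_koszul_algHom (σ := PEmpty.{u + 1}) (hw := fun _ => Even.zero)
    (hq := hr) (D := 0) (hD := Submodule.zero_mem _) (x := fun i => i.elim) (fun i => i.elim) hy
  obtain ⟨F, hF1, hF2⟩ := exists_tensor_algHom f g hf hg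
  exact ⟨F, (hF1 _).trans (hf1 _), (hF1 _).trans hf2, (hF2 _).trans hg2⟩

theorem model_d_X : (model hp hq hr D hD).d (modelX hp hq hr D hD) = 0 := by
  rw [modelX, tensorInl_d, koszul_d_X, map_zero]

theorem model_d_Y : (model hp hq hr D hD).d (modelY hp hq hr D hD) = 0 := by
  rw [modelY, tensorInr_d, koszul_d_zero, LinearMap.zero_apply, map_zero]

theorem model_d_Z {k : ℕ} {hD : X PUnit.unit ^ k ∈ shiftedHomogeneous (fun _ => p) 0 (q + 1)} :
    (model.{u} hp hq hr (X PUnit.unit ^ k) hD).d (modelZ hp hq hr _ hD) =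
      modelX hp hq hr _ hD ^ k := by
  rw [modelZ, tensorInl_d, koszul_d_eps, map_pow, modelX]

/-- The universal property of `Λ⟨x, z⟩ ⊗ Λ⟨y⟩` with `dz = x ^ k`. -/
theorem exists_model_hom {k : ℕ}
    {hD : X PUnit.unit ^ k ∈ shiftedHomogeneous (fun _ => p) 0 (q + 1)} (T : CDGA.{v}) {x z y : T}
    (hx : x ∈ T.gr p) (hz : z ∈ T.gr q) (hy : y ∈ T.gr r) (hdx : T.d x = 0) (hdz : T.d z = x ^ k)
    (hdy : T.d y = 0) : ∃ F : Hom (model.{u} hp hq hr (X PUnit.unit ^ k) hD) T,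
      F.toAlgHom (modelX hp hq hr _ hD) = x ∧ F.toAlgHom (modelZ hp hq hr _ hD) = z ∧
        F.toAlgHom (modelY hp hq hr _ hD) = y := by
  obtain ⟨f, h1, h2, h3⟩ := exists_model_algHom (hp := hp) (hq := hq) (hr := hr)
    (D := X PUnit.unit ^ k) (hD := hD) T hx hz hy
  obtain ⟨F, rfl⟩ := exists_hom_of_adjoin adjoin_model_eq_top f
    (by
      rintro _ (rfl | rfl | rfl)
      · exact ⟨p, modelX_mem, by rwa [h1]⟩
      · exact ⟨q, modelZ_mem, by rwa [h2]⟩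
      · exact ⟨r, modelY_mem, by rwa [h3]⟩)
    (by
      rintro _ (rfl | rfl | rfl)
      · rw [model_d_X, map_zero, h1, hdx]
      · rw [model_d_Z, map_pow, h1, h2, hdz]
      · rw [model_d_Y, map_zero, h3, hdy])
  exact ⟨F, h1, h2, h3⟩

/-- The algebra map to `Λ⟨x, z⟩` with `x ↦ x` and `y, z ↦ 0` reduces this to the polynomial ring. -/
theorem modelX_pow_ne_zero (n : ℕ) : modelX hp hq hr D hD ^ n ≠ 0 := by
  intro h
  obtain ⟨F, hF, -, -⟩ := exists_model_algHom (hp := hp) (hq := hq) (hr := hr) (D := D) (hD := hD)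
    (evenOdd hp hq D hD) (koszulX_mem (w := fun _ => p) PUnit.unit)
    (Submodule.zero_mem _) (Submodule.zero_mem _)
  have h1 := congrArg F h
  rw [map_pow, hF, map_zero] at h1
  exact koszulX_pow_ne_zero _ n h1

/-- The cocycles of `Λ⟨x, z⟩ ⊗ Λ⟨y⟩` with `dz ≠ 0` lie in `Λ⟨x, y⟩`. -/
theorem mem_adjoin_of_model_d_eq_zero (hD0 : D ≠ 0) {m : model hp hq hr D hD}
    (hm : (model hp hq hr D hD).d m = 0) :
    m ∈ Algebra.adjoin ℚ {modelX hp hq hr D hD, modelY hp hq hr D hD} := by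
  set K : Subalgebra ℚ (model hp hq hr D hD) :=
    Algebra.adjoin ℚ {modelX hp hq hr D hD, modelY hp hq hr D hD} with hK
  have hX : ∀ b : evenOdd hp hq D hD, (evenOdd hp hq D hD).d b = 0 →
      tensorInl _ (oddSphere hr) b ∈ K := by
    intro b hb
    have h1 := Subalgebra.mem_map.mpr ⟨b, mem_adjoin_of_koszul_d_eq_zero hD0 hb,
      (rfl : tensorInl _ (oddSphere hr) b = _)⟩
    rw [AlgHom.map_adjoin] at h1
    refine Algebra.adjoin_mono ?_ h1
    rintro _ ⟨_, ⟨i, rfl⟩, rfl⟩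
    exact Or.inl rfl
  have hY : ∀ c : oddSphere.{u} hr, tensorInr (evenOdd hp hq D hD) _ c ∈ K := by
    intro c
    have hc : c ∈ (⊤ : Subalgebra ℚ (oddSphere.{u} hr)) := Algebra.mem_top
    rw [← adjoin_koszul_eq_top] at hc
    have h1 := Subalgebra.mem_map.mpr
      ⟨c, hc, (rfl : tensorInr (evenOdd hp hq D hD) (oddSphere hr) c = _)⟩
    rw [AlgHom.map_adjoin] at h1
    refine Algebra.adjoin_mono ?_ h1
    rintro _ ⟨_, rfl | ⟨i, rfl⟩, rfl⟩
    · exact Or.inr rfl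
    · exact i.elim
  -- As `dy = 0`, the differential of the tensor product is `d ⊗ 1`, and by flatness over `ℚ` its
  -- kernel is `ker d ⊗ Λ⟨y⟩`.
  have hexact := Module.Flat.rTensor_exact (oddSphere.{u} hr)
    (LinearMap.exact_subtype_ker_map (evenOdd hp hq D hD).d)
  have hdm : LinearMap.rTensor (oddSphere.{u} hr) (evenOdd hp hq D hD).d m = 0 := by
    have h1 : tensorD (evenOdd hp hq D hD) (oddSphere.{u} hr) m = 0 := hm
    rw [tensorD, koszul_d_zero, TensorProduct.map_zero_right, add_zero] at h1
    exact h1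
  obtain ⟨t, rfl⟩ := (hexact m).mp hdm
  clear hm hdm
  induction t using TensorProduct.induction_on with
  | zero => exact Subalgebra.zero_mem K
  | add s t hs ht =>
    rw [map_add]
    exact Subalgebra.add_mem K hs ht
  | tmul b c =>
    have h1 := Subalgebra.mul_mem K (hX b b.2) (hY c)
    rw [tensorInl_mul_tensorInr] at h1
    exact h1

end Model

end CDGA

/-! ### Criteria for injectivity and for quasi-isomorphisms. -/

namespace CDGA

section Injective

variable {S : CDGA.{u}} {V : ℕ → Submodule ℚ S} {M : CDGA.{v}} {p q r : ℕ}

/-- Elements that are linearly independent modulo a subspace have dual functionals that vanish on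
the subspace. -/
theorem exists_dual_of_independent {M : Type*} [AddCommGroup M] [Module ℚ M] {N : Submodule ℚ M}
    {x y z : M} (hind : ∀ a b c : ℚ, a • x + b • y + c • z ∈ N → a = 0 ∧ b = 0 ∧ c = 0) :
    ∃ ξ η ζ : M →ₗ[ℚ] ℚ, (∀ a ∈ N, ξ a = 0 ∧ η a = 0 ∧ ζ a = 0) ∧
      (ξ x = 1 ∧ ξ y = 0 ∧ ξ z = 0) ∧ (η x = 0 ∧ η y = 1 ∧ η z = 0) ∧
      (ζ x = 0 ∧ ζ y = 0 ∧ ζ z = 1) := by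
  let e : ℚ × ℚ × ℚ →ₗ[ℚ] M ⧸ N := N.mkQ ∘ₗ
    (LinearMap.coprod (LinearMap.toSpanSingleton ℚ M x)
      (LinearMap.coprod (LinearMap.toSpanSingleton ℚ M y) (LinearMap.toSpanSingleton ℚ M z)))
  have he : ∀ a b c, e (a, b, c) = N.mkQ (a • x + b • y + c • z) := fun a b c => by
    simp [e, add_assoc]
  have hinj : LinearMap.ker e = ⊥ := by
    rw [LinearMap.ker_eq_bot']
    rintro ⟨a, b, c⟩ h
    rw [he, Submodule.mkQ_apply, Submodule.Quotient.mk_eq_zero] at h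
    obtain ⟨rfl, rfl, rfl⟩ := hind a b c h
    rfl
  obtain ⟨g, hg⟩ := LinearMap.exists_leftInverse_of_injective e hinj
  have hg' : ∀ a b c, g (N.mkQ (a • x + b • y + c • z)) = (a, b, c) := fun a b c => by
    rw [← he]
    exact LinearMap.congr_fun hg (a, b, c)
  have hx := hg' 1 0 0
  have hy := hg' 0 1 0
  have hz := hg' 0 0 1
  simp only [one_smul, zero_smul, add_zero, zero_add] at hx hy hz
  refine ⟨LinearMap.fst ℚ ℚ (ℚ × ℚ) ∘ₗ g ∘ₗ N.mkQ,
    LinearMap.fst ℚ ℚ ℚ ∘ₗ LinearMap.snd ℚ ℚ (ℚ × ℚ) ∘ₗ g ∘ₗ N.mkQ,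
    LinearMap.snd ℚ ℚ ℚ ∘ₗ LinearMap.snd ℚ ℚ (ℚ × ℚ) ∘ₗ g ∘ₗ N.mkQ, fun a ha => ?_, ?_, ?_, ?_⟩
  · have h0 : N.mkQ a = 0 := by rwa [Submodule.mkQ_apply, Submodule.Quotient.mk_eq_zero]
    simp only [LinearMap.comp_apply, h0, map_zero, and_self]
  all_goals simp only [LinearMap.comp_apply, hx, hy, hz, LinearMap.fst_apply, LinearMap.snd_apply,
    and_self]

/-- A homomorphism from an algebra generated by elements `mX` of even and `mY`, `mZ` of odd degree
to a free algebra is injective if it maps the generators to elements that are linearly independent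
modulo decomposables. -/
theorem IsFreeOn.injective_of_independent (h : S.IsFreeOn V) (hp : Even p) (hq : Odd q) (hr : Odd r)
    (hp0 : 0 < p) {mX mY mZ : M} (hX : mX ∈ M.gr p) (hY : mY ∈ M.gr r) (hZ : mZ ∈ M.gr q)
    (htop : Algebra.adjoin ℚ {mX, mZ, mY} = ⊤) (ψ : M →ₐ[ℚ] S) (hx : ψ mX ∈ S.gr p)
    (hy : ψ mY ∈ S.gr r) (hz : ψ mZ ∈ S.gr q)
    (hind : ∀ a b c : ℚ, a • ψ mX + b • ψ mY + c • ψ mZ ∈ S.pos ^ 2 → a = 0 ∧ b = 0 ∧ c = 0) :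
    Function.Injective ψ := by
  obtain ⟨ξ, η, ζ, hN, ⟨hξx, hξy, hξz⟩, ⟨hηx, hηy, hηz⟩, ⟨hζx, hζy, hζz⟩⟩ :=
    exists_dual_of_independent hind
  -- The generator part of a left inverse of `ψ` up to decomposables: `ξ` is applied to the even
  -- part of `v`, `η` and `ζ` to its odd part. Splitting by parity makes the values commute,
  -- respectively square to zero, as the universal property of `S` demands; degrees need not be
  -- preserved.
  let lam : S →ₗ[ℚ] M :=
    LinearMap.toSpanSingleton ℚ M mX ∘ₗ ((1 / 2 : ℚ) • ξ ∘ₗ (LinearMap.id + S.signInv)) +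
    LinearMap.toSpanSingleton ℚ M mY ∘ₗ ((1 / 2 : ℚ) • η ∘ₗ (LinearMap.id - S.signInv)) +
    LinearMap.toSpanSingleton ℚ M mZ ∘ₗ ((1 / 2 : ℚ) • ζ ∘ₗ (LinearMap.id - S.signInv))
  have hlam : ∀ v, lam v = ((1 / 2 : ℚ) * ξ (v + S.signInv v)) • mX +
      ((1 / 2 : ℚ) * η (v - S.signInv v)) • mY + ((1 / 2 : ℚ) * ζ (v - S.signInv v)) • mZ :=
    fun v => rfl
  have heven : ∀ v, S.signInv v = v → lam v = ξ v • mX := fun v hv => by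
    rw [hlam, hv, sub_self, map_zero, map_zero, mul_zero, zero_smul, zero_smul, add_zero, add_zero,
      map_add]
    congr 1
    ring
  have hodd : ∀ v, S.signInv v = -v → lam v = η v • mY + ζ v • mZ := fun v hv => by
    rw [hlam, hv, add_neg_cancel, map_zero, mul_zero, zero_smul, zero_add, sub_neg_eq_add, map_add,
      map_add]
    congr 2 <;> ring
  have hsX : M.signInv mX = mX := signInv_even hp hX
  have hsY : M.signInv mY = -mY := signInv_odd hr hY
  have hsZ : M.signInv mZ = -mZ := signInv_odd hq hZ
  have hcomm : ∀ v, S.signInv v = v → ∀ m : M, lam v * m = m * lam v := fun v hv m => by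
    rw [heven v hv]
    exact ((commute_of_signInv_eq hsX m).smul_left _).eq
  obtain ⟨ρ, hρ⟩ := h.exists_algHom lam
    (fun a ha b _ => hcomm a (h.signInv_evenPart ha) _)
    (fun a ha b _ => hcomm a (h.signInv_evenPart ha) _)
    (fun a ha => mul_self_of_signInv_eq_neg (by
      rw [hodd a (h.signInv_oddPart ha), map_add, map_smul, map_smul, hsY, hsZ, smul_neg, smul_neg,
        neg_add]))
  have hGpos : ∀ m ∈ Submodule.span ℚ {mX, mZ, mY}, m ∈ M.pos := by
    intro m hm
    refine Submodule.span_le.mpr ?_ hm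
    rintro _ (rfl | rfl | rfl)
    · exact mem_pos_of_mem_gr hp0 hX
    · exact mem_pos_of_mem_gr hq.pos hZ
    · exact mem_pos_of_mem_gr hr.pos hY
  have hlampos : ∀ v, lam v ∈ M.pos := fun v => by
    rw [hlam]
    exact Submodule.add_mem _ (Submodule.add_mem _
      (Submodule.smul_mem _ _ (mem_pos_of_mem_gr hp0 hX))
      (Submodule.smul_mem _ _ (mem_pos_of_mem_gr hr.pos hY)))
      (Submodule.smul_mem _ _ (mem_pos_of_mem_gr hq.pos hZ))
  have hρV : ∀ v ∈ ⨆ n, V n, ρ v = lam v := by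
    have : ⨆ n, V n ≤ LinearMap.ker (ρ.toLinearMap - lam) := iSup_le fun n v hv => by
      rw [LinearMap.mem_ker, LinearMap.sub_apply, sub_eq_zero]
      exact hρ n v hv
    intro v hv
    have h1 := this hv
    rwa [LinearMap.mem_ker, LinearMap.sub_apply, sub_eq_zero] at h1
  have hρpos : ∀ a ∈ S.pos, ρ a ∈ M.pos := fun a ha =>
    map_mem_pos_of_adjoin h.le_pos h.adjoin_eq_top ρ
      (fun g hg => by rw [hρV g hg]; exact hlampos g) ha
  have hρlam : ∀ a ∈ S.pos, ρ a - lam a ∈ M.pos ^ 2 := by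
    intro a ha
    obtain ⟨v, hv, f, hf, rfl⟩ :=
      Submodule.mem_sup.mp (pos_le_of_adjoin h.le_pos h.adjoin_eq_top ha)
    have hf' : lam f = 0 := by
      obtain ⟨h1, -, -⟩ := hN _ (Submodule.add_mem _ hf (signInv_mem_pos_pow hf))
      obtain ⟨-, h2, h3⟩ := hN _ (Submodule.sub_mem _ hf (signInv_mem_pos_pow hf))
      rw [hlam, h1, h2, h3, mul_zero, zero_smul, zero_smul, zero_smul, add_zero, add_zero]
    rw [map_add, map_add, hf', hρV v hv, add_zero, add_sub_cancel_left]
    exact map_mul_pos_pow_le ρ hρpos hf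
  have hfix : ∀ m ∈ Submodule.span ℚ {mX, mZ, mY}, ρ (ψ m) - m ∈ M.pos ^ 2 := by
    have : Submodule.span ℚ {mX, mZ, mY} ≤
        (M.pos ^ 2).comap ((ρ.comp ψ).toLinearMap - LinearMap.id) := by
      rw [Submodule.span_le]
      rintro _ (rfl | rfl | rfl)
      · have h1 := hρlam _ (mem_pos_of_mem_gr hp0 hx)
        rwa [heven _ (signInv_even hp hx), hξx, one_smul] at h1
      · have h1 := hρlam _ (mem_pos_of_mem_gr hq.pos hz)
        rwa [hodd _ (signInv_odd hq hz), hηz, hζz, zero_smul, zero_add, one_smul] at h1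
      · have h1 := hρlam _ (mem_pos_of_mem_gr hr.pos hy)
        rwa [hodd _ (signInv_odd hr hy), hηy, hζy, zero_smul, add_zero, one_smul] at h1
    exact fun m hm => this hm
  -- `ρ ∘ ψ` is the identity on the indecomposables of `M` and hence unipotent.
  have hinj : Function.Injective (ρ.comp ψ) :=
    injective_of_sub_mem hGpos (by rw [Algebra.adjoin_span]; exact htop)
      (ρ.comp ψ) hfix
  exact Function.Injective.of_comp hinj

end Injective

section QuasiIso

variable {A : CDGA.{u}} {B : CDGA.{v}}

theorem Hom.isQuasiIso_iff (f : Hom A B) : f.IsQuasiIso ↔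
    (∀ a, A.d a = 0 → (∃ b, B.d b = f.toAlgHom a) → ∃ c, A.d c = a) ∧
      ∀ b, B.d b = 0 → ∃ a, A.d a = 0 ∧ ∃ c, B.d c = b - f.toAlgHom a := by
  refine and_congr ?_ ?_
  · rw [injective_iff_map_eq_zero]
    constructor
    · intro h a ha hb
      exact cohomologyClass_eq_zero.mp (h (A.cohomologyClass ⟨a, ha⟩)
        (cohomologyClass_eq_zero.mpr hb))
    · intro h x hx
      obtain ⟨z, rfl⟩ := cohomologyClass_surjective x
      exact cohomologyClass_eq_zero.mpr (h z z.2 (cohomologyClass_eq_zero.mp hx))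
  · constructor
    · intro h b hb
      obtain ⟨x, hx⟩ := h (B.cohomologyClass ⟨b, hb⟩)
      obtain ⟨z, rfl⟩ := cohomologyClass_surjective x
      refine ⟨z, z.2, ?_⟩
      have h1 : B.cohomologyClass (⟨b, hb⟩ - f.cocyclesMap z) = 0 := by
        rw [map_sub, sub_eq_zero]
        exact hx.symm
      exact cohomologyClass_eq_zero.mp h1
    · intro h x
      obtain ⟨z, rfl⟩ := cohomologyClass_surjective x
      obtain ⟨a, ha, hc⟩ := h z z.2
      refine ⟨A.cohomologyClass ⟨a, ha⟩, ?_⟩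
      have h1 : B.cohomologyClass (z - f.cocyclesMap ⟨a, ha⟩) = 0 := cohomologyClass_eq_zero.mpr hc
      rw [map_sub, sub_eq_zero] at h1
      exact h1.symm

/-- The inclusion of the minimal part is a quasi-isomorphism. -/
theorem IsContraction.isQuasiIso {θ : B →ₗ[ℚ] B} (hθ : B.IsContraction θ) (f : Hom A B)
    (hf : Function.Injective f.toAlgHom) (hrange : f.toAlgHom.range = hθ.minimalPart) :
    f.IsQuasiIso := by
  rw [f.isQuasiIso_iff]
  constructor
  · rintro a ha ⟨b, hb⟩
    obtain ⟨b₀, hb₀, h⟩ := hθ.exists_d_eq_of_mem_minimalPart (b := b)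
      (by rw [hb, ← hrange]; exact ⟨a, rfl⟩)
    rw [← hrange] at hb₀
    obtain ⟨c, rfl⟩ := hb₀
    refine ⟨c, hf ?_⟩
    rw [f.map_d, ← hb, ← h]
    rfl
  · intro b hb
    obtain ⟨b₀, hb₀, hd, c, hc⟩ := hθ.exists_cocycle hb
    rw [← hrange] at hb₀
    obtain ⟨a, rfl⟩ := hb₀
    refine ⟨a, hf ?_, c, hc⟩
    rw [f.map_d, map_zero]
    exact hd

theorem Hom.map_proj (f : Hom A B) (n : ℕ) (a : A) :
    f.toAlgHom (A.proj n a) = B.proj n (f.toAlgHom a) := by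
  refine LinearMap.congr_fun (linearMap_ext_gr (f := f.toAlgHom.toLinearMap ∘ₗ A.proj n)
    (g := B.proj n ∘ₗ f.toAlgHom.toLinearMap) fun m a ha => ?_) a
  change f.toAlgHom (A.proj n a) = B.proj n (f.toAlgHom a)
  by_cases h : m = n
  · subst h
    rw [proj_of_mem ha, proj_of_mem (f.map_mem _ _ ha)]
  · rw [proj_of_mem_ne h ha, proj_of_mem_ne h (f.map_mem _ _ ha), map_zero]

/-- The inverse of a bijective morphism is a morphism. -/
theorem Hom.isIsomorphic_symm (f : Hom A B) (hf : Function.Bijective f.toAlgHom) :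
    IsIsomorphic B A := by
  let e := AlgEquiv.ofBijective f.toAlgHom hf
  have he : ∀ b, f.toAlgHom (e.symm b) = b := e.apply_symm_apply
  refine ⟨⟨e.symm.toAlgHom, fun n b hb => ?_, fun b => ?_⟩, e.symm.bijective⟩
  · change e.symm b ∈ A.gr n
    have h1 : A.proj n (e.symm b) = e.symm b := hf.1 (by rw [f.map_proj, he, proj_of_mem hb])
    rw [← h1]
    exact proj_mem n _
  · change e.symm (B.d b) = A.d (e.symm b)
    exact hf.1 (by rw [he, f.map_d, he])

theorem IsContraction.minimalPart_eq_top {θ : B →ₗ[ℚ] B} (hθ : B.IsContraction θ) (h : θ = 0) :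
    hθ.minimalPart = ⊤ := by
  rw [eq_top_iff]
  rintro a -
  refine ⟨1, ?_⟩
  rw [pow_one, Polynomial.aeval_X, laplacian_apply, h, LinearMap.zero_apply, LinearMap.zero_apply,
    map_zero, add_zero]

end QuasiIso

end CDGA

/-! ### Homogeneous representatives of a basis of the homotopy. -/

/-- A finite-dimensional direct sum has a basis of homogeneous elements. -/
theorem DirectSum.exists_homogeneous_basis {ι : Type*} [DecidableEq ι] {H : ι → Type*}
    [∀ i, AddCommGroup (H i)] [∀ i, Module ℚ (H i)] {k : ℕ}
    (hk : Module.finrank ℚ (⨁ i, H i) = k) (hk0 : k ≠ 0) :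
    ∃ (deg : Fin k → ι) (h : ∀ i, H (deg i)) (b : Module.Basis (Fin k) ℚ (⨁ i, H i)),
      ∀ i, b i = DirectSum.lof ℚ ι H (deg i) (h i) := by
  let b : Module.Basis (Σ i, Module.Basis.ofVectorSpaceIndex ℚ (H i)) ℚ (⨁ i, H i) :=
    DFinsupp.basis fun i => Module.Basis.ofVectorSpace ℚ (H i)
  have : Module.Finite ℚ (⨁ i, H i) := Module.finite_of_finrank_pos (by omega)
  have hfin : Finite (Σ i, Module.Basis.ofVectorSpaceIndex ℚ (H i)) :=
    Module.Finite.finite_basis b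
  have hcard : Nat.card (Σ i, Module.Basis.ofVectorSpaceIndex ℚ (H i)) = k := by
    rw [← hk, Module.finrank_eq_nat_card_basis b]
  let e := Finite.equivFinOfCardEq hcard
  refine ⟨fun i => (e.symm i).1, fun i => Module.Basis.ofVectorSpace ℚ _ (e.symm i).2,
    b.reindex e, fun i => ?_⟩
  rw [Module.Basis.reindex_apply]
  change b (e.symm i) = DirectSum.lof ℚ ι H (e.symm i).1
    (Module.Basis.ofVectorSpace ℚ (H (e.symm i).1) (e.symm i).2)
  generalize e.symm i = j
  obtain ⟨j, t⟩ := j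
  refine b.repr.injective ?_
  rw [Module.Basis.repr_self]
  ext ⟨l, s⟩
  change _ = (Module.Basis.ofVectorSpace ℚ (H l)).repr
    (DirectSum.lof ℚ ι H j (Module.Basis.ofVectorSpace ℚ (H j) t) l) s
  by_cases hjl : j = l
  · subst hjl
    rw [DirectSum.lof_apply, Module.Basis.repr_self]
    by_cases hts : t = s
    · subst hts
      rw [Finsupp.single_eq_same, Finsupp.single_eq_same]
    · rw [Finsupp.single_eq_of_ne (by simpa using Ne.symm hts),
        Finsupp.single_eq_of_ne (Ne.symm hts)]
  · rw [DirectSum.lof_eq_of, DirectSum.of_eq_of_ne _ _ _ (Ne.symm hjl), map_zero,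
      Finsupp.single_eq_of_ne (by rintro ⟨⟩; exact hjl rfl)]
    rfl

/-- Coefficients that vanish outside degree `n` turn the basis of the direct sum into spanning and
independence statements in each single degree, which is the form suited to homotopy groups defined
degree by degree. -/
theorem DirectSum.exists_homogeneous_representatives {ι : Type*} {H : ι → Type*}
    [∀ i, AddCommGroup (H i)] [∀ i, Module ℚ (H i)] {M : Type*} [AddCommGroup M] [Module ℚ M]
    (e : ∀ i, M →ₗ[ℚ] H i) {C : ι → Submodule ℚ M} (hC : ∀ i, ∀ h : H i, ∃ v ∈ C i, e i v = h)
    {k : ℕ} (hk : Module.finrank ℚ (⨁ i, H i) = k) (hk0 : k ≠ 0) :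
    ∃ (g : Fin k → M) (deg : Fin k → ι), (∀ i, g i ∈ C (deg i)) ∧
      (∀ n v, ∃ c : Fin k → ℚ, (∀ i, deg i ≠ n → c i = 0) ∧ e n v = e n (∑ i, c i • g i)) ∧
      ∀ n, ∀ c : Fin k → ℚ, (∀ i, deg i ≠ n → c i = 0) → e n (∑ i, c i • g i) = 0 → c = 0 := by
  classical
  obtain ⟨deg, h, b, hb⟩ := DirectSum.exists_homogeneous_basis hk hk0
  choose g hg hgh using fun i => hC (deg i) (h i)
  have hsum : ∀ n, ∀ c : Fin k → ℚ, (∀ i, deg i ≠ n → c i = 0) →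
      DirectSum.lof ℚ ι H n (e n (∑ i, c i • g i)) = ∑ i, c i • b i := by
    intro n c hc
    rw [map_sum, map_sum]
    refine Finset.sum_congr rfl fun i _ => ?_
    rw [map_smul, map_smul]
    by_cases hi : deg i = n
    · subst hi
      rw [hb, hgh]
    · rw [hc i hi, zero_smul, zero_smul]
  refine ⟨g, deg, hg, fun n v => ?_, fun n c hc h0 => ?_⟩
  · refine ⟨fun i => if deg i = n then b.repr (DirectSum.lof ℚ ι H n (e n v)) i else 0,
      fun i hi => if_neg hi, ?_⟩
    refine DirectSum.of_injective n ?_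
    change DirectSum.lof ℚ ι H n _ = DirectSum.lof ℚ ι H n _
    rw [hsum n _ fun i hi => if_neg hi]
    have h1 := congrArg (fun t => DirectSum.lof ℚ ι H n (DirectSum.component ℚ ι H n t))
      (b.sum_repr (DirectSum.lof ℚ ι H n (e n v)))
    simp only [map_sum, map_smul, DirectSum.component.lof_self] at h1
    refine h1.symm.trans (Finset.sum_congr rfl fun i _ => ?_)
    rw [hb]
    by_cases hi : deg i = n
    · rw [if_pos hi]
      subst hi
      rw [DirectSum.component.lof_self]
    · rw [if_neg hi, zero_smul, DirectSum.component.of, dif_neg hi, map_zero, smul_zero]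
  · have h1 := hsum n c hc
    rw [h0, map_zero] at h1
    exact funext fun i => Fintype.linearIndependent_iff.mp b.linearIndependent c h1.symm i

namespace SullivanAlgebra

variable (S : SullivanAlgebra.{u})

/-- Homogeneous representatives of a basis of the homotopy in degrees satisfying `P`. -/
structure IsHomotopyBasis {ι : Type} [Fintype ι] (P : ℕ → Prop) (g : ι → S.toCDGA) (deg : ι → ℕ) :
    Prop where
  prop : ∀ i, P (deg i)
  mem : ∀ i, g i ∈ S.linearCocycles (deg i)
  span : ∀ n, P n → ∀ v ∈ S.linearCocycles n, ∃ c : ι → ℚ, (∀ i, deg i ≠ n → c i = 0) ∧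
    v - ∑ i, c i • g i ∈ S.linearCoboundaries n
  independent : ∀ n, ∀ c : ι → ℚ, (∀ i, deg i ≠ n → c i = 0) →
    ∑ i, c i • g i ∈ S.linearCoboundaries n → c = 0

variable {S}

theorem exists_isHomotopyBasis {P : ℕ → Prop} {k : ℕ}
    (hk : Module.finrank ℚ (⨁ n : {n : ℕ // P n}, S.homotopy n) = k) (hk0 : k ≠ 0) :
    ∃ (g : Fin k → S.toCDGA) (deg : Fin k → ℕ), S.IsHomotopyBasis P g deg := by
  -- The quotient maps are extended from the cocycles of degree `n` to the whole algebra, so that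
  -- they share a domain.
  have hE : ∀ n : {n : ℕ // P n}, ∃ E : S.toCDGA →ₗ[ℚ] S.homotopy n,
      ∀ v : S.linearCocycles n, E v = Submodule.Quotient.mk v := fun n => by
    obtain ⟨E, hE⟩ := LinearMap.exists_extend
      (Submodule.mkQ ((S.linearCoboundaries n).comap (S.linearCocycles n).subtype))
    exact ⟨E, fun v => LinearMap.congr_fun hE v⟩
  choose E hE using hE
  have hE0 : ∀ n : {n : ℕ // P n}, ∀ v ∈ S.linearCocycles n,
      E n v = 0 ↔ v ∈ S.linearCoboundaries n := by
    intro n v hv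
    rw [hE n ⟨v, hv⟩, Submodule.Quotient.mk_eq_zero]
    rfl
  obtain ⟨g, deg, h1, h2, h3⟩ := DirectSum.exists_homogeneous_representatives
    (H := fun n : {n : ℕ // P n} => S.homotopy n) E (C := fun n => S.linearCocycles n)
    (fun n h => by
      obtain ⟨v, rfl⟩ := Submodule.Quotient.mk_surjective _ h
      exact ⟨v, v.2, hE n v⟩) hk hk0
  have hsum : ∀ n, ∀ c : Fin k → ℚ, (∀ i, (deg i : ℕ) ≠ n → c i = 0) →
      ∑ i, c i • g i ∈ S.linearCocycles n := by
    intro n c hc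
    refine Submodule.sum_mem _ fun i _ => ?_
    by_cases hi : (deg i : ℕ) = n
    · subst hi
      exact Submodule.smul_mem _ _ (h1 i)
    · rw [hc i hi, zero_smul]
      exact Submodule.zero_mem _
  refine ⟨g, fun i => deg i, fun i => (deg i).2, h1, ?_, ?_⟩
  · intro n hn v hv
    obtain ⟨c, hc, h⟩ := h2 ⟨n, hn⟩ v
    have hc' : ∀ i, (deg i : ℕ) ≠ n → c i = 0 := fun i hi => hc i fun h => hi (congrArg _ h)
    refine ⟨c, hc', ?_⟩
    rw [← hE0 ⟨n, hn⟩ _ (Submodule.sub_mem _ hv (hsum n c hc')), map_sub, h, sub_self]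
  · intro n c hc hmem
    by_contra h0
    obtain ⟨i, hi⟩ := Function.ne_iff.mp h0
    obtain rfl : (deg i : ℕ) = n := by
      by_contra h
      exact hi (hc i h)
    exact h0 (h3 (deg i) c (fun j hj => hc j fun h => hj (Subtype.ext h))
      ((hE0 _ _ (hsum _ c hc)).mpr hmem))

/-- A basis of the even homotopy and a basis of the odd homotopy form a basis of the homotopy. -/
theorem IsHomotopyBasis.sumElim {ι κ : Type} [Fintype ι] [Fintype κ] {g : ι → S.toCDGA}
    {deg : ι → ℕ} {g' : κ → S.toCDGA} {deg' : κ → ℕ} (h : S.IsHomotopyBasis Even g deg)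
    (h' : S.IsHomotopyBasis Odd g' deg') :
    S.IsHomotopyBasis (fun _ => True) (Sum.elim g g') (Sum.elim deg deg') where
  prop _ := trivial
  mem := Sum.rec h.mem h'.mem
  span n _ v hv := by
    rcases Nat.even_or_odd n with hn | hn
    · obtain ⟨c, hc, hv⟩ := h.span n hn v hv
      exact ⟨Sum.elim c 0, Sum.rec hc fun _ _ => rfl, by simpa using hv⟩
    · obtain ⟨c, hc, hv⟩ := h'.span n hn v hv
      exact ⟨Sum.elim 0 c, Sum.rec (fun _ _ => rfl) hc, by simpa using hv⟩
  independent n c hc hmem := by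
    rw [Fintype.sum_sum_type] at hmem
    simp only [Sum.elim_inl, Sum.elim_inr] at hmem
    rcases Nat.even_or_odd n with hn | hn
    · have h0 : ∀ j, c (Sum.inr j) = 0 := fun j => hc (Sum.inr j) fun hj =>
        Nat.not_even_iff_odd.mpr (h'.prop j) (by rw [show deg' j = n from hj]; exact hn)
      have h1 := h.independent n (fun i => c (Sum.inl i)) (fun i => hc (Sum.inl i))
        (by simpa [h0] using hmem)
      exact funext (Sum.rec (congrFun h1) h0)
    · have h0 : ∀ j, c (Sum.inl j) = 0 := fun j => hc (Sum.inl j) fun hj =>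
        Nat.not_odd_iff_even.mpr (h.prop j) (by rw [show deg j = n from hj]; exact hn)
      have h1 := h'.independent n (fun i => c (Sum.inr i)) (fun i => hc (Sum.inr i))
        (by simpa [h0] using hmem)
      exact funext (Sum.rec h0 (congrFun h1))

end SullivanAlgebra

/-! ### Lifting a basis of the homotopy to generators of the minimal part. -/

namespace CDGA

theorem IsFreeOn.exists_isContraction {A : CDGA.{u}} {V : ℕ → Submodule ℚ A} (h : A.IsFreeOn V) :
    ∃ θ : A →ₗ[ℚ] A, A.IsContraction θ ∧
      (∀ n, ∀ v ∈ V n, ∃ w ∈ V n, A.d w ∈ A.pos ^ 2 ∧ A.laplacian θ w ∈ A.pos ^ 2 ∧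
        A.laplacian θ (v - w) - (v - w) ∈ A.pos ^ 2 ∧
        (A.d v ∈ A.pos ^ 2 → v - w ∈ (V (n - 1)).map A.d ⊔ A.pos ^ 2)) ∧
      ((∀ a, A.d a ∈ A.pos ^ 2) → θ = 0) := by
  obtain ⟨θ, h1, h2, h3, h4, h5⟩ := h.exists_contraction
  refine ⟨θ, ⟨fun a => exists_algebraMap_of_adjoin h.le_pos h.adjoin_eq_top, h1, h2, h3, ?_⟩,
    h4, h5⟩
  have hV : ∀ v ∈ ⨆ n, V n, ∃ w ∈ A.pos, ∃ t ∈ A.pos, w + t = v ∧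
      A.laplacian θ w ∈ A.pos ^ 2 ∧ A.laplacian θ t - t ∈ A.pos ^ 2 := by
    intro v hv
    induction hv using Submodule.iSup_induction' with
    | mem n v hv =>
      obtain ⟨w, hw, -, hw2, hw3, -⟩ := h4 n v hv
      exact ⟨w, h.le_pos (Submodule.mem_iSup_of_mem n hw), v - w,
        h.le_pos (Submodule.mem_iSup_of_mem n (Submodule.sub_mem _ hv hw)), add_sub_cancel w v,
        hw2, hw3⟩
    | zero => exact ⟨0, Submodule.zero_mem _, 0, Submodule.zero_mem _, by simp, by simp, by simp⟩
    | add a b _ _ ha hb =>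
      obtain ⟨w, hw, t, ht, rfl, hw', ht'⟩ := ha
      obtain ⟨w₂, hw₂, t₂, ht₂, rfl, hw₂', ht₂'⟩ := hb
      refine ⟨w + w₂, Submodule.add_mem _ hw hw₂, t + t₂, Submodule.add_mem _ ht ht₂,
        add_add_add_comm _ _ _ _, ?_, ?_⟩
      · rw [map_add]
        exact Submodule.add_mem _ hw' hw₂'
      · rw [map_add, add_sub_add_comm]
        exact Submodule.add_mem _ ht' ht₂'
  intro a ha
  obtain ⟨v, hv, f, hf, rfl⟩ := Submodule.mem_sup.mp (pos_le_of_adjoin h.le_pos h.adjoin_eq_top ha)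
  obtain ⟨w, hw, t, ht, rfl, hw', ht'⟩ := hV v hv
  exact ⟨w, hw, t, ht, f, hf, rfl, hw', ht'⟩

end CDGA

namespace SullivanAlgebra

open CDGA CDGA.IsContraction

variable {S : SullivanAlgebra.{u}}

theorem mem_decomposables {a : S.toCDGA} : a ∈ S.decomposables ↔ a ∈ S.toCDGA.pos ^ 2 := by
  rw [pow_two]
  rfl

theorem mem_linearCocycles {n : ℕ} {v : S.toCDGA} :
    v ∈ S.linearCocycles n ↔ v ∈ S.V n ∧ S.d v ∈ S.toCDGA.pos ^ 2 :=
  and_congr Iff.rfl mem_decomposables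

theorem mem_linearCoboundaries {n : ℕ} {v : S.toCDGA} : v ∈ S.linearCoboundaries n ↔
    v ∈ S.V n ∧ v ∈ (S.V (n - 1)).map S.d ⊔ S.toCDGA.pos ^ 2 := by
  rw [pow_two]
  rfl

/-- `V 0 = ⊥`, whereas members of the basis are nonzero. -/
theorem IsHomotopyBasis.deg_pos {ι : Type} [Fintype ι] {P : ℕ → Prop} {g : ι → S.toCDGA}
    {deg : ι → ℕ} (h : S.IsHomotopyBasis P g deg) (i : ι) : 0 < deg i := by
  classical
  by_contra h0
  have hi : deg i = 0 := by omega
  have h1 := (mem_linearCocycles.mp (h.mem i)).1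
  rw [hi, S.isFreeOn.zero_eq_bot, Submodule.mem_bot] at h1
  have h2 := h.independent 0 (Pi.single i 1) (fun j hj => by
    rw [Pi.single_eq_of_ne]
    rintro rfl
    exact hj hi) (by
      rw [Finset.sum_eq_zero]
      · exact Submodule.zero_mem _
      · intro j _
        by_cases hj : j = i
        · rw [hj, h1, smul_zero]
        · rw [Pi.single_eq_of_ne hj, zero_smul])
  have h3 := congrFun h2 i
  rw [Pi.single_eq_same] at h3
  exact one_ne_zero h3

/-- A basis of the homotopy lifts to generators of the minimal part. -/
theorem IsHomotopyBasis.exists_generators {ι : Type} [Fintype ι] {g : ι → S.toCDGA} {deg : ι → ℕ}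
    (h : S.IsHomotopyBasis (fun _ => True) g deg) :
    ∃ (θ : S.toCDGA →ₗ[ℚ] S.toCDGA) (hθ : S.toCDGA.IsContraction θ) (x : ι → S.toCDGA),
      (∀ i, x i ∈ S.gr (deg i)) ∧ (∀ i, x i ∈ hθ.minimalPart) ∧
      (∀ i, S.d (x i) ∈ S.toCDGA.pos ^ 2) ∧
      (∀ c : ι → ℚ, ∑ i, c i • x i ∈ S.toCDGA.pos ^ 2 → c = 0) ∧
      (∀ a ∈ hθ.minimalPart, a ∈ Algebra.adjoin ℚ (Set.range x)) ∧ (S.IsMinimal → θ = 0) := by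
  classical
  obtain ⟨θ, hθ, hV, hmin⟩ := S.isFreeOn.exists_isContraction
  have hVpos : ∀ n, ∀ v ∈ S.V n, v ∈ S.toCDGA.pos := fun n v hv =>
    S.isFreeOn.le_pos (Submodule.mem_iSup_of_mem n hv)
  have hL2 : ∀ a ∈ S.toCDGA.pos ^ 2, S.toCDGA.laplacian θ a ∈ S.toCDGA.pos ^ 2 :=
    fun a ha => hθ.laplacian_mem_pos_pow one_le_two ha
  have hd2 : ∀ a ∈ S.toCDGA.pos ^ 2, S.d a ∈ S.toCDGA.pos ^ 2 :=
    fun a ha => d_mem_pos_pow one_le_two ha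
  -- `g' i` represents the same class in `H(V, d₀)` as `g i` and is killed by `L` modulo
  -- decomposables. This permits a further decomposable correction `x i` in the generalized kernel
  -- of `L`.
  choose g' hg'V hg'd hg'L _ hg'g using
    fun i => hV _ _ (mem_linearCocycles.mp (h.mem i)).1
  choose x hxmin hxgr hxg using
    fun i => hθ.exists_lift (S.isFreeOn.le_gr _ (hg'V i)) (hg'L i)
  have hx : ∀ i, x i = g' i - (g' i - x i) := fun i => (sub_sub_cancel _ _).symm
  have hxpos : ∀ i, x i ∈ S.toCDGA.pos := fun i => by
    rw [hx]
    exact Submodule.sub_mem _ (hVpos _ _ (hg'V i)) (pos_sq_le (hxg i))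
  have hxd : ∀ i, S.d (x i) ∈ S.toCDGA.pos ^ 2 := fun i => by
    rw [hx, map_sub]
    exact Submodule.sub_mem _ (hg'd i) (hd2 _ (hxg i))
  have hxL : ∀ i, S.toCDGA.laplacian θ (x i) ∈ S.toCDGA.pos ^ 2 := fun i => by
    rw [hx, map_sub]
    exact Submodule.sub_mem _ (hg'L i) (hL2 _ (hxg i))
  have hsum : ∀ c : ι → ℚ, ∑ i, c i • g' i - ∑ i, c i • x i ∈ S.toCDGA.pos ^ 2 := fun c => by
    rw [← Finset.sum_sub_distrib]
    refine Submodule.sum_mem _ fun i _ => ?_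
    rw [← smul_sub]
    exact Submodule.smul_mem _ _ (hxg i)
  have hsum' : ∀ n, ∀ c : ι → ℚ, (∀ i, deg i ≠ n → c i = 0) →
      ∑ i, c i • g i - ∑ i, c i • g' i ∈ (S.V (n - 1)).map S.d ⊔ S.toCDGA.pos ^ 2 ∧
        ∑ i, c i • g i ∈ S.V n ∧ ∑ i, c i • g' i ∈ S.V n := by
    intro n c hc
    rw [← Finset.sum_sub_distrib]
    refine ⟨Submodule.sum_mem _ fun i _ => ?_, Submodule.sum_mem _ fun i _ => ?_,
      Submodule.sum_mem _ fun i _ => ?_⟩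
    all_goals
      by_cases hi : deg i = n
    · subst hi
      rw [← smul_sub]
      exact Submodule.smul_mem _ _ (hg'g i (mem_linearCocycles.mp (h.mem i)).2)
    · rw [hc i hi, zero_smul, zero_smul, sub_zero]
      exact Submodule.zero_mem _
    · subst hi
      exact Submodule.smul_mem _ _ (mem_linearCocycles.mp (h.mem i)).1
    · rw [hc i hi, zero_smul]
      exact Submodule.zero_mem _
    · subst hi
      exact Submodule.smul_mem _ _ (hg'V i)
    · rw [hc i hi, zero_smul]
      exact Submodule.zero_mem _
  refine ⟨θ, hθ, x, hxgr, hxmin, hxd, ?_, ?_, fun hS => hmin fun a => mem_decomposables.mp (hS a)⟩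
  · intro c hc
    funext i
    -- Independence is available degree by degree only, so the relation is projected to the degree
    -- of the index `i`.
    let c' : ι → ℚ := fun j => if deg j = deg i then c j else 0
    have hc' : ∀ j, deg j ≠ deg i → c' j = 0 := fun j hj => if_neg hj
    have h1 : ∑ j, c' j • x j ∈ S.toCDGA.pos ^ 2 := by
      have h2 := proj_mem_pos_sq hc (deg i)
      rw [map_sum] at h2
      convert h2 using 2 with j
      rw [map_smul]
      by_cases hj : deg j = deg i
      · rw [show c' j = c j from if_pos hj, ← hj, proj_of_mem (hxgr j)]
      · rw [hc' j hj, zero_smul, proj_of_mem_ne hj (hxgr j), smul_zero]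
    obtain ⟨h2, h3, -⟩ := hsum' _ c' hc'
    have h4 := Submodule.add_mem _ (Submodule.add_mem _ h2 (Submodule.mem_sup_right (hsum c')))
      (Submodule.mem_sup_right h1)
    rw [sub_add_sub_cancel, sub_add_cancel] at h4
    have h5 := congrFun (h.independent _ c' hc' (mem_linearCoboundaries.mpr ⟨h3, h4⟩)) i
    rwa [show c' i = c i from if_pos rfl] at h5
  · refine fun a ha => hθ.mem_adjoin_of_mem_minimalPart hxgr hxmin
      (fun i => mem_weight.mpr ⟨by rw [pow_one]; exact hxpos i, ?_⟩) ?_ ha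
    · rw [Nat.cast_zero, zero_smul, sub_zero]
      exact hxL i
    intro a ha
    obtain ⟨v, hv, f, hf, rfl⟩ := Submodule.mem_sup.mp
      (pos_le_of_adjoin S.isFreeOn.le_pos S.isFreeOn.adjoin_eq_top ha)
    refine Submodule.add_mem _ ?_ (Submodule.mem_sup_right (hθ.pos_sq_le_posWeight hf))
    clear ha
    induction hv using Submodule.iSup_induction' with
    | zero => exact Submodule.zero_mem _
    | add a b _ _ ha hb => exact Submodule.add_mem _ ha hb
    | mem n v hv =>
      obtain ⟨w, hw, hwd, hwL, hvw, -⟩ := hV n v hv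
      obtain ⟨c, hc, hwc⟩ := h.span n trivial w (mem_linearCocycles.mpr ⟨hw, hwd⟩)
      have h1 := (mem_linearCoboundaries.mp hwc).2
      have h2 := Submodule.add_mem _ h1 (hsum' n c hc).1
      rw [sub_add_sub_cancel] at h2
      obtain ⟨_, ⟨t, ht, rfl⟩, e, he, h3⟩ := Submodule.mem_sup.mp h2
      -- The class of `w` in `H(V, d₀)` determines `w` modulo decomposables: `w` and the `g' i` are
      -- killed by `L` up to decomposables, hence so is the coboundary `d t` by which they differ.
      have hLt : S.toCDGA.laplacian θ (S.d t) ∈ S.toCDGA.pos ^ 2 := by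
        rw [eq_sub_of_add_eq h3, map_sub, map_sub, map_sum]
        refine Submodule.sub_mem _ (Submodule.sub_mem _ hwL (Submodule.sum_mem _ fun i _ => ?_))
          (hL2 _ he)
        rw [map_smul]
        exact Submodule.smul_mem _ _ (hg'L i)
      obtain ⟨t', ht', ht'd, ht'L, htt', -⟩ := hV _ t ht
      have hdt : S.d t ∈ S.toCDGA.pos ^ 2 := by
        -- Such a coboundary is decomposable. Indeed `t = t' + (t - t')`, where `d t'` is
        -- decomposable and `L` is the identity on `t - t'` up to decomposables, so `d t` and `L (d
        -- t)` agree up to decomposables.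
        have h4 : S.d t = S.toCDGA.laplacian θ (S.d t) - S.d (S.toCDGA.laplacian θ t') -
            S.d (S.toCDGA.laplacian θ (t - t') - (t - t')) + S.d t' := by
          rw [laplacian_d]
          simp only [map_sub]
          abel
        rw [h4]
        exact Submodule.add_mem _ (Submodule.sub_mem _ (Submodule.sub_mem _ hLt (hd2 _ ht'L))
          (hd2 _ htt')) ht'd
      have h5 : w - ∑ i, c i • x i ∈ S.toCDGA.pos ^ 2 := by
        rw [← sub_add_sub_cancel w (∑ i, c i • g' i), ← h3]
        exact Submodule.add_mem _ (Submodule.add_mem _ hdt he) (hsum c)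
      have h6 : v = ∑ i, c i • x i + ((w - ∑ i, c i • x i) + (v - w)) := by abel
      rw [h6]
      refine Submodule.add_mem_sup (Submodule.sum_mem _ fun i _ => Submodule.smul_mem _ _
        (Submodule.subset_span ⟨i, rfl⟩)) (Submodule.add_mem _ (hθ.pos_sq_le_posWeight h5)
        (weight_le_posWeight 1 0 (mem_weight.mpr ⟨?_, ?_⟩)))
      · rw [pow_one]
        exact Submodule.sub_mem _ (hVpos _ _ hv) (hVpos _ _ hw)
      · rwa [zero_add, Nat.cast_one, one_smul]

end SullivanAlgebra

/-! ### Monomials in one even and two odd generators. -/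

namespace CDGA

section Monomials

variable {A : CDGA.{u}} {p q r : ℕ} {x y z : A}

/-- The monomials `x ^ i`, `x ^ i * y`, `x ^ i * z` and `x ^ i * (y * z)`. -/
def oddMonomial (x y z : A) : ℕ × Bool × Bool → A
  | (i, false, false) => x ^ i
  | (i, true, false) => x ^ i * y
  | (i, false, true) => x ^ i * z
  | (i, true, true) => x ^ i * (y * z)

/-- The degrees of the monomials. -/
def oddMonomialDeg (p q r : ℕ) : ℕ × Bool × Bool → ℕ
  | (i, false, false) => i * p
  | (i, true, false) => i * p + r
  | (i, false, true) => i * p + q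
  | (i, true, true) => i * p + (r + q)

theorem oddMonomial_mem (hx : x ∈ A.gr p) (hy : y ∈ A.gr r) (hz : z ∈ A.gr q)
    (t : ℕ × Bool × Bool) : oddMonomial x y z t ∈ A.gr (oddMonomialDeg p q r t) := by
  obtain ⟨i, _ | _, _ | _⟩ := t
  · exact pow_mem_gr hx i
  · exact mul_mem_gr (pow_mem_gr hx i) hz
  · exact mul_mem_gr (pow_mem_gr hx i) hy
  · exact mul_mem_gr (pow_mem_gr hx i) (mul_mem_gr hy hz)

/-- The subalgebra generated by an even and two odd elements is spanned by the monomials. -/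
theorem mem_span_oddMonomial (hp : Even p) (hq : Odd q) (hr : Odd r) (hx : x ∈ A.gr p)
    (hy : y ∈ A.gr r) (hz : z ∈ A.gr q) {a : A} (ha : a ∈ Algebra.adjoin ℚ {x, y, z}) :
    a ∈ Submodule.span ℚ (Set.range (oddMonomial x y z)) := by
  set N := Submodule.span ℚ (Set.range (oddMonomial x y z)) with hN
  have hmem : ∀ t, oddMonomial x y z t ∈ N := fun t => Submodule.subset_span ⟨t, rfl⟩
  have hxc : ∀ (i : ℕ) (b : A), b * x ^ i = x ^ i * b := fun i b =>
    ((commute_of_signInv_eq (signInv_even hp hx) b).pow_left i).eq.symm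
  have hyy : y * y = 0 := mul_self_of_signInv_eq_neg (signInv_odd hr hy)
  have hzz : z * z = 0 := mul_self_of_signInv_eq_neg (signInv_odd hq hz)
  have hzy : z * y = -(y * z) :=
    mul_eq_neg_of_signInv_eq_neg (signInv_odd hq hz) (signInv_odd hr hy)
  have key : ∀ g ∈ ({x, y, z} : Set A), ∀ t, g * oddMonomial x y z t ∈ N := by
    rintro g (rfl | rfl | rfl) ⟨i, _ | _, _ | _⟩
    · exact (pow_succ' g i).symm ▸ hmem (i + 1, false, false)
    · simpa [oddMonomial, pow_succ', mul_assoc] using hmem (i + 1, false, true)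
    · simpa [oddMonomial, pow_succ', mul_assoc] using hmem (i + 1, true, false)
    · simpa [oddMonomial, pow_succ', mul_assoc] using hmem (i + 1, true, true)
    · rw [oddMonomial, hxc]
      exact hmem (i, true, false)
    · rw [oddMonomial, ← mul_assoc, hxc, mul_assoc]
      exact hmem (i, true, true)
    · rw [oddMonomial, ← mul_assoc, hxc, mul_assoc, hyy, mul_zero]
      exact Submodule.zero_mem _
    · rw [oddMonomial, ← mul_assoc, hxc, mul_assoc, ← mul_assoc g, hyy, zero_mul, mul_zero]
      exact Submodule.zero_mem _
    · rw [oddMonomial, hxc]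
      exact hmem (i, false, true)
    · rw [oddMonomial, ← mul_assoc, hxc, mul_assoc, hzz, mul_zero]
      exact Submodule.zero_mem _
    · rw [oddMonomial, ← mul_assoc, hxc, mul_assoc, hzy, mul_neg]
      exact Submodule.neg_mem _ (hmem (i, true, true))
    · rw [oddMonomial, ← mul_assoc, hxc, mul_assoc, ← mul_assoc g, hzy, neg_mul, mul_assoc, hzz,
        mul_zero, neg_zero, mul_zero]
      exact Submodule.zero_mem _
  have hmul : ∀ g ∈ ({x, y, z} : Set A), ∀ b ∈ N, g * b ∈ N := by
    intro g hg b hb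
    induction hb using Submodule.span_induction with
    | mem b hb => obtain ⟨t, rfl⟩ := hb; exact key g hg t
    | zero => rw [mul_zero]; exact Submodule.zero_mem _
    | add b c _ _ hb hc => rw [mul_add]; exact Submodule.add_mem _ hb hc
    | smul s b _ hb => rw [mul_smul_comm]; exact Submodule.smul_mem _ _ hb
  rw [← Subalgebra.mem_toSubmodule, Algebra.adjoin_eq_span] at ha
  refine Submodule.span_le.mpr ?_ ha
  intro c hc
  induction hc using Submonoid.closure_induction_left with
  | one => exact hmem (0, false, false) |> fun h => by simpa [oddMonomial] using h
  | mul_left g hg b _ hb => exact hmul g hg b hb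

/-- Since `p > 0`, the degree determines the exponent, so two terms of the same shape merge into
one. The degree is prescribed only for nonzero coefficients, which leaves the exponent of a zero
term free. -/
theorem exists_smul_pow_mul_add (hp0 : 0 < p) {n s : ℕ} {γ γ' : ℚ} {l l' : ℕ} (w : A)
    (h : γ ≠ 0 → l * p + s = n) (h' : γ' ≠ 0 → l' * p + s = n) :
    ∃ (δ : ℚ) (k : ℕ), γ • (x ^ l * w) + γ' • (x ^ l' * w) = δ • (x ^ k * w) ∧
      (δ ≠ 0 → k * p + s = n) := by
  by_cases h0 : γ = 0
  · exact ⟨γ', l', by rw [h0, zero_smul, zero_add], h'⟩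
  by_cases h0' : γ' = 0
  · exact ⟨γ, l, by rw [h0', zero_smul, add_zero], h⟩
  have hl : l = l' := Nat.eq_of_mul_eq_mul_right hp0 (by have := h h0; have := h' h0'; omega)
  exact ⟨γ + γ', l, by rw [hl, add_smul], fun _ => h h0⟩

/-- A homogeneous element of odd degree is a combination of `x ^ i * y` and `x ^ j * z`. -/
theorem exists_of_mem_gr_odd (hp : Even p) (hp0 : 0 < p) (hq : Odd q) (hr : Odd r)
    (hx : x ∈ A.gr p) (hy : y ∈ A.gr r) (hz : z ∈ A.gr q) {a : A}
    (ha : a ∈ Algebra.adjoin ℚ {x, y, z}) {n : ℕ} (hn : Odd n) (han : a ∈ A.gr n) :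
    ∃ (α β : ℚ) (i j : ℕ), a = α • (x ^ i * y) + β • (x ^ j * z) ∧ (α ≠ 0 → i * p + r = n) ∧
      (β ≠ 0 → j * p + q = n) := by
  have h := mem_span_of_mem_gr (oddMonomial_mem hx hy hz)
    (mem_span_oddMonomial hp hq hr hx hy hz ha) han
  clear han ha
  induction h using Submodule.span_induction with
  | mem a ha =>
    obtain ⟨⟨i, _ | _, _ | _⟩, hd, rfl⟩ := ha
    · exact absurd hn (Nat.not_odd_iff_even.mpr (hd ▸ hp.mul_left i))
    · exact ⟨0, 1, 0, i, by simp [oddMonomial], fun h => absurd rfl h, fun _ => hd⟩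
    · exact ⟨1, 0, i, 0, by simp [oddMonomial], fun _ => hd, fun h => absurd rfl h⟩
    · exact absurd hn (Nat.not_odd_iff_even.mpr (hd ▸ (hp.mul_left i).add (hr.add_odd hq)))
  | zero => exact ⟨0, 0, 0, 0, by simp, fun h => absurd rfl h, fun h => absurd rfl h⟩
  | smul s a _ ha =>
    obtain ⟨α, β, i, j, rfl, h1, h2⟩ := ha
    refine ⟨s * α, s * β, i, j, by rw [smul_add, smul_smul, smul_smul],
      fun h => h1 (right_ne_zero_of_mul h), fun h => h2 (right_ne_zero_of_mul h)⟩
  | add a b _ _ ha hb =>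
    obtain ⟨α, β, i, j, rfl, h1, h2⟩ := ha
    obtain ⟨α', β', i', j', rfl, h1', h2'⟩ := hb
    obtain ⟨δ, k, h3, h4⟩ := exists_smul_pow_mul_add hp0 (x := x) y h1 h1'
    obtain ⟨ε, l, h5, h6⟩ := exists_smul_pow_mul_add hp0 (x := x) z h2 h2'
    exact ⟨δ, ε, k, l, by rw [← h3, ← h5, add_add_add_comm], h4, h6⟩

/-- A homogeneous element of even degree is a combination of `x ^ i` and `x ^ j * (y * z)`. -/
theorem exists_of_mem_gr_even (hp : Even p) (hp0 : 0 < p) (hq : Odd q) (hr : Odd r)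
    (hx : x ∈ A.gr p) (hy : y ∈ A.gr r) (hz : z ∈ A.gr q) {a : A}
    (ha : a ∈ Algebra.adjoin ℚ {x, y, z}) {n : ℕ} (hn : Even n) (han : a ∈ A.gr n) :
    ∃ (α β : ℚ) (i j : ℕ), a = α • x ^ i + β • (x ^ j * (y * z)) ∧ (α ≠ 0 → i * p = n) ∧
      (β ≠ 0 → j * p + (r + q) = n) := by
  have h := mem_span_of_mem_gr (oddMonomial_mem hx hy hz)
    (mem_span_oddMonomial hp hq hr hx hy hz ha) han
  clear han ha
  induction h using Submodule.span_induction with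
  | mem a ha =>
    obtain ⟨⟨i, _ | _, _ | _⟩, hd, rfl⟩ := ha
    · exact ⟨1, 0, i, 0, by simp [oddMonomial], fun _ => hd, fun h => absurd rfl h⟩
    · exact absurd hn (Nat.not_even_iff_odd.mpr (hd ▸ (hp.mul_left i).add_odd hq))
    · exact absurd hn (Nat.not_even_iff_odd.mpr (hd ▸ (hp.mul_left i).add_odd hr))
    · exact ⟨0, 1, 0, i, by simp [oddMonomial], fun h => absurd rfl h, fun _ => hd⟩
  | zero => exact ⟨0, 0, 0, 0, by simp, fun h => absurd rfl h, fun h => absurd rfl h⟩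
  | smul s a _ ha =>
    obtain ⟨α, β, i, j, rfl, h1, h2⟩ := ha
    refine ⟨s * α, s * β, i, j, by rw [smul_add, smul_smul, smul_smul],
      fun h => h1 (right_ne_zero_of_mul h), fun h => h2 (right_ne_zero_of_mul h)⟩
  | add a b _ _ ha hb =>
    obtain ⟨α, β, i, j, rfl, h1, h2⟩ := ha
    obtain ⟨α', β', i', j', rfl, h1', h2'⟩ := hb
    obtain ⟨δ, k, h3, h4⟩ := exists_smul_pow_mul_add hp0 (s := 0) (x := x) 1 h1 h1'
    obtain ⟨ε, l, h5, h6⟩ := exists_smul_pow_mul_add hp0 (x := x) (y * z) h2 h2'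
    rw [mul_one, mul_one, mul_one] at h3
    exact ⟨δ, ε, k, l, by rw [← h3, ← h5, add_add_add_comm], h4, h6⟩

end Monomials

end CDGA

/-! ### Three generators with decomposable differentials: consequences of degrees. -/

namespace CDGA

section Generators

variable {A : CDGA.{u}}

/-- `x` of even degree `p` and `y`, `z` of odd degrees `r`, `q` are linearly independent modulo
decomposables and generate the subalgebra `K`. -/
structure AreGenerators (K : Subalgebra ℚ A) (p q r : ℕ) (x y z : A) : Prop where
  even : Even p
  odd : Odd q
  odd' : Odd r
  pos : 0 < p
  x_mem : x ∈ A.gr p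
  y_mem : y ∈ A.gr r
  z_mem : z ∈ A.gr q
  independent : ∀ a b c : ℚ, a • x + b • y + c • z ∈ A.pos ^ 2 → a = 0 ∧ b = 0 ∧ c = 0
  adjoin_eq : Algebra.adjoin ℚ {x, y, z} = K

namespace AreGenerators

variable {K : Subalgebra ℚ A} {p q r : ℕ} {x y z : A}

theorem swap (h : AreGenerators K p q r x y z) : AreGenerators K p r q x z y where
  even := h.even
  odd := h.odd'
  odd' := h.odd
  pos := h.pos
  x_mem := h.x_mem
  y_mem := h.z_mem
  z_mem := h.y_mem
  independent a b c habc := by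
    rw [add_right_comm] at habc
    obtain ⟨ha, hb, hc⟩ := h.independent a c b habc
    exact ⟨ha, hc, hb⟩
  adjoin_eq := by
    rw [← h.adjoin_eq, Set.pair_comm]

theorem y_mem_pos (h : AreGenerators K p q r x y z) : y ∈ A.pos :=
  mem_pos_of_mem_gr h.odd'.pos h.y_mem

theorem z_mem_pos (h : AreGenerators K p q r x y z) : z ∈ A.pos :=
  mem_pos_of_mem_gr h.odd.pos h.z_mem

theorem x_mem_subalgebra (h : AreGenerators K p q r x y z) : x ∈ K :=
  h.adjoin_eq ▸ Algebra.subset_adjoin (Or.inl rfl)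

theorem y_mem_subalgebra (h : AreGenerators K p q r x y z) : y ∈ K :=
  h.adjoin_eq ▸ Algebra.subset_adjoin (Or.inr (Or.inl rfl))

theorem z_mem_subalgebra (h : AreGenerators K p q r x y z) : z ∈ K :=
  h.adjoin_eq ▸ Algebra.subset_adjoin (Or.inr (Or.inr rfl))

theorem mul_mem_pos_sq {a b : A} (ha : a ∈ A.pos) (hb : b ∈ A.pos) : a * b ∈ A.pos ^ 2 := by
  rw [pow_two]
  exact Submodule.mul_mem_mul ha hb

theorem smul_z (h : AreGenerators K p q r x y z) {β : ℚ} (hβ : β ≠ 0) :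
    AreGenerators K p q r x y (β • z) where
  even := h.even
  odd := h.odd
  odd' := h.odd'
  pos := h.pos
  x_mem := h.x_mem
  y_mem := h.y_mem
  z_mem := Submodule.smul_mem _ _ h.z_mem
  independent a b c habc := by
    rw [smul_smul] at habc
    obtain ⟨ha, hb, hc⟩ := h.independent a b (c * β) habc
    exact ⟨ha, hb, (mul_eq_zero.mp hc).resolve_right hβ⟩
  adjoin_eq := by
    rw [← h.adjoin_eq]
    apply le_antisymm <;> refine Algebra.adjoin_le ?_
    · have hz : z ∈ Algebra.adjoin ℚ {x, y, z} := Algebra.subset_adjoin (Or.inr (Or.inr rfl))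
      rintro _ (rfl | rfl | rfl)
      · exact Algebra.subset_adjoin (Or.inl rfl)
      · exact Algebra.subset_adjoin (Or.inr (Or.inl rfl))
      · exact Subalgebra.smul_mem _ hz β
    · have hz : β • z ∈ Algebra.adjoin ℚ {x, y, β • z} :=
        Algebra.subset_adjoin (Or.inr (Or.inr rfl))
      have hz' := Subalgebra.smul_mem _ hz β⁻¹
      rw [inv_smul_smul₀ hβ] at hz'
      rintro _ (rfl | rfl | rfl)
      · exact Algebra.subset_adjoin (Or.inl rfl)
      · exact Algebra.subset_adjoin (Or.inr (Or.inl rfl))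
      · exact hz'

/-- For `j > 0` the correction of `y` is decomposable; for `j = 0` it is a linear change among odd
generators of equal degree. -/
theorem sub_smul (h : AreGenerators K p q r x y z) {j : ℕ} (hj : j * p + q = r) (γ : ℚ) :
    AreGenerators K p q r x (y - γ • (x ^ j * z)) z where
  even := h.even
  odd := h.odd
  odd' := h.odd'
  pos := h.pos
  x_mem := h.x_mem
  y_mem := Submodule.sub_mem _ h.y_mem
    (Submodule.smul_mem _ _ (hj ▸ mul_mem_gr (pow_mem_gr h.x_mem j) h.z_mem))
  z_mem := h.z_mem
  independent a b c habc := by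
    rcases j with _ | j
    · rw [pow_zero, one_mul] at habc
      have h1 : a • x + b • (y - γ • z) + c • z = a • x + b • y + (c - b * γ) • z := by module
      rw [h1] at habc
      obtain ⟨ha, hb, hc⟩ := h.independent _ _ _ habc
      rw [hb, zero_mul, sub_zero] at hc
      exact ⟨ha, hb, hc⟩
    · refine h.independent a b c ?_
      have h1 : a • x + b • y + c • z = (a • x + b • (y - γ • (x ^ (j + 1) * z)) + c • z) +
          (b * γ) • (x ^ (j + 1) * z) := by module
      rw [h1]
      refine Submodule.add_mem _ habc (Submodule.smul_mem _ _ (mul_mem_pos_sq ?_ h.z_mem_pos))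
      exact mem_pos_of_mem_gr (Nat.mul_pos (Nat.succ_pos j) h.pos) (pow_mem_gr h.x_mem (j + 1))
  adjoin_eq := by
    rw [← h.adjoin_eq]
    apply le_antisymm <;> refine Algebra.adjoin_le ?_
    · have hx : x ∈ Algebra.adjoin ℚ {x, y, z} := Algebra.subset_adjoin (Or.inl rfl)
      have hy : y ∈ Algebra.adjoin ℚ {x, y, z} := Algebra.subset_adjoin (Or.inr (Or.inl rfl))
      have hz : z ∈ Algebra.adjoin ℚ {x, y, z} := Algebra.subset_adjoin (Or.inr (Or.inr rfl))
      rintro _ (rfl | rfl | rfl)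
      · exact hx
      · exact Subalgebra.sub_mem _ hy
          (Subalgebra.smul_mem _ (Subalgebra.mul_mem _ (Subalgebra.pow_mem _ hx j) hz) γ)
      · exact hz
    · set y' := y - γ • (x ^ j * z) with hy'
      have hx : x ∈ Algebra.adjoin ℚ {x, y', z} := Algebra.subset_adjoin (Or.inl rfl)
      have hy : y' ∈ Algebra.adjoin ℚ {x, y', z} := Algebra.subset_adjoin (Or.inr (Or.inl rfl))
      have hz : z ∈ Algebra.adjoin ℚ {x, y', z} := Algebra.subset_adjoin (Or.inr (Or.inr rfl))
      have hyy := Subalgebra.add_mem _ hy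
        (Subalgebra.smul_mem _ (Subalgebra.mul_mem _ (Subalgebra.pow_mem _ hx j) hz) γ)
      rw [hy', sub_add_cancel, ← hy'] at hyy
      rintro _ (rfl | rfl | rfl)
      · exact hx
      · exact hyy
      · exact hz

theorem y_ne_zero (h : AreGenerators K p q r x y z) : y ≠ 0 := by
  rintro rfl
  obtain ⟨-, h1, -⟩ := h.independent 0 1 0 (by simp)
  exact one_ne_zero h1

/-- A decomposable element of even degree in `K` whose `y * z` term vanishes for degree reasons is a
multiple of a power of `x` with exponent at least `2`. -/
theorem exists_eq_smul_pow (h : AreGenerators K p q r x y z) {a : A} (ha : a ∈ K)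
    (ha2 : a ∈ A.pos ^ 2) {n : ℕ} (hn : Even n) (hn0 : 0 < n) (hnrq : n < r + q)
    (han : a ∈ A.gr n) :
    ∃ (α : ℚ) (m : ℕ), a = α • x ^ m ∧ (α ≠ 0 → m * p = n ∧ 2 ≤ m) := by
  obtain ⟨α, β, m, j, rfl, h1, h2⟩ := exists_of_mem_gr_even h.even h.pos h.odd h.odd' h.x_mem
    h.y_mem h.z_mem (h.adjoin_eq ▸ ha) hn han
  obtain rfl : β = 0 := by
    by_contra hβ
    have := h2 hβ
    omega
  rw [zero_smul, add_zero] at ha2 ⊢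
  refine ⟨α, m, rfl, fun hα => ⟨h1 hα, ?_⟩⟩
  have hm := h1 hα
  by_contra hm2
  obtain rfl : m = 1 := by
    rcases m with _ | _ | m
    · omega
    · rfl
    · omega
  refine hα (h.independent α 0 0 ?_).1
  simpa using ha2

/-- In degree `p + 1`, which is less than `p + r` and `p + q`, the only possible terms are multiples
of `y` and `z` themselves. A decomposable combination of these is zero. -/
theorem d_x_eq_zero (h : AreGenerators K p q r x y z) (hK : ∀ a ∈ K, A.d a ∈ K)
    (hd : A.d x ∈ A.pos ^ 2) (hq1 : 1 < q) (hr1 : 1 < r) : A.d x = 0 := by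
  obtain ⟨α, β, i, j, h0, h1, h2⟩ := exists_of_mem_gr_odd h.even h.pos h.odd h.odd' h.x_mem
    h.y_mem h.z_mem (h.adjoin_eq ▸ hK x h.x_mem_subalgebra) h.even.add_one
    (A.d_mem _ _ h.x_mem)
  have hi : α • (x ^ i * y) = α • y := by
    by_cases hα : α = 0
    · rw [hα, zero_smul, zero_smul]
    · have := h1 hα
      rcases i with _ | i
      · rw [pow_zero, one_mul]
      · rw [add_mul] at this
        omega
  have hj : β • (x ^ j * z) = β • z := by
    by_cases hβ : β = 0
    · rw [hβ, zero_smul, zero_smul]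
    · have := h2 hβ
      rcases j with _ | j
      · rw [pow_zero, one_mul]
      · rw [add_mul] at this
        omega
  rw [hi, hj] at h0
  rw [h0] at hd ⊢
  obtain ⟨-, rfl, rfl⟩ := h.independent 0 α β (by simpa using hd)
  simp

/-- A cocycle of degree `1` bounds an element of degree `0`, that is, a constant, and constants have
differential zero. -/
theorem eq_zero_of_mem_gr_one (hA : A.cohomology.gr 1 = ⊥)
    (h0 : ∀ a ∈ A.gr 0, ∃ s : ℚ, algebraMap ℚ A s = a) {a : A} (ha : a ∈ A.gr 1)
    (hd : A.d a = 0) : a = 0 := by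
  have h1 : ∀ t ∈ A.cohomology.gr 1, t = 0 := fun t ht => by rwa [hA, Submodule.mem_bot] at ht
  obtain ⟨b, hb⟩ := cohomologyClass_eq_zero.mp
    (h1 (A.cohomologyClass ⟨a, hd⟩) ⟨⟨a, hd⟩, ha, rfl⟩)
  have hb : A.d b = a := hb
  rw [← proj_of_mem ha, ← hb, proj_d]
  obtain ⟨s, hs⟩ := h0 _ (proj_mem 0 b)
  rw [← hs, Algebra.algebraMap_eq_smul_one, map_smul, d_one, smul_zero]

/-- In degree `2` a power of the even generator `x` could only be `x` itself, which is not
decomposable, and `x ^ j * (y * z)` forces `j = 0` and `q = 1`. -/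
theorem exists_d_eq_smul_mul (h : AreGenerators K p q 1 x y z) (hK : ∀ a ∈ K, A.d a ∈ K)
    (hd : A.d y ∈ A.pos ^ 2) : ∃ β : ℚ, A.d y = β • (y * z) ∧ (β ≠ 0 → q = 1) := by
  obtain ⟨α, β, m, j, h0, h1, h2⟩ := exists_of_mem_gr_even h.even h.pos h.odd h.odd' h.x_mem
    h.y_mem h.z_mem (h.adjoin_eq ▸ hK y h.y_mem_subalgebra) even_two (A.d_mem _ _ h.y_mem)
  have hβ : β ≠ 0 → j * p + q = 1 := fun hβ => by have := h2 hβ; omega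
  have hβ' : β • (x ^ j * (y * z)) = β • (y * z) := by
    by_cases hβ0 : β = 0
    · rw [hβ0, zero_smul, zero_smul]
    · have h3 := hβ hβ0
      have h4 := h.pos
      have h5 := h.odd.pos
      rcases j with _ | j
      · rw [pow_zero, one_mul]
      · rw [add_mul] at h3
        omega
  rw [hβ'] at h0
  obtain rfl : α = 0 := by
    by_contra hα
    have h3 := h1 hα
    obtain ⟨s, hs⟩ := h.even
    have h4 := h.pos
    obtain rfl : m = 1 := by
      rcases m with _ | _ | m
      · omega
      · rfl
      · have : (m + 1 + 1) * p = m * p + p + p := by ring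
        omega
    refine hα (h.independent α 0 0 ?_).1
    have h5 : α • x = A.d y - β • (y * z) := by rw [h0, pow_one, add_sub_cancel_right]
    rw [zero_smul, zero_smul, add_zero, add_zero, h5]
    exact Submodule.sub_mem _ hd (Submodule.smul_mem _ _ (mul_mem_pos_sq h.y_mem_pos h.z_mem_pos))
  refine ⟨β, by rw [h0, zero_smul, zero_add], fun hβ0 => ?_⟩
  have h3 := hβ hβ0
  have h5 := h.odd.pos
  omega

/-- Simple connectivity excludes generators of degree `1`. -/
theorem one_lt (h : AreGenerators K p q r x y z) (hK : ∀ a ∈ K, A.d a ∈ K)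
    (hdy : A.d y ∈ A.pos ^ 2) (hdz : A.d z ∈ A.pos ^ 2) (hA : A.cohomology.gr 1 = ⊥)
    (h0 : ∀ a ∈ A.gr 0, ∃ s : ℚ, algebraMap ℚ A s = a) : 1 < r := by
  by_contra hr
  obtain rfl : r = 1 := by have := h.odd'.pos; omega
  -- If `y` had degree `1`, then `dy` would be a nonzero multiple of `y * z` and `z` would have
  -- degree `1` too. By symmetry `dz` is a multiple of `y * z`, so some nontrivial combination of
  -- `y` and `z` is a cocycle of degree `1`, hence zero.
  obtain ⟨β, hβ, hβq⟩ := h.exists_d_eq_smul_mul hK hdy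
  have hβ0 : β ≠ 0 := by
    rintro rfl
    rw [zero_smul] at hβ
    exact h.y_ne_zero (eq_zero_of_mem_gr_one hA h0 h.y_mem hβ)
  obtain rfl := hβq hβ0
  obtain ⟨γ, hγ, -⟩ := h.swap.exists_d_eq_smul_mul hK hdz
  have hzy : z * y = -(y * z) :=
    mul_eq_neg_of_signInv_eq_neg (signInv_odd h.odd h.z_mem) (signInv_odd h.odd' h.y_mem)
  have h1 : γ • y + β • z = 0 := by
    refine eq_zero_of_mem_gr_one hA h0 (Submodule.add_mem _ (Submodule.smul_mem _ _ h.y_mem)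
      (Submodule.smul_mem _ _ h.z_mem)) ?_
    rw [map_add, map_smul, map_smul, hβ, hγ, hzy]
    module
  refine hβ0 (h.independent 0 γ β ?_).2.2
  rw [zero_smul, zero_add, h1]
  exact Submodule.zero_mem _

end AreGenerators

end Generators

end CDGA

/-! ### Normal form of the differential, and formality. -/

namespace CDGA

section NormalForm

variable {A : CDGA.{u}} {V : ℕ → Submodule ℚ A} {K : Subalgebra ℚ A} {p q r : ℕ} {x y z : A}

namespace AreGenerators

theorem d_pow_mul (h : AreGenerators K p q r x y z) (hdx : A.d x = 0) (j : ℕ) (b : A) :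
    A.d (x ^ j * b) = x ^ j * A.d b := by
  have h1 : A.d (x ^ j) = 0 := Subalgebra.pow_mem A.cocycles hdx j
  rw [d_mul, h1, zero_mul, zero_add,
    signInv_even (h.even.mul_left j) (pow_mem_gr h.x_mem j)]

/-- A homomorphism to a free algebra from the model that maps the generators to generators of `K` is
injective with range `K`. -/
theorem injective_and_range_eq (h : AreGenerators K p q r x y z) (hA : A.IsFreeOn V)
    {D : MvPolynomial PUnit.{v + 1} ℚ} {hD : D ∈ shiftedHomogeneous (fun _ => p) 0 (q + 1)}
    (ψ : model h.even h.odd h.odd' D hD →ₐ[ℚ] A) (hx : ψ (modelX h.even h.odd h.odd' D hD) = x)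
    (hz : ψ (modelZ h.even h.odd h.odd' D hD) = z) (hy : ψ (modelY h.even h.odd h.odd' D hD) = y) :
    Function.Injective ψ ∧ ψ.range = K := by
  constructor
  · refine hA.injective_of_independent h.even h.odd h.odd' h.pos modelX_mem modelY_mem modelZ_mem
      adjoin_model_eq_top ψ ?_ ?_ ?_ ?_
    · rw [hx]; exact h.x_mem
    · rw [hy]; exact h.y_mem
    · rw [hz]; exact h.z_mem
    · rw [hx, hy, hz]; exact h.independent
  · rw [← Algebra.map_top, ← adjoin_model_eq_top, AlgHom.map_adjoin,
      Set.image_insert_eq, Set.image_pair, hx, hz, hy, Set.pair_comm, h.adjoin_eq]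

/-- Only the algebra structure matters, so the comparison with the model is made for `D = 0`. -/
theorem pow_ne_zero (h : AreGenerators K p q r x y z) (hA : A.IsFreeOn V) (n : ℕ) : x ^ n ≠ 0 := by
  obtain ⟨ψ, hx, hz, hy⟩ := exists_model_algHom.{0} (hp := h.even) (hq := h.odd) (hr := h.odd')
    (D := 0) (hD := Submodule.zero_mem _) A h.x_mem h.z_mem h.y_mem
  rw [← hx, ← map_pow]
  exact fun h0 => modelX_pow_ne_zero n ((h.injective_and_range_eq hA ψ hx hz hy).1
    (h0.trans (map_zero ψ).symm))

/-- If the differential vanishes on the generators, then the powers of `x` represent nonzero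
cohomology classes in infinitely many degrees. -/
theorem not_finite_cohomology (h : AreGenerators K p q r x y z) (hA : A.IsFreeOn V)
    (hK : ∀ b, A.d b ∈ K → ∃ b₀ ∈ K, A.d b₀ = A.d b) (hdx : A.d x = 0) (hdy : A.d y = 0)
    (hdz : A.d z = 0) : ¬ Module.Finite ℚ A.cohomology := by
  intro hfin
  have hdK : ∀ a ∈ K, A.d a = 0 := by
    have : K ≤ A.cocycles := by
      rw [← h.adjoin_eq]
      refine Algebra.adjoin_le ?_
      rintro _ (rfl | rfl | rfl)
      · exact hdx
      · exact hdy
      · exact hdz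
    exact fun a ha => this ha
  -- If `x ^ n` were a coboundary, it would bound an element of `K`; but `K` consists of cocycles
  -- and `x ^ n ≠ 0`. Finite-dimensional cohomology cannot be nonzero in infinitely many degrees.
  have hne : ∀ n, A.cohomology.gr (n * p) ≠ ⊥ := by
    intro n hbot
    have h1 : ∀ t ∈ A.cohomology.gr (n * p), t = 0 := fun t ht => by
      rwa [hbot, Submodule.mem_bot] at ht
    have hxK : x ^ n ∈ K := Subalgebra.pow_mem _ h.x_mem_subalgebra n
    obtain ⟨b, hb⟩ := cohomologyClass_eq_zero.mp
      (h1 (A.cohomologyClass ⟨x ^ n, hdK _ hxK⟩) ⟨⟨x ^ n, hdK _ hxK⟩, pow_mem_gr h.x_mem n, rfl⟩)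
    have hb : A.d b = x ^ n := hb
    obtain ⟨b₀, hb₀, hbb⟩ := hK b (hb ▸ hxK)
    rw [hdK b₀ hb₀, hb] at hbb
    exact h.pow_ne_zero hA n hbb.symm
  have hind : iSupIndep A.cohomology.gr := A.cohomologyGr_isInternal.submodule_iSupIndep
  refine Set.infinite_of_injective_forall_mem (f := fun n => n * p)
    (fun a b hab => Nat.eq_of_mul_eq_mul_right h.pos hab) hne
    (WellFoundedGT.finite_ne_bot_of_iSupIndep hind)

/-- For `k ≤ m` the element `y - (α / β) • (x ^ (m - k) * z)` is a cocycle, homogeneous because `(m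
- k) * p + q = r`. Rescaling `z` normalizes the coefficient of `x ^ k`. -/
theorem exists_normal_form_of_ne_zero (h : AreGenerators K p q r x y z) (hr1 : 1 < r)
    (hdx : A.d x = 0) {α β : ℚ} {m k : ℕ} (hdy : A.d y = α • x ^ m)
    (hm : α ≠ 0 → m * p = r + 1 ∧ k ≤ m) (hβ : β ≠ 0) (hdz : A.d z = β • x ^ k)
    (hk : k * p = q + 1) (hk2 : 2 ≤ k) :
    ∃ (p q r k : ℕ) (x y z : A), AreGenerators K p q r x y z ∧ 1 < r ∧ 2 ≤ k ∧ k * p = q + 1 ∧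
      A.d x = 0 ∧ A.d y = 0 ∧ A.d z = x ^ k := by
  have hdz' : A.d (β⁻¹ • z) = x ^ k := by rw [map_smul, hdz, inv_smul_smul₀ hβ]
  by_cases hα : α = 0
  · exact ⟨p, q, r, k, x, y, β⁻¹ • z, h.smul_z (inv_ne_zero hβ), hr1, hk2, hk, hdx,
      by rw [hdy, hα, zero_smul], hdz'⟩
  · obtain ⟨hmr, hkm⟩ := hm hα
    obtain ⟨j, rfl⟩ := Nat.exists_eq_add_of_le' hkm
    rw [add_mul] at hmr
    refine ⟨p, q, r, k, x, y - (α / β) • (x ^ j * z), β⁻¹ • z,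
      (h.sub_smul (by omega) (α / β)).smul_z (inv_ne_zero hβ), hr1, hk2, hk, hdx, ?_, hdz'⟩
    rw [map_sub, map_smul, h.d_pow_mul hdx, hdy, hdz, mul_smul_comm, smul_smul,
      div_mul_cancel₀ α hβ, pow_add, sub_self]

/-- Finite-dimensional cohomology and simple connectivity force generators of `K` that can be chosen
with `dx = 0`, `dy = 0` and `dz = x ^ k`. -/
theorem exists_normal_form (h : AreGenerators K p q r x y z) (hA : A.IsFreeOn V)
    (hdK : ∀ a ∈ K, A.d a ∈ K) (hK : ∀ b, A.d b ∈ K → ∃ b₀ ∈ K, A.d b₀ = A.d b)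
    (hdx : A.d x ∈ A.pos ^ 2) (hdy : A.d y ∈ A.pos ^ 2) (hdz : A.d z ∈ A.pos ^ 2)
    (hH : A.cohomology.gr 1 = ⊥) (hfin : Module.Finite ℚ A.cohomology) :
    ∃ (p q r k : ℕ) (x y z : A), AreGenerators K p q r x y z ∧ 1 < r ∧ 2 ≤ k ∧ k * p = q + 1 ∧
      A.d x = 0 ∧ A.d y = 0 ∧ A.d z = x ^ k := by
  have h0 : ∀ a ∈ A.gr 0, ∃ s : ℚ, algebraMap ℚ A s = a := fun a =>
    exists_algebraMap_of_adjoin hA.le_pos hA.adjoin_eq_top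
  have hr1 := h.one_lt hdK hdy hdz hH h0
  have hq1 := h.swap.one_lt hdK hdz hdy hH h0
  have hdx0 := h.d_x_eq_zero hdK hdx hq1 hr1
  obtain ⟨α, m, hα, hm⟩ := h.exists_eq_smul_pow (hdK y h.y_mem_subalgebra) hdy h.odd'.add_one
    (by omega) (by omega) (A.d_mem _ _ h.y_mem)
  obtain ⟨β, n, hβ, hn⟩ := h.exists_eq_smul_pow (hdK z h.z_mem_subalgebra) hdz h.odd.add_one
    (by omega) (by omega) (A.d_mem _ _ h.z_mem)
  -- Finite cohomology excludes `α = β = 0`. The odd generator whose differential is nonzero with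
  -- the smaller exponent takes the role of `z`, if necessary after a swap.
  by_cases hβ0 : β = 0
  · have hα0 : α ≠ 0 := by
      rintro rfl
      rw [hβ0, zero_smul] at hβ
      rw [zero_smul] at hα
      exact h.not_finite_cohomology hA hK hdx0 hα hβ hfin
    exact h.swap.exists_normal_form_of_ne_zero hq1 hdx0 hβ (fun hne => absurd hβ0 hne) hα0 hα
      (hm hα0).1 (hm hα0).2
  by_cases hnm : α ≠ 0 → n ≤ m
  · exact h.exists_normal_form_of_ne_zero hr1 hdx0 hα (fun hα0 => ⟨(hm hα0).1, hnm hα0⟩) hβ0 hβ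
      (hn hβ0).1 (hn hβ0).2
  · push Not at hnm
    exact h.swap.exists_normal_form_of_ne_zero hq1 hdx0 hβ (fun _ => ⟨(hn hβ0).1, hnm.2.le⟩)
      hnm.1 hα (hm hnm.1).1 (hm hnm.1).2

end AreGenerators

/-- An algebra to which `Λ⟨x, z⟩ ⊗ Λ⟨y⟩` with `dz = x ^ k` admits a quasi-isomorphism is formal. -/
theorem isFormal_of_isQuasiIso {hp : Even p} {hq : Odd q} {hr : Odd r} {k : ℕ}
    {hD : MvPolynomial.X PUnit.unit ^ k ∈ shiftedHomogeneous (fun _ => p) 0 (q + 1)}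
    (f : Hom (model.{u} hp hq hr (MvPolynomial.X PUnit.unit ^ k) hD) A) (hf : f.IsQuasiIso) :
    A.IsFormal := by
  set D : MvPolynomial PUnit.{u + 1} ℚ := MvPolynomial.X PUnit.unit ^ k with hDdef
  have hcocycle : ∀ m : model hp hq hr D hD, (model hp hq hr D hD).d m = 0 →
      A.d (f.toAlgHom m) = 0 := fun m hm => by rw [← f.map_d, hm, map_zero]
  let cx : A.cocycles := ⟨f.toAlgHom (modelX hp hq hr D hD), hcocycle _ model_d_X⟩
  let cy : A.cocycles := ⟨f.toAlgHom (modelY hp hq hr D hD), hcocycle _ model_d_Y⟩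
  have hpow : A.cohomologyClass cx ^ k = 0 := by
    rw [← map_pow]
    refine cohomologyClass_eq_zero.mpr ⟨f.toAlgHom (modelZ hp hq hr D hD), ?_⟩
    rw [← f.map_d, model_d_Z, map_pow]
    rfl
  -- The assignment `z ↦ 0` is compatible with `dz = x ^ k` because the class of `x` has vanishing
  -- `k`-th power.
  obtain ⟨G, hGx, hGz, hGy⟩ := exists_model_hom (hp := hp) (hq := hq) (hr := hr) (k := k)
    (hD := hD) A.cohomology (x := A.cohomologyClass cx) (z := 0) (y := A.cohomologyClass cy)
    ⟨cx, f.map_mem _ _ modelX_mem, rfl⟩ (Submodule.zero_mem _)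
    ⟨cy, f.map_mem _ _ modelY_mem, rfl⟩ rfl ((map_zero _).trans hpow.symm) rfl
  have hD0 : D ≠ 0 := _root_.pow_ne_zero _ (MvPolynomial.X_ne_zero _)
  -- On cocycles `G` is `m ↦ [f m]`: they lie in `Λ⟨x, y⟩`, and the identity is multiplicative and
  -- true for `x` and `y`. So `G` induces the same map in cohomology as `f`.
  have key : ∀ m, (model hp hq hr D hD).d m = 0 → ∃ c : A.cocycles, (c : A) = f.toAlgHom m ∧
      A.cohomologyClass c = G.toAlgHom m := by
    intro m hm
    have hm' := mem_adjoin_of_model_d_eq_zero hD0 hm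
    clear hm
    induction hm' using Algebra.adjoin_induction with
    | mem m hm =>
      rcases hm with rfl | rfl
      · exact ⟨cx, rfl, hGx.symm⟩
      · exact ⟨cy, rfl, hGy.symm⟩
    | algebraMap s =>
      exact ⟨algebraMap ℚ _ s, (f.toAlgHom.commutes s).symm,
        (A.cohomologyClass.commutes s).trans (G.toAlgHom.commutes s).symm⟩
    | add m m' _ _ h h' =>
      obtain ⟨c, hc, hcG⟩ := h
      obtain ⟨c', hc', hcG'⟩ := h'
      exact ⟨c + c', by rw [map_add, ← hc, ← hc']; rfl, by rw [map_add, map_add, hcG, hcG']; rfl⟩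
    | mul m m' _ _ h h' =>
      obtain ⟨c, hc, hcG⟩ := h
      obtain ⟨c', hc', hcG'⟩ := h'
      exact ⟨c * c', by rw [map_mul, ← hc, ← hc']; rfl, by rw [map_mul, map_mul, hcG, hcG']; rfl⟩
  obtain ⟨hf1, hf2⟩ := f.isQuasiIso_iff.mp hf
  have hG : G.IsQuasiIso := by
    rw [G.isQuasiIso_iff]
    constructor
    · rintro m hm ⟨b, hb⟩
      obtain ⟨c, hc, hcG⟩ := key m hm
      refine hf1 m hm ?_
      rw [← hc]
      exact cohomologyClass_eq_zero.mp (hcG.trans hb.symm)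
    · intro b _
      obtain ⟨t, rfl⟩ := cohomologyClass_surjective b
      obtain ⟨m, hm, e, he⟩ := hf2 t t.2
      obtain ⟨c, hc, hcG⟩ := key m hm
      refine ⟨m, hm, 0, ?_⟩
      have h1 : A.cohomologyClass (t - c) = 0 :=
        cohomologyClass_eq_zero.mpr ⟨e, by rw [he, ← hc]; rfl⟩
      rw [map_sub] at h1
      rw [map_zero, ← hcG]
      exact h1.symm
  exact Relation.EqvGen.trans _ _ _ (Relation.EqvGen.symm _ _ (Relation.EqvGen.rel _ _ ⟨f, hf⟩))
    (Relation.EqvGen.rel _ _ ⟨G, hG⟩)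

end NormalForm

end CDGA

/-! ### The theorem. -/

theorem lemma02 (S : SullivanAlgebra.{u}) (hS : S.IsElliptic)
    (hodd : Module.finrank ℚ S.oddHomotopy = 2) (heven : Module.finrank ℚ S.evenHomotopy = 1) :
    S.IsFormal ∧
      ∃ (B C : CDGA.{u}) (x z : B) (y : C) (p q r k : ℕ),
        Even p ∧ Odd q ∧ Odd r ∧ 1 < r ∧ 2 ≤ k ∧
        B.IsFreelyGeneratedBy ![x, z] ![p, q] ∧ B.d x = 0 ∧ B.d z = x ^ k ∧
        C.IsFreelyGeneratedBy ![y] ![r] ∧ C.d y = 0 ∧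
        (∃ f : CDGA.Hom (B.tensor C) S.toCDGA, f.IsQuasiIso) ∧
        (S.IsMinimal → CDGA.IsIsomorphic S.toCDGA (B.tensor C)) := by
  obtain ⟨g, deg, hg⟩ := SullivanAlgebra.exists_isHomotopyBasis heven one_ne_zero
  obtain ⟨g', deg', hg'⟩ := SullivanAlgebra.exists_isHomotopyBasis hodd two_ne_zero
  have hbasis := hg.sumElim hg'
  obtain ⟨θ, hθ, x, hxgr, hxmin, hxd, hind, hadj, hmin⟩ := hbasis.exists_generators
  have hrange : Set.range x = {x (Sum.inl 0), x (Sum.inr 0), x (Sum.inr 1)} := by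
    ext a
    simp [eq_comm]
  -- Which of the two odd generators is called `y` is arbitrary at this point; the normal form may
  -- exchange them.
  have hgen : CDGA.AreGenerators hθ.minimalPart (deg 0) (deg' 1) (deg' 0) (x (Sum.inl 0))
      (x (Sum.inr 0)) (x (Sum.inr 1)) :=
    { even := hg.prop 0
      odd := hg'.prop 1
      odd' := hg'.prop 0
      pos := hg.deg_pos 0
      x_mem := hxgr (Sum.inl 0)
      y_mem := hxgr (Sum.inr 0)
      z_mem := hxgr (Sum.inr 1)
      independent := fun a b c h => by
        have h1 := hind (Sum.elim ![a] ![b, c]) (by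
          simpa [Fintype.sum_sum_type, add_assoc] using h)
        exact ⟨congrFun h1 (Sum.inl 0), congrFun h1 (Sum.inr 0), congrFun h1 (Sum.inr 1)⟩
      adjoin_eq := by
        rw [← hrange]
        refine le_antisymm (Algebra.adjoin_le ?_) hadj
        rintro _ ⟨i, rfl⟩
        exact hxmin i }
  obtain ⟨p, q, r, k, x, y, z, h, hr1, hk2, hk, hdx, hdy, hdz⟩ := hgen.exists_normal_form
    S.isFreeOn (fun a => hθ.d_mem_minimalPart) (fun b => hθ.exists_d_eq_of_mem_minimalPart)
    (hxd _) (hxd _) (hxd _) hS.simplyConnected hS.finite_cohomology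
  have hD := CDGA.X_pow_mem_shiftedHomogeneous.{u} hk
  obtain ⟨f, hfx, hfz, hfy⟩ := CDGA.exists_model_hom (hp := h.even) (hq := h.odd) (hr := h.odd')
    (hD := hD) S.toCDGA h.x_mem h.z_mem h.y_mem hdx hdz hdy
  obtain ⟨hinj, hfrange⟩ := h.injective_and_range_eq S.isFreeOn f.toAlgHom hfx hfz hfy
  have hf := hθ.isQuasiIso f hinj hfrange
  refine ⟨CDGA.isFormal_of_isQuasiIso f hf, CDGA.evenOdd h.even h.odd _ hD, CDGA.oddSphere h.odd',
    _, _, _, p, q, r, k, h.even, h.odd, h.odd', hr1, hk2,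
    CDGA.evenOdd_isFreelyGeneratedBy h.pos h.even h.odd _ hD, CDGA.koszul_d_X _, CDGA.koszul_d_eps,
    CDGA.oddSphere_isFreelyGeneratedBy h.odd', ?_, ⟨f, hf⟩, fun hS' => ?_⟩
  · rw [CDGA.koszul_d_zero, LinearMap.zero_apply]
  -- For a minimal algebra `θ = 0`, so the minimal part, which is the image of `f`, is everything.
  · refine f.isIsomorphic_symm ⟨hinj, ?_⟩
    rw [← AlgHom.range_eq_top, hfrange]
    exact hθ.minimalPart_eq_top (hmin hS')
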